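/- Let $\mathbb{T}=\mathbb{R}/2\pi\mathbb{Z}$ and $\langle a\rangle=(1+|a|^2)^{1/2}$. For functions or distributions $u(t,x,y)$ on $\mathbb{R}_t\times\mathbb{R}_x\times\mathbb{T}_y$ let $\widehat u(\tau,\xi,q)$, $(\tau,\xi,q)\in\mathbb{R}\times\mathbb{R}\times\mathbb{Z}$, be the space-time Fourier transform, and put $\sigma=\sigma(\tau,\xi,q)=\tau-\xi^3+q^2/\xi$ and $\zeta=(\xi,q)$. For $b,b_1,s\in\mathbb{R}$ define $$\|u\|_{X^{b,b_1,s}}^2=\sum_{q\in\mathbb{Z}}\int_{\mathbb{R}}\int_{\mathbb{R}}\Big\langle\frac{\langle\sigma\rangle}{\langle\xi\rangle^3}\Big\rangle^{2b_1}\langle\zeta\rangle^{2s}\langle\sigma\rangle^{2b}\,|\widehat u(\tau,\xi,q)|^2\,d\tau\,d\xi,$$ $$\|u\|_{Z^{b,s}}=\big\|\langle\sigma\rangle^{b-\frac12}\langle\zeta\rangle^{s}\,\widehat u\big\|_{L^2_{\zeta}L^1_{\tau}}=\Big(\sum_{q\in\mathbb{Z}}\int_{\mathbb{R}}\Big(\int_{\mathbb{R}}\langle\sigma\rangle^{b-\frac12}\langle\zeta\rangle^{s}|\widehat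 u(\tau,\xi,q)|\,d\tau\Big)^2d\xi\Big)^{1/2}.$$ Proposition. There exist $\beta<1/2$ and $b_1$ with $1/4<b_1<3/8$ such that for every $s\ge 0$ there is a constant $C$ such that for all $u,v\in X^{1/2,b_1,s}$ $$\|\partial_x(uv)\|_{X^{-1/2,b_1,s}}\le C\big(\|u\|_{X^{1/2,b_1,s}}\|v\|_{X^{\beta,0,s}}+\|u\|_{X^{\beta,0,s}}\|v\|_{X^{1/2,b_1,s}}\big)$$ and $$\|\partial_x(uv)\|_{Z^{-1/2,s}}\le C\big(\|u\|_{X^{1/2,b_1,s}}\|v\|_{X^{\beta,0,s}}+\|u\|_{X^{\beta,0,s}}\|v\|_{X^{1/2,b_1,s}}\big).$$ -/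

import Mathlib

open MeasureTheory Real
open scoped ENNReal NNReal SchwartzMap FourierTransform LineDeriv

noncomputable section

/-! ### The space-time domain `ℝ_t × ℝ_x × 𝕋_y`, with `𝕋 = ℝ / 2πℤ` -/

instance factTwoPiPos : Fact (0 < 2 * π) := ⟨Real.two_pi_pos⟩

/-- The plane of the variables `(t, x)`: `p 0 = t` and `p 1 = x`. -/
abbrev Plane : Type := EuclideanSpace ℝ (Fin 2)

/-- The torus `𝕋_y = ℝ / 2πℤ`. -/
abbrev Torus : Type := AddCircle (2 * π)

/-- Space-time `ℝ_t × ℝ_x × 𝕋_y`; a point is `((t, x), y)`. -/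
abbrev SpaceTime : Type := Plane × Torus

/-- Lebesgue measure in `(t, x)` times the normalised Haar measure `dy / 2π` in `y`. -/
def stMeasure : Measure SpaceTime :=
  (volume : Measure Plane).prod AddCircle.haarAddCircle

/-! ### Distributions -/

/-- A distribution on `ℝ_t × ℝ_x × 𝕋_y`, tempered in `(t, x)`, given by its Fourier coefficients in
`y`: `T q` is the coefficient of `e^{iqy}`, that is, `T q φ` is the value of the distribution on the
test function `φ(t, x) e^{-iqy}`. -/
abbrev STDistribution : Type := ℤ → 𝓢'(Plane, ℂ)

theorem measurePreserving_fst_stMeasure :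
    MeasurePreserving (Prod.fst : SpaceTime → Plane) stMeasure volume :=
  measurePreserving_fst

theorem memLp_fourier_mul {p : ℝ≥0∞} {w : SpaceTime → ℂ} (hw : MemLp w p stMeasure) (q : ℤ) :
    MemLp (fun z : SpaceTime => fourier (-q) z.2 * w z) p stMeasure := by
  have hc : Continuous (fun z : SpaceTime => (fourier (-q) z.2 : ℂ)) :=
    (fourier (-q)).continuous.comp continuous_snd
  refine hw.of_le (hc.aestronglyMeasurable.mul hw.1) (Filter.Eventually.of_forall fun z => ?_)
  rw [norm_mul, fourier_apply, Circle.norm_coe, one_mul]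

/-- The distribution defined by an `L^p` function `w` on space-time: see `ofFunction_apply`. -/
def ofFunction {p : ℝ≥0∞} [hp : Fact (1 ≤ p)] {w : SpaceTime → ℂ}
    (hw : MemLp w p stMeasure) : STDistribution := fun q =>
  haveI := ENNReal.HolderConjugate.inv_one_sub_inv' hp.out
  haveI : Fact (1 ≤ (1 - p⁻¹)⁻¹) := by simp [fact_iff]
  ContinuousLinearMap.toPointwiseConvergenceCLM _ _ _ _ <|
    ((ContinuousLinearMap.mul ℂ ℂ).lpPairing stMeasure p (1 - p⁻¹)⁻¹
        ((memLp_fourier_mul hw q).toLp _)) ∘L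
      (Lp.compMeasurePreservingₗᵢ ℂ (Prod.fst : SpaceTime → Plane)
        measurePreserving_fst_stMeasure).toContinuousLinearMap ∘L
      SchwartzMap.toLpCLM ℂ ℂ (1 - p⁻¹)⁻¹ volume

theorem ofFunction_apply {p : ℝ≥0∞} [hp : Fact (1 ≤ p)] {w : SpaceTime → ℂ}
    (hw : MemLp w p stMeasure) (q : ℤ) (φ : 𝓢(Plane, ℂ)) :
    ofFunction hw q φ = ∫ z : SpaceTime, φ z.1 * fourier (-q) z.2 * w z ∂stMeasure := by
  have := ENNReal.HolderConjugate.inv_one_sub_inv' hp.out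
  have : Fact (1 ≤ (1 - p⁻¹)⁻¹) := by simp [fact_iff]
  have h1 : ofFunction hw q φ = ∫ z : SpaceTime, ((memLp_fourier_mul hw q).toLp _) z *
      (Lp.compMeasurePreserving (Prod.fst : SpaceTime → Plane) measurePreserving_fst_stMeasure
        (φ.toLp (1 - p⁻¹)⁻¹ volume)) z ∂stMeasure :=
    ContinuousLinearMap.lpPairing_eq_integral (ContinuousLinearMap.mul ℂ ℂ) _ _
  rw [h1]
  refine integral_congr_ae ?_
  filter_upwards [(memLp_fourier_mul hw q).coeFn_toLp,
    Lp.coeFn_compMeasurePreserving (φ.toLp (1 - p⁻¹)⁻¹ volume) measurePreserving_fst_stMeasure,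
    measurePreserving_fst_stMeasure.quasiMeasurePreserving.ae_eq_comp
      (φ.coeFn_toLp (1 - p⁻¹)⁻¹ volume)] with z e1 e2 e3
  rw [e1, e2, e3]
  simp only [Function.comp_apply]
  ring

/-- The distributional derivative `∂_x`. -/
def dx (T : STDistribution) : STDistribution := fun q =>
  ∂_{(EuclideanSpace.single 1 1 : Plane)} (T q)

/-- The measurable function `F(τ, ξ, q)` on `ℝ_τ × ℝ_ξ × ℤ_q` is the Fourier transform of the
distribution `T`, with the convention
`F(τ, ξ, q) = (2π)⁻¹ ∫∫∫ T(t, x, y) e^{-i(tτ + xξ + qy)} dt dx dy`. Mathlib's Fourier transform in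
`(t, x)` uses the phase `e^{-2πi(...)}`, hence the dilation `(τ, ξ) = 2πp`. -/
def IsFourierTransform (T : STDistribution) (F : ℝ → ℝ → ℤ → ℂ) : Prop :=
  ∀ q : ℤ, Measurable (fun z : ℝ × ℝ => F z.1 z.2 q) ∧
    ∀ φ : 𝓢(Plane, ℂ),
      Integrable (fun p : Plane => φ p * F (2 * π * p 0) (2 * π * p 1) q) ∧
      𝓕 (T q) φ = ∫ p : Plane, φ p * F (2 * π * p 0) (2 * π * p 1) q

/-! ### Bourgain spaces -/

/-- The bracket `⟨x⟩ = (1 + |x|²)^{1/2}`. -/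
def jap (x : ℝ) : ℝ := √(1 + x ^ 2)

/-- The bracket `⟨ζ⟩`, `ζ = (ξ, q)`. -/
def japZeta (ξ : ℝ) (q : ℤ) : ℝ := √(1 + (ξ ^ 2 + (q : ℝ) ^ 2))

/-- The modulation `σ(τ, ξ, q) = τ - ξ³ + q²/ξ` (the null set `ξ = 0` plays no role). -/
def modulation (τ ξ : ℝ) (q : ℤ) : ℝ := τ - ξ ^ 3 + (q : ℝ) ^ 2 / ξ

/-- The square of the weight in the norm of `X^{b,b₁,s}`. -/
def weightX (b b₁ s τ ξ : ℝ) (q : ℤ) : ℝ :=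
  jap (jap (modulation τ ξ q) / jap ξ ^ 3) ^ (2 * b₁) * japZeta ξ q ^ (2 * s) *
    jap (modulation τ ξ q) ^ (2 * b)

/-- The norm of `X^{b,b₁,s}`; it is `∞` when the Fourier transform is not a function. (The function
`F` is unique up to null sets, so that the infimum only selects it.) -/
def normX (b b₁ s : ℝ) (T : STDistribution) : ℝ≥0∞ :=
  ⨅ (F : ℝ → ℝ → ℤ → ℂ) (_ : IsFourierTransform T F),
    (∑' q : ℤ, ∫⁻ ξ : ℝ, ∫⁻ τ : ℝ,
      ENNReal.ofReal (weightX b b₁ s τ ξ q) * ‖F τ ξ q‖ₑ ^ 2) ^ (1 / 2 : ℝ)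

/-- The norm `‖⟨σ⟩^{b-1/2} ⟨ζ⟩^s F‖_{L²_ζ L¹_τ}` of `Z^{b,s}`, `F` being the Fourier transform; it is
`∞` when the Fourier transform is not a function. -/
def normZ (b s : ℝ) (T : STDistribution) : ℝ≥0∞ :=
  ⨅ (F : ℝ → ℝ → ℤ → ℂ) (_ : IsFourierTransform T F),
    (∑' q : ℤ, ∫⁻ ξ : ℝ, (∫⁻ τ : ℝ,
      ENNReal.ofReal (jap (modulation τ ξ q) ^ (b - 1 / 2) * japZeta ξ q ^ s) *
        ‖F τ ξ q‖ₑ) ^ 2) ^ (1 / 2 : ℝ)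

end

/-! The estimate rests on the resonance identity `modul_add_modul_sub`. If the output has frequency
(ξ, q) and the inputs have x-frequencies n and ξ − n, then σ₁ + σ₂ − σ = 3ξn(ξ − n) + ξ(k −
qn/ξ)²/(n(ξ − n)), and both terms on the right have the same sign. Hence the largest of the three
modulations is at least |ξn(ξ − n)| (`abs_mul_le_abs_resonance`), and this gain pays for the
derivative. The exponents are β = 15/32 and b₁ = 1/3.

On the Fourier side, once ⟨ζ⟩^s has been distributed over the inputs, the X estimate is the L²
boundedness of bilinear operators with kernel K(z, a)^{1/2} (`BilinearBounded`). By Cauchy–Schwarz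
it suffices that ∫ K(z, a) da is bounded in z, or, by transposition, ∫ K(z, a) dz in a. In such an
integral the τ-variable gives a convolution of brackets, the discrete variable gives a sum of
brackets of a quadratic polynomial (`exists_tsum_jap_quadratic_le`), and a one-dimensional integral
over n remains (`exists_lintegral_frequency_mul_jap_modul_le`).

Three majorants cover all interactions (`outputKernel_le`, `inputKernel_le`). If the dominant
modulation sits at a frequency comparable to the largest one, the inequality |ξn(ξ − n)| ≤ |σ|
confines n to small neighbourhoods of 0 and ξ, and Cauchy–Schwarz is enough
(`bilinearBounded_comparableKernel`). Otherwise it sits at the smallest frequency, and the two large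
ones face each other with opposite signs; n is then unbounded, and one uses that uv and u v̄ have
the same modulus: after reflecting one factor the large frequencies add up
(`lintegral_sq_bilinear_le_of_reflected`, `bilinearBounded_highHighLowKernel`). If moreover the
dominant modulation belongs to an input of frequency at most 1, the weight ⟨⟨σ⟩/⟨ξ⟩³⟩^{b₁} of that
input supplies the missing decay (`bilinearBounded_lowKernel`).

For the Z norm, a dominant input is reduced to the same kernel by Cauchy–Schwarz in τ, and a
dominant output is treated by Cauchy–Schwarz in τ and the input variable together
(`exists_lintegral_outputKernelL1_le`).

It remains to know that the Fourier transform of ∂ₓ(uv) is iξ times the convolution of the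
transforms (`isFourierTransform_dx_mul`). Since u and v are square integrable, this follows from
Parseval's identity in y and from the multiplication formula in (t, x). -/

noncomputable section

/-! ### The Japanese bracket -/

theorem one_le_jap (x : ℝ) : 1 ≤ jap x := by
  rw [jap, Real.one_le_sqrt]; nlinarith [sq_nonneg x]

theorem jap_pos (x : ℝ) : 0 < jap x := zero_lt_one.trans_le (one_le_jap x)

theorem jap_nonneg (x : ℝ) : 0 ≤ jap x := (jap_pos x).le

theorem jap_sq (x : ℝ) : jap x ^ 2 = 1 + x ^ 2 := Real.sq_sqrt (by positivity)

theorem abs_le_jap (x : ℝ) : |x| ≤ jap x :=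
  Real.abs_le_sqrt (by linarith)

theorem jap_le_one_add_abs (x : ℝ) : jap x ≤ 1 + |x| := by
  rw [jap, Real.sqrt_le_left (by positivity)]
  nlinarith [abs_nonneg x, sq_abs x]

theorem jap_neg (x : ℝ) : jap (-x) = jap x := by simp [jap]

theorem jap_mono {x y : ℝ} (h : |x| ≤ |y|) : jap x ≤ jap y :=
  Real.sqrt_le_sqrt (by nlinarith [sq_abs x, sq_abs y, abs_nonneg x])

theorem continuous_jap : Continuous jap := by unfold jap; fun_prop

@[fun_prop]
theorem measurable_jap : Measurable jap := continuous_jap.measurable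

theorem jap_add_le (x y : ℝ) : jap (x + y) ≤ jap x + jap y := by
  refine (sq_le_sq₀ (jap_nonneg _) (add_nonneg (jap_nonneg x) (jap_nonneg y))).1 ?_
  have : |x| * |y| ≤ jap x * jap y :=
    mul_le_mul (abs_le_jap x) (abs_le_jap y) (abs_nonneg y) (jap_nonneg x)
  have h2 : x * y ≤ |x| * |y| := by rw [← abs_mul]; exact le_abs_self _
  nlinarith [jap_sq x, jap_sq y, jap_sq (x + y)]

theorem jap_sub_le (x y : ℝ) : jap (x - y) ≤ jap x + jap y := by
  simpa [sub_eq_add_neg, jap_neg] using jap_add_le x (-y)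

/-- A homogeneous lower bound for the bracket up to a scaling of the argument. -/
theorem jap_mul_le {c : ℝ} (hc : 1 ≤ c) (x : ℝ) : jap (c * x) ≤ c * jap x := by
  refine (sq_le_sq₀ (jap_nonneg _) (mul_nonneg (by linarith) (jap_nonneg x))).1 ?_
  rw [mul_pow, jap_sq, jap_sq]
  nlinarith [sq_nonneg x]

theorem rpow_neg_jap_le_one (x : ℝ) {p : ℝ} (hp : 0 ≤ p) : jap x ^ (-p) ≤ 1 :=
  Real.rpow_le_one_of_one_le_of_nonpos (one_le_jap x) (by linarith)

theorem jap_rpow_neg_anti {x y p : ℝ} (hp : 0 ≤ p) (h : |x| ≤ |y|) :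
    jap y ^ (-p) ≤ jap x ^ (-p) :=
  Real.rpow_le_rpow_of_nonpos (jap_pos x) (jap_mono h) (by linarith)

theorem jap_rpow_neg_mono_exp {p q : ℝ} (h : p ≤ q) (x : ℝ) : jap x ^ (-q) ≤ jap x ^ (-p) :=
  Real.rpow_le_rpow_of_exponent_le (one_le_jap x) (by linarith)

/-! ### Integrals of powers -/

/-- Replacing the larger base by the smaller one increases the product, which becomes a single
power. -/
theorem rpow_neg_mul_rpow_neg_le {x y p q : ℝ} (hx : 0 < x) (hy : 0 < y) (hp : 0 ≤ p)
    (hq : 0 ≤ q) : x ^ (-p) * y ^ (-q) ≤ x ^ (-(p + q)) + y ^ (-(p + q)) := by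
  rcases le_total x y with h | h
  · have h1 : y ^ (-q) ≤ x ^ (-q) := Real.rpow_le_rpow_of_nonpos hx h (by linarith)
    have h2 : x ^ (-(p + q)) = x ^ (-p) * x ^ (-q) := by
      rw [← Real.rpow_add hx]; congr 1; ring
    have := Real.rpow_nonneg hy.le (-(p + q))
    have := mul_le_mul_of_nonneg_left h1 (Real.rpow_nonneg hx.le (-p))
    linarith
  · have h1 : x ^ (-p) ≤ y ^ (-p) := Real.rpow_le_rpow_of_nonpos hy h (by linarith)
    have h2 : y ^ (-(p + q)) = y ^ (-p) * y ^ (-q) := by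
      rw [← Real.rpow_add hy]; congr 1; ring
    have := Real.rpow_nonneg hx.le (-(p + q))
    have := mul_le_mul_of_nonneg_right h1 (Real.rpow_nonneg hy.le (-q))
    linarith

theorem exists_lintegral_jap_rpow_le {p : ℝ} (hp : 1 < p) :
    ∃ C : ℝ≥0, ∀ u : ℝ, ∫⁻ x : ℝ, ENNReal.ofReal (jap (x - u) ^ (-p)) ≤ C := by
  have hi : Integrable (fun x : ℝ => jap x ^ (-p)) := by
    have := integrable_rpow_neg_one_add_norm_sq (E := ℝ) (μ := volume) (r := p) (by simpa using hp)
    refine this.congr (Filter.Eventually.of_forall fun x => ?_)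
    simp only [jap, Real.norm_eq_abs, sq_abs]
    rw [Real.sqrt_eq_rpow, ← Real.rpow_mul (by positivity)]
    congr 1; ring
  refine ⟨(∫⁻ x : ℝ, ENNReal.ofReal (jap x ^ (-p))).toNNReal, fun u => ?_⟩
  rw [lintegral_sub_right_eq_self (fun x => ENNReal.ofReal (jap x ^ (-p))) u,
    ENNReal.coe_toNNReal]
  exact hi.lintegral_lt_top.ne

/-- Convolution of two powers of the bracket. -/
theorem exists_lintegral_jap_mul_jap_le {A B c : ℝ} (hc : 0 ≤ c) (hA : c ≤ A) (hB : c ≤ B)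
    (h : 1 < A + B - c) : ∃ C : ℝ≥0, ∀ u v : ℝ,
      ∫⁻ x : ℝ, ENNReal.ofReal (jap (x - u) ^ (-A) * jap (x - v) ^ (-B)) ≤
        C * ENNReal.ofReal (jap (u - v) ^ (-c)) := by
  obtain ⟨C, hC⟩ := exists_lintegral_jap_rpow_le h
  refine ⟨Real.toNNReal (2 ^ c * 2) * (C + C), fun u v => ?_⟩
  -- Since ⟨u − v⟩ ≤ X + Y, the factor ⟨u − v⟩^c, moved to the left, splits into X^c and Y^c. Each
  -- lowers one exponent by c, which is why c ≤ A and c ≤ B are needed, and the remaining total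
  -- exponent A + B − c is integrable.
  have key : ∀ x : ℝ, jap (x - u) ^ (-A) * jap (x - v) ^ (-B) ≤ (2 ^ c * 2) *
      jap (u - v) ^ (-c) * (jap (x - u) ^ (-(A + B - c)) + jap (x - v) ^ (-(A + B - c))) := by
    intro x
    set X := jap (x - u) with hXdef
    set Y := jap (x - v) with hYdef
    have hX : 0 < X := jap_pos _
    have hY : 0 < Y := jap_pos _
    have hD : 0 < jap (u - v) := jap_pos _
    have h1 : jap (u - v) ≤ X + Y := by
      have : u - v = (x - v) - (x - u) := by ring
      rw [this, add_comm]; exact jap_sub_le _ _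
    have h2 : jap (u - v) ^ c ≤ 2 ^ c * (X ^ c + Y ^ c) := by
      have hm : jap (u - v) ≤ 2 * max X Y := by
        linarith [le_max_left X Y, le_max_right X Y]
      calc jap (u - v) ^ c ≤ (2 * max X Y) ^ c := Real.rpow_le_rpow hD.le hm hc
        _ = 2 ^ c * (max X Y) ^ c := Real.mul_rpow (by norm_num) (by positivity)
        _ ≤ _ := by
          gcongr
          have := Real.rpow_nonneg hX.le c
          have := Real.rpow_nonneg hY.le c
          rcases max_cases X Y with ⟨e, -⟩ | ⟨e, -⟩ <;> rw [e] <;> linarith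
    have hAB : X ^ c * (X ^ (-A) * Y ^ (-B)) ≤ X ^ (-(A + B - c)) + Y ^ (-(A + B - c)) := by
      have := rpow_neg_mul_rpow_neg_le hX hY (p := A - c) (q := B) (by linarith) (by linarith)
      rw [← mul_assoc, ← Real.rpow_add hX]
      convert this using 2 <;> ring_nf
    have hBA : Y ^ c * (X ^ (-A) * Y ^ (-B)) ≤ X ^ (-(A + B - c)) + Y ^ (-(A + B - c)) := by
      have := rpow_neg_mul_rpow_neg_le hX hY (p := A) (q := B - c) (by linarith) (by linarith)
      rw [mul_left_comm, ← Real.rpow_add hY]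
      convert this using 2 <;> ring_nf
    have h3 : jap (u - v) ^ c * (X ^ (-A) * Y ^ (-B)) ≤
        2 ^ c * 2 * (X ^ (-(A + B - c)) + Y ^ (-(A + B - c))) := by
      have h4 := mul_le_mul_of_nonneg_right h2
        (mul_nonneg (Real.rpow_nonneg hX.le (-A)) (Real.rpow_nonneg hY.le (-B)))
      have h5 : (0:ℝ) < 2 ^ c := by positivity
      nlinarith
    rw [Real.rpow_neg hD.le c, mul_right_comm, ← div_eq_mul_inv,
      le_div_iff₀ (Real.rpow_pos_of_pos hD c)]
    linarith
  calc ∫⁻ x : ℝ, ENNReal.ofReal (jap (x - u) ^ (-A) * jap (x - v) ^ (-B))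
      ≤ ∫⁻ x : ℝ, ENNReal.ofReal (2 ^ c * 2 * jap (u - v) ^ (-c)) *
        (ENNReal.ofReal (jap (x - u) ^ (-(A + B - c))) +
          ENNReal.ofReal (jap (x - v) ^ (-(A + B - c)))) := by
        refine lintegral_mono fun x => ?_
        have := jap_pos (u - v); have := jap_pos (x - u); have := jap_pos (x - v)
        rw [← ENNReal.ofReal_add (by positivity) (by positivity),
          ← ENNReal.ofReal_mul (by positivity)]
        exact ENNReal.ofReal_le_ofReal (key x)
    _ = ENNReal.ofReal (2 ^ c * 2 * jap (u - v) ^ (-c)) *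
        ((∫⁻ x : ℝ, ENNReal.ofReal (jap (x - u) ^ (-(A + B - c)))) +
          ∫⁻ x : ℝ, ENNReal.ofReal (jap (x - v) ^ (-(A + B - c)))) := by
        rw [lintegral_const_mul _ (by fun_prop), lintegral_add_left (by fun_prop)]
    _ ≤ ENNReal.ofReal (2 ^ c * 2 * jap (u - v) ^ (-c)) * (C + C) := by
        gcongr <;> apply hC
    _ = _ := by
        rw [ENNReal.ofReal_mul (by positivity)]
        rw [ENNReal.ofReal]; push_cast; ring

theorem lintegral_Ioc_rpow_neg {s R : ℝ} (hs : s < 1) (hR : 0 ≤ R) :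
    ∫⁻ x in Set.Ioc 0 R, ENNReal.ofReal (x ^ (-s)) = ENNReal.ofReal (R ^ (1 - s) / (1 - s)) := by
  rw [← ofReal_integral_eq_lintegral_ofReal, ← intervalIntegral.integral_of_le hR,
    integral_rpow (Or.inl (by linarith))]
  · rw [Real.zero_rpow (by linarith)]; congr 1; ring_nf
  · exact (intervalIntegrable_iff_integrableOn_Ioc_of_le hR).1
      (intervalIntegral.intervalIntegrable_rpow' (by linarith))
  · filter_upwards [ae_restrict_mem measurableSet_Ioc] with x hx
    exact Real.rpow_nonneg hx.1.le _

theorem lintegral_Ioi_rpow_neg {s R : ℝ} (hs : 1 < s) (hR : 0 < R) :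
    ∫⁻ x in Set.Ioi R, ENNReal.ofReal (x ^ (-s)) = ENNReal.ofReal (R ^ (1 - s) / (s - 1)) := by
  rw [← ofReal_integral_eq_lintegral_ofReal, integral_Ioi_rpow_of_lt (by linarith) hR]
  · congr 1
    rw [show -s + 1 = -(s - 1) by ring, neg_div_neg_eq]; ring_nf
  · exact integrableOn_Ioi_rpow_of_lt (by linarith) hR
  · filter_upwards [ae_restrict_mem measurableSet_Ioi] with x hx
    exact Real.rpow_nonneg (hR.le.trans (le_of_lt hx)) _

/-! ### Sums over the integers -/

/-- For t in [k, k + 1) one has |t − x| − 1 ≤ |k − x|, so each term is at most the integral of g((|t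
− x| − 1)₊) over that interval. The plateau |t − x| ≤ 1 accounts for the term 2 g(0). -/
theorem tsum_int_le_lintegral {g : ℝ → ℝ≥0∞} (hg : Measurable g)
    (hanti : ∀ s t, 0 ≤ s → s ≤ t → g t ≤ g s) (x : ℝ) :
    ∑' k : ℤ, g |k - x| ≤ 2 * g 0 + 2 * ∫⁻ t in Set.Ioi 0, g t := by
  set J : ℝ → ℝ≥0∞ := (Set.Ioi 0).indicator g with hJ
  have hJm : Measurable J := hg.indicator measurableSet_Ioi
  set I : ℝ → ℝ≥0∞ := fun y => (Set.Icc (0:ℝ) 1).indicator (fun _ => g 0) y + J (y - 1) with hI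
  have hIm : Measurable I := (measurable_const.indicator measurableSet_Icc).add (by fun_prop)
  have hIint : ∫⁻ y, I y = g 0 + ∫⁻ t in Set.Ioi 0, g t := by
    rw [hI, lintegral_add_right _ (by fun_prop), lintegral_indicator measurableSet_Icc,
      lintegral_sub_right_eq_self J 1, hJ, lintegral_indicator measurableSet_Ioi]
    simp
  have hpt : ∀ y : ℝ, g (max (|y| - 1) 0) ≤ I y + I (-y) := by
    have h0 : ∀ y : ℝ, 0 ≤ y → g (max (y - 1) 0) ≤ I y := by
      intro y hy
      simp only [hI, hJ]
      rcases le_or_gt y 1 with h | h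
      · rw [Set.indicator_of_mem (show y ∈ Set.Icc (0:ℝ) 1 from ⟨hy, h⟩),
          max_eq_right (by linarith)]
        exact le_self_add
      · rw [Set.indicator_of_mem (show y - 1 ∈ Set.Ioi (0:ℝ) by simpa using h),
          max_eq_left (by linarith)]
        exact le_add_self
    intro y
    rcases le_total 0 y with h | h
    · rw [abs_of_nonneg h]; exact (h0 y h).trans le_self_add
    · rw [abs_of_nonpos h]; exact (h0 (-y) (by linarith)).trans le_add_self
  have hk : ∀ k : ℤ, g |k - x| ≤ ∫⁻ t in Set.Ico (k:ℝ) (k + 1), g (max (|t - x| - 1) 0) := by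
    intro k
    calc g |k - x| = ∫⁻ t in Set.Ico (k:ℝ) (k + 1), g |k - x| := by simp
      _ ≤ _ := by
        refine setLIntegral_mono' measurableSet_Ico fun t ht => hanti _ _ (le_max_right _ _) ?_
        refine max_le ?_ (abs_nonneg _)
        have : |t - k| ≤ 1 := abs_le.2 ⟨by linarith [ht.1], by linarith [ht.2]⟩
        have h2 : |t - x| ≤ |t - k| + |k - x| := abs_sub_le _ _ _
        linarith
  calc ∑' k : ℤ, g |k - x|
      ≤ ∑' k : ℤ, ∫⁻ t in Set.Ico (k:ℝ) (k + 1), g (max (|t - x| - 1) 0) :=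
        ENNReal.tsum_le_tsum hk
    _ = ∫⁻ t : ℝ, g (max (|t - x| - 1) 0) := by
        rw [← lintegral_iUnion (fun k => measurableSet_Ico) (Set.pairwise_disjoint_Ico_intCast ℝ),
          iUnion_Ico_intCast, Measure.restrict_univ]
    _ ≤ ∫⁻ t : ℝ, (I (t - x) + I (-(t - x))) := lintegral_mono fun t => hpt (t - x)
    _ = 2 * g 0 + 2 * ∫⁻ t in Set.Ioi 0, g t := by
        rw [lintegral_sub_right_eq_self (fun y => I y + I (-y)) x,
          lintegral_add_left hIm, lintegral_neg_eq_self I, hIint]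
        ring

/-- Half-line integral of a bracket of a quadratic expression. -/
theorem lintegral_Ioi_jap_max_le {γ A D : ℝ} (h1 : 1 / 2 < γ) (h2 : γ < 1) (hA : 0 < A) :
    ∫⁻ t in Set.Ioi 0, ENNReal.ofReal (jap (max (√D * (A * t)) ((A * t) ^ 2)) ^ (-γ)) ≤
      ENNReal.ofReal ((1 / (1 - γ) + 1 / (2 * γ - 1)) * (A⁻¹ * max D 1 ^ (1 / 2 - γ))) := by
  set M := max D 1 with hM
  have hM1 : 1 ≤ M := le_max_right _ _
  have hM0 : 0 < M := by linarith
  -- At t = T the bounds √M·At and (At)² coincide. The linear bound is used below T, where γ < 1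
  -- gives integrability at 0, and the quadratic one above T, where 2γ > 1 gives integrability at
  -- infinity.
  set T := √M / A with hT
  have hsM : 0 < √M := Real.sqrt_pos.2 hM0
  have hT0 : 0 < T := by positivity
  have hsplit : Set.Ioi (0:ℝ) = Set.Ioc 0 T ∪ Set.Ioi T := (Set.Ioc_union_Ioi_eq_Ioi hT0.le).symm
  have ha : ∀ t ∈ Set.Ioc 0 T, ENNReal.ofReal (jap (max (√D * (A * t)) ((A * t) ^ 2)) ^ (-γ)) ≤
      ENNReal.ofReal ((√M * A) ^ (-γ)) * ENNReal.ofReal (t ^ (-γ)) := by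
    intro t ht
    have ht0 : 0 < t := ht.1
    rw [← ENNReal.ofReal_mul (by positivity), ← Real.mul_rpow (by positivity) ht0.le]
    refine ENNReal.ofReal_le_ofReal ?_
    rcases le_total 1 D with hD1 | hD1
    · have : M = D := max_eq_left hD1
      refine Real.rpow_le_rpow_of_nonpos (by positivity) ?_ (by linarith)
      calc √M * A * t ≤ max (√D * (A * t)) ((A * t) ^ 2) := by
            rw [this, mul_assoc]; exact le_max_left _ _
        _ ≤ _ := (le_abs_self _).trans (abs_le_jap _)
    · have : M = 1 := max_eq_right hD1
      have hAt : A * t ≤ 1 := by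
        have := ht.2
        rw [hT, le_div_iff₀ hA] at this
        rw [‹M = 1›] at this; simp only [Real.sqrt_one] at this; linarith
      calc _ ≤ (1:ℝ) := rpow_neg_jap_le_one _ (by linarith)
        _ ≤ _ := by
          apply Real.one_le_rpow_of_pos_of_le_one_of_nonpos (by positivity) _ (by linarith)
          rw [‹M = 1›]; simpa using hAt
  have hb : ∀ t ∈ Set.Ioi T, ENNReal.ofReal (jap (max (√D * (A * t)) ((A * t) ^ 2)) ^ (-γ)) ≤
      ENNReal.ofReal (A ^ (-(2 * γ))) * ENNReal.ofReal (t ^ (-(2 * γ))) := by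
    intro t ht
    have ht0 : 0 < t := hT0.trans ht
    rw [← ENNReal.ofReal_mul (by positivity), ← Real.mul_rpow hA.le ht0.le]
    refine ENNReal.ofReal_le_ofReal ?_
    rw [show -(2 * γ) = 2 * (-γ) by ring, Real.rpow_mul (by positivity)]
    refine Real.rpow_le_rpow_of_nonpos (by positivity) ?_ (by linarith)
    calc (A * t) ^ (2:ℝ) ≤ max (√D * (A * t)) ((A * t) ^ 2) := by
          rw [Real.rpow_two]; exact le_max_right _ _
      _ ≤ _ := (le_abs_self _).trans (abs_le_jap _)
  rw [hsplit, lintegral_union measurableSet_Ioi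
    (Set.disjoint_left.2 fun x hx hx' => not_lt.2 hx.2 hx')]
  refine (add_le_add (setLIntegral_mono' measurableSet_Ioc ha)
    (setLIntegral_mono' measurableSet_Ioi hb)).trans ?_
  rw [lintegral_const_mul _ (by fun_prop), lintegral_const_mul _ (by fun_prop),
    lintegral_Ioc_rpow_neg h2 hT0.le, lintegral_Ioi_rpow_neg (by linarith) hT0,
    ← ENNReal.ofReal_mul (by positivity), ← ENNReal.ofReal_mul (by positivity),
    ← ENNReal.ofReal_add]
  rotate_left
  · have : 0 < 1 - γ := by linarith
    positivity
  · have : 0 < 2 * γ - 1 := by linarith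
    positivity
  refine ENNReal.ofReal_le_ofReal (le_of_eq ?_)
  have e1 : (√M * A) ^ (-γ) * T ^ (1 - γ) = A⁻¹ * M ^ (1 / 2 - γ) := by
    rw [hT, Real.div_rpow hsM.le hA.le, Real.mul_rpow hsM.le hA.le, Real.sqrt_eq_rpow,
      ← Real.rpow_mul hM0.le, ← Real.rpow_mul hM0.le, div_eq_mul_inv (M ^ _), ← Real.rpow_neg hA.le,
      show M ^ (1 / 2 * -γ) * A ^ (-γ) * (M ^ (1 / 2 * (1 - γ)) * A ^ (-(1 - γ))) =
        (A ^ (-γ) * A ^ (-(1 - γ))) * (M ^ (1 / 2 * -γ) * M ^ (1 / 2 * (1 - γ))) by ring,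
      ← Real.rpow_add hA, ← Real.rpow_add hM0, ← Real.rpow_neg_one]
    congr 2 <;> ring
  have e2 : A ^ (-(2 * γ)) * T ^ (1 - 2 * γ) = A⁻¹ * M ^ (1 / 2 - γ) := by
    rw [hT, Real.div_rpow hsM.le hA.le, Real.sqrt_eq_rpow,
      ← Real.rpow_mul hM0.le, div_eq_mul_inv (M ^ _), ← Real.rpow_neg hA.le,
      show A ^ (-(2 * γ)) * (M ^ (1 / 2 * (1 - 2 * γ)) * A ^ (-(1 - 2 * γ))) =
        (A ^ (-(2 * γ)) * A ^ (-(1 - 2 * γ))) * (M ^ (1 / 2 * (1 - 2 * γ))) by ring,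
      ← Real.rpow_add hA, ← Real.rpow_neg_one]
    congr 2 <;> ring
  rw [mul_div_assoc', mul_div_assoc', e1, e2]; ring

/-- A sum of brackets of a quadratic polynomial over the integers. -/
theorem exists_tsum_jap_quadratic_le {γ : ℝ} (h1 : 1 / 2 < γ) (h2 : γ < 1) :
    ∃ C : ℝ≥0, ∀ a d c : ℝ, a ≠ 0 →
      ∑' k : ℤ, ENNReal.ofReal (jap (d + a * (k - c) ^ 2) ^ (-γ)) ≤
        C * (1 + ENNReal.ofReal (|a| ^ (-(1 / 2) : ℝ) * jap d ^ (1 / 2 - γ))) := by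
  set κ := (1 / (1 - γ) + 1 / (2 * γ - 1)) * 2 ^ (γ - 1 / 2) with hκ
  have hκ0 : 0 ≤ κ := by
    have : 0 < 1 - γ := by linarith
    have : 0 < 2 * γ - 1 := by linarith
    positivity
  have hpos : ∀ a d c : ℝ, 0 < a →
      ∑' k : ℤ, ENNReal.ofReal (jap (d + a * (k - c) ^ 2) ^ (-γ)) ≤
        (4 + 4 * Real.toNNReal κ : ℝ≥0) *
          (1 + ENNReal.ofReal (|a| ^ (-(1 / 2) : ℝ) * jap d ^ (1 / 2 - γ))) := by
    intro a d c ha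
    set A := √a with hA
    have hA0 : 0 < A := Real.sqrt_pos.2 ha
    have hAa : A ^ 2 = a := Real.sq_sqrt ha.le
    set D := |d| with hD
    set G : ℝ → ℝ≥0∞ :=
      fun t => ENNReal.ofReal (jap (max (√D * (A * t)) ((A * t) ^ 2)) ^ (-γ)) with hG
    have hGm : Measurable G := by fun_prop
    have hGanti : ∀ s t, 0 ≤ s → s ≤ t → G t ≤ G s := by
      intro s t hs hst
      refine ENNReal.ofReal_le_ofReal (jap_rpow_neg_anti (by linarith) ?_)
      rw [abs_of_nonneg (by positivity), abs_of_nonneg (by positivity)]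
      gcongr
    have hG0 : G 0 ≤ 1 := by
      rw [← ENNReal.ofReal_one]
      exact ENNReal.ofReal_le_ofReal (rpow_neg_jap_le_one _ (by linarith))
    have hcmp : ∀ y t : ℝ, max (√D * (A * |t|)) ((A * |t|) ^ 2) ≤ |y| →
        ENNReal.ofReal (jap y ^ (-γ)) ≤ G |t| := by
      intro y t h
      refine ENNReal.ofReal_le_ofReal (jap_rpow_neg_anti (by linarith) ?_)
      rwa [abs_of_nonneg (by positivity)]
    -- For d ≥ 0 the polynomial is the sum of squares d + (Ap)². For d < 0 it factors as (Ap − ρ)(Ap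
    -- + ρ) with ρ = √|d|; the larger factor is at least ρ and at least the smaller factor, so the
    -- distance to the nearer root controls the value both linearly and quadratically.
    have hcenter : ∃ r₁ r₂ : ℝ, ∀ k : ℤ, ENNReal.ofReal (jap (d + a * (k - c) ^ 2) ^ (-γ)) ≤
        G |k - r₁| + G |k - r₂| := by
      rcases le_total 0 d with hd | hd
      · refine ⟨c, c, fun k => (hcmp _ _ ?_).trans le_self_add⟩
        have hDd : D = d := abs_of_nonneg hd
        rw [hDd]
        set p := (k:ℝ) - c
        have hs : √d ^ 2 = d := Real.sq_sqrt hd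
        have e : d + a * p ^ 2 = √d ^ 2 + (A * |p|) ^ 2 := by
          rw [hs, mul_pow, hAa, sq_abs]
        rw [e, abs_of_nonneg (show 0 ≤ √d ^ 2 + (A * |p|) ^ 2 by positivity)]
        refine max_le ?_ ?_ <;> nlinarith [sq_nonneg (√d), sq_nonneg (√d - A * |p|),
          sq_nonneg (A * |p|), mul_nonneg (Real.sqrt_nonneg d) (mul_nonneg hA0.le (abs_nonneg p))]
      · have hDd : D = -d := abs_of_nonpos hd
        set ρ := √D with hρ
        have hρ0 : 0 ≤ ρ := Real.sqrt_nonneg _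
        have hs : ρ ^ 2 = -d := by rw [hρ, Real.sq_sqrt (abs_nonneg _), ← hDd]
        refine ⟨c + ρ / A, c - ρ / A, fun k => ?_⟩
        set p := (k:ℝ) - c with hp
        have e1 : A * |(k:ℝ) - (c + ρ / A)| = |A * p - ρ| := by
          rw [← abs_of_pos hA0, ← abs_mul, abs_of_pos hA0, hp]; congr 1; field_simp; ring
        have e2 : A * |(k:ℝ) - (c - ρ / A)| = |A * p + ρ| := by
          rw [← abs_of_pos hA0, ← abs_mul, abs_of_pos hA0, hp]; congr 1; field_simp; ring
        have e3 : |d + a * p ^ 2| = |A * p - ρ| * |A * p + ρ| := by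
          rw [← abs_mul]; congr 1; rw [← hAa]; linear_combination hs
        have hsum : 2 * ρ ≤ |A * p - ρ| + |A * p + ρ| := by
          have := abs_sub (A * p + ρ) (A * p - ρ)
          rw [show A * p + ρ - (A * p - ρ) = 2 * ρ by ring, abs_of_nonneg (by positivity)] at this
          linarith
        rcases le_total (|A * p - ρ|) (|A * p + ρ|) with h | h
        · refine (hcmp _ _ ?_).trans le_self_add
          rw [e1, e3]
          refine max_le ?_ ?_ <;> nlinarith [abs_nonneg (A * p - ρ), abs_nonneg (A * p + ρ)]
        · refine (hcmp _ _ ?_).trans le_add_self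
          rw [e2, e3]
          refine max_le ?_ ?_ <;> nlinarith [abs_nonneg (A * p - ρ), abs_nonneg (A * p + ρ)]
    obtain ⟨r₁, r₂, hr⟩ := hcenter
    have hint : ∫⁻ t in Set.Ioi 0, G t ≤
        ENNReal.ofReal (κ * (|a| ^ (-(1 / 2) : ℝ) * jap d ^ (1 / 2 - γ))) := by
      refine (lintegral_Ioi_jap_max_le h1 h2 hA0).trans
        (ENNReal.ofReal_le_ofReal ?_)
      have eA : A⁻¹ = |a| ^ (-(1 / 2) : ℝ) := by
        rw [hA, Real.sqrt_eq_rpow, abs_of_pos ha, Real.rpow_neg ha.le]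
      have hM : max D 1 ^ (1 / 2 - γ) ≤ 2 ^ (γ - 1 / 2) * jap d ^ (1 / 2 - γ) := by
        have hj : jap d ≤ 2 * max D 1 := by
          have := jap_le_one_add_abs d
          linarith [le_max_left D 1, le_max_right D 1]
        have hjp := jap_pos d
        calc max D 1 ^ (1 / 2 - γ) ≤ (2⁻¹ * jap d) ^ (1 / 2 - γ) :=
              Real.rpow_le_rpow_of_nonpos (by positivity) (by linarith) (by linarith)
          _ = _ := by
            rw [Real.mul_rpow (by norm_num) hjp.le, Real.inv_rpow (by norm_num),
              ← Real.rpow_neg (by norm_num)]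
            congr 2; ring
      rw [← eA, hκ]
      have : 0 < 1 - γ := by linarith
      have : 0 < 2 * γ - 1 := by linarith
      calc _ ≤ (1 / (1 - γ) + 1 / (2 * γ - 1)) *
              (A⁻¹ * (2 ^ (γ - 1 / 2) * jap d ^ (1 / 2 - γ))) := by gcongr
        _ = _ := by ring
    have hone : ∀ r : ℝ, ∑' k : ℤ, G |k - r| ≤
        2 * (1 + ENNReal.ofReal (κ * (|a| ^ (-(1 / 2) : ℝ) * jap d ^ (1 / 2 - γ)))) := by
      intro r
      refine (tsum_int_le_lintegral hGm hGanti r).trans ?_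
      rw [mul_add]
      gcongr
    calc _ ≤ ∑' k : ℤ, (G |k - r₁| + G |k - r₂|) := ENNReal.tsum_le_tsum hr
      _ = ∑' k : ℤ, G |k - r₁| + ∑' k : ℤ, G |k - r₂| := ENNReal.tsum_add
      _ ≤ _ := add_le_add (hone r₁) (hone r₂)
      _ ≤ _ := by
        rw [ENNReal.ofReal_mul hκ0]
        push_cast
        rw [show ENNReal.ofReal κ = ((κ.toNNReal : ℝ≥0) : ℝ≥0∞) from rfl]
        set X := ENNReal.ofReal (|a| ^ (-(1 / 2) : ℝ) * jap d ^ (1 / 2 - γ))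
        set k : ℝ≥0∞ := ((κ.toNNReal : ℝ≥0) : ℝ≥0∞)
        calc 2 * (1 + k * X) + 2 * (1 + k * X) = 4 + 4 * k * X := by ring
          _ ≤ 4 + 4 * k * X + (4 * k + 4 * X) := le_self_add
          _ = _ := by ring
  refine ⟨4 + 4 * Real.toNNReal κ, fun a d c ha => ?_⟩
  rcases lt_or_gt_of_ne ha with h | h
  · have := hpos (-a) (-d) c (by linarith)
    rw [abs_neg, jap_neg] at this
    refine le_trans (le_of_eq ?_) this
    congr 1; ext k; congr 2
    rw [← jap_neg]; congr 1; ring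
  · exact hpos a d c h

/-! ### Singular powers -/

/-- The extended-real power `|x|⁻ˢ`, infinite at the origin when `s > 0`. -/
def singPow (s x : ℝ) : ℝ≥0∞ := ENNReal.ofReal |x| ^ (-s)

@[fun_prop]
theorem measurable_singPow (s : ℝ) : Measurable (singPow s) := by
  unfold singPow; fun_prop

theorem singPow_anti {s x y : ℝ} (hs : 0 ≤ s) (h : |x| ≤ |y|) : singPow s y ≤ singPow s x := by
  unfold singPow
  rw [ENNReal.rpow_neg, ENNReal.rpow_neg, ENNReal.inv_le_inv]
  exact ENNReal.rpow_le_rpow (ENNReal.ofReal_le_ofReal h) hs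

theorem singPow_mul (s x y : ℝ) : singPow s (x * y) = singPow s x * singPow s y := by
  unfold singPow
  rw [abs_mul, ENNReal.ofReal_mul (abs_nonneg _),
    ENNReal.mul_rpow_of_ne_top ENNReal.ofReal_ne_top ENNReal.ofReal_ne_top]

theorem singPow_sq (s x : ℝ) : singPow s (x ^ 2) = singPow (2 * s) x := by
  unfold singPow
  rw [abs_pow, ENNReal.ofReal_pow (abs_nonneg _), ← ENNReal.rpow_natCast_mul]
  congr 1; push_cast; ring

/-- The signs matter only at the origin: for nonnegative exponents each factor there is 1 or ∞, so
that no product 0 · ∞ arises. -/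
theorem singPow_add {s t : ℝ} (hs : 0 ≤ s) (ht : 0 ≤ t) (x : ℝ) :
    singPow (s + t) x = singPow s x * singPow t x := by
  unfold singPow
  rw [ENNReal.rpow_neg, ENNReal.rpow_neg, ENNReal.rpow_neg,
    ENNReal.rpow_add_of_nonneg _ _ hs ht]
  rcases eq_or_ne s 0 with rfl | hs'
  · simp
  · refine ENNReal.mul_inv ?_ ?_
    · right; exact (ENNReal.rpow_lt_top_of_nonneg ht ENNReal.ofReal_ne_top).ne
    · left; exact (ENNReal.rpow_lt_top_of_nonneg hs ENNReal.ofReal_ne_top).ne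

theorem singPow_of_ne_zero {s x : ℝ} (hx : x ≠ 0) :
    singPow s x = ENNReal.ofReal (|x| ^ (-s)) := by
  unfold singPow; rw [ENNReal.ofReal_rpow_of_pos (abs_pos.2 hx)]

theorem singPow_neg (s x : ℝ) : singPow s (-x) = singPow s x := by simp [singPow]

theorem ofReal_jap_rpow_le_singPow {p : ℝ} (hp : 0 ≤ p) (y : ℝ) :
    ENNReal.ofReal (jap y ^ (-p)) ≤ singPow p y := by
  unfold singPow
  rw [← ENNReal.ofReal_rpow_of_pos (jap_pos y), ENNReal.rpow_neg, ENNReal.rpow_neg,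
    ENNReal.inv_le_inv]
  exact ENNReal.rpow_le_rpow (ENNReal.ofReal_le_ofReal (abs_le_jap y)) hp

theorem singPow_mul_singPow_le {s : ℝ} (hs : 0 ≤ s) (x y : ℝ) :
    singPow s x * singPow s y ≤ singPow (2 * s) x + singPow (2 * s) y := by
  rw [two_mul, singPow_add hs hs, singPow_add hs hs]
  rcases le_total (singPow s x) (singPow s y) with h | h
  · exact (mul_le_mul_left h _).trans le_add_self
  · exact (mul_le_mul_right h _).trans le_self_add

theorem lintegral_comp_abs_le {f : ℝ → ℝ≥0∞} (hf : Measurable f) (R : ℝ) :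
    ∫⁻ x in {x : ℝ | R < |x|}, f |x| ≤ 2 * ∫⁻ x in Set.Ioi R, f x := by
  have hm : MeasurableSet {x : ℝ | R < |x|} := measurableSet_lt measurable_const (by fun_prop)
  set J := (Set.Ioi R).indicator f with hJ
  have hJm : Measurable J := hf.indicator measurableSet_Ioi
  calc ∫⁻ x in {x : ℝ | R < |x|}, f |x| ≤ ∫⁻ x, (J x + J (-x)) := by
        rw [← lintegral_indicator hm]
        refine lintegral_mono fun x => Set.indicator_le (g := fun y => J y + J (-y)) (fun y hy => ?_) x
        change R < |y| at hy
        rcases le_total 0 y with h | h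
        · rw [abs_of_nonneg h] at hy ⊢
          rw [hJ, Set.indicator_of_mem (show y ∈ Set.Ioi R from hy)]; exact le_self_add
        · rw [abs_of_nonpos h] at hy ⊢
          rw [hJ, Set.indicator_of_mem (show -y ∈ Set.Ioi R from hy)]; exact le_add_self
    _ = 2 * ∫⁻ x in Set.Ioi R, f x := by
        rw [lintegral_add_left hJm, lintegral_neg_eq_self J, hJ,
          lintegral_indicator measurableSet_Ioi, two_mul]

/-- Among sets of given measure, a singular power has its largest integral on an interval. -/
theorem exists_setLIntegral_singPow_le {s : ℝ} (hs : 0 < s) (hs1 : s < 1) :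
    ∃ C : ℝ≥0, ∀ (S : Set ℝ), MeasurableSet S → ∀ a : ℝ,
      ∫⁻ x in S, singPow s (x - a) ≤ C * volume S ^ (1 - s) := by
  refine ⟨1 + 2 * Real.toNNReal (1 / (1 - s)), fun S hS a => ?_⟩
  rcases eq_or_ne (volume S) ⊤ with hT | hT
  · rw [hT, ENNReal.top_rpow_of_pos (by linarith), ENNReal.mul_top (by simp)]
    exact le_top
  rcases eq_or_ne (volume S) 0 with h0 | h0
  · rw [setLIntegral_measure_zero _ _ h0]; exact zero_le
  -- With ℓ the measure of S, the power is at most ℓ^(-s) outside the interval of radius ℓ about a,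
  -- which contributes at most ℓ^(1-s) over S. Inside the interval it is integrated explicitly.
  set ℓ := (volume S).toReal with hℓ
  have hℓ0 : 0 < ℓ := ENNReal.toReal_pos h0 hT
  have hvol : volume S = ENNReal.ofReal ℓ := (ENNReal.ofReal_toReal hT).symm
  have hneg : ∫⁻ x in S, singPow s (x - a) ≤
      (∫⁻ x in S, ENNReal.ofReal (ℓ ^ (-s))) +
        ∫⁻ x, (Set.Icc (-ℓ) ℓ).indicator (singPow s) (x - a) := by
    rw [← lintegral_indicator hS]
    have hle : ∫⁻ x in S, ENNReal.ofReal (ℓ ^ (-s)) =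
        ∫⁻ x, S.indicator (fun _ => ENNReal.ofReal (ℓ ^ (-s))) x := (lintegral_indicator hS _).symm
    rw [hle, ← lintegral_add_left (measurable_const.indicator hS)]
    refine lintegral_mono fun x => Set.indicator_le
      (g := fun y => S.indicator (fun _ => ENNReal.ofReal (ℓ ^ (-s))) y +
        (Set.Icc (-ℓ) ℓ).indicator (singPow s) (y - a)) (fun y hy => ?_) x
    rw [Set.indicator_of_mem hy]
    by_cases h : y - a ∈ Set.Icc (-ℓ) ℓ
    · rw [Set.indicator_of_mem h]; exact le_add_self
    · refine le_trans ?_ le_self_add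
      have h' : ℓ ≤ |y - a| := by
        by_contra hc
        exact h ⟨(abs_le.1 (not_le.1 hc).le).1, (abs_le.1 (not_le.1 hc).le).2⟩
      calc singPow s (y - a) ≤ singPow s ℓ := singPow_anti hs.le (by rwa [abs_of_pos hℓ0])
        _ = _ := by rw [singPow_of_ne_zero hℓ0.ne', abs_of_pos hℓ0]
  have hpow : ℓ ^ (-s) * ℓ = ℓ ^ (1 - s) := by
    nth_rw 2 [← Real.rpow_one ℓ]; rw [← Real.rpow_add hℓ0]; congr 1; ring
  have hsym : ∫⁻ x in Set.Icc (-ℓ) ℓ, singPow s x ≤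
      2 * ENNReal.ofReal (ℓ ^ (1 - s) / (1 - s)) := by
    rw [← lintegral_Ioc_rpow_neg hs1 hℓ0.le, ← lintegral_indicator measurableSet_Icc]
    set J := (Set.Ioc 0 ℓ).indicator (fun x => ENNReal.ofReal (x ^ (-s))) with hJ
    have hJm : Measurable J := Measurable.indicator (by fun_prop) measurableSet_Ioc
    have : ∫⁻ x, (Set.Icc (-ℓ) ℓ).indicator (singPow s) x ≤ ∫⁻ x, (J x + J (-x)) := by
      refine lintegral_mono_ae ?_
      filter_upwards [Measure.ae_ne volume (0:ℝ)] with x hx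
      refine Set.indicator_le (s := Set.Icc (-ℓ) ℓ \ {0}) (f := singPow s)
        (g := fun x => J x + J (-x)) (fun y hy => ?_) x |>.trans' (le_of_eq ?_)
      · rw [singPow_of_ne_zero hy.2]
        rcases lt_or_gt_of_ne (show y ≠ 0 from hy.2) with h | h
        · rw [abs_of_neg h, hJ, Set.indicator_of_mem (show -y ∈ Set.Ioc 0 ℓ from
            ⟨by linarith, by linarith [hy.1.1]⟩)]
          exact le_add_self
        · rw [abs_of_pos h, hJ, Set.indicator_of_mem (show y ∈ Set.Ioc 0 ℓ from
            ⟨h, hy.1.2⟩)]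
          exact le_self_add
      · by_cases h : x ∈ Set.Icc (-ℓ) ℓ
        · rw [Set.indicator_of_mem h, Set.indicator_of_mem (show x ∈ Set.Icc (-ℓ) ℓ \ {0} from ⟨h, hx⟩)]
        · rw [Set.indicator_of_notMem h, Set.indicator_of_notMem (fun h' => h h'.1)]
    refine this.trans ?_
    rw [lintegral_add_left hJm, lintegral_neg_eq_self J, hJ,
      lintegral_indicator measurableSet_Ioc, two_mul]
  refine hneg.trans ?_
  rw [setLIntegral_const, lintegral_sub_right_eq_self ((Set.Icc (-ℓ) ℓ).indicator (singPow s)) a,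
    lintegral_indicator measurableSet_Icc, hvol, ← ENNReal.ofReal_mul (by positivity), hpow,
    ENNReal.ofReal_rpow_of_pos hℓ0]
  refine (add_le_add_right hsym _).trans (le_of_eq ?_)
  rw [div_eq_mul_one_div, mul_comm (ℓ ^ (1 - s)), ENNReal.ofReal_mul (by
    have : 0 < 1 - s := by linarith
    positivity)]
  push_cast
  rw [show ENNReal.ofReal (1 / (1 - s)) = ((Real.toNNReal (1 / (1 - s)) : ℝ≥0) : ℝ≥0∞) from rfl]
  ring

/-- The bracket of a quadratic polynomial is bounded by singular powers at two centers. -/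
theorem exists_jap_quadratic_le_singPow {p D Λ : ℝ} (hp : 0 ≤ p) (hD : D ≠ 0) :
    ∃ r₁ r₂ : ℝ, ∀ n : ℝ, ENNReal.ofReal (jap (Λ + 3 * D * (n * (D - n))) ^ (-p)) ≤
      singPow p D * (singPow (2 * p) (n - r₁) + singPow (2 * p) (n - r₂)) := by
  -- Completing the square: the polynomial is −3D((n − D/2)² − E).
  set E := Λ / (3 * D) + D ^ 2 / 4 with hE
  have hquad : ∀ n : ℝ, Λ + 3 * D * (n * (D - n)) = -3 * D * ((n - D / 2) ^ 2 - E) := by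
    intro n; rw [hE]; field_simp; ring
  have hstep : ∀ n r : ℝ, (n - r) ^ 2 ≤ |(n - D / 2) ^ 2 - E| →
      ENNReal.ofReal (jap (Λ + 3 * D * (n * (D - n))) ^ (-p)) ≤
        singPow p D * singPow (2 * p) (n - r) := by
    intro n r h
    rw [← singPow_sq, ← singPow_mul]
    refine (ofReal_jap_rpow_le_singPow hp _).trans (singPow_anti hp ?_)
    rw [hquad, abs_mul, abs_mul, abs_mul, abs_of_nonneg (sq_nonneg (n - r))]
    have h3 : |(-3:ℝ)| = 3 := by norm_num
    rw [h3]
    have := abs_pos.2 hD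
    nlinarith [sq_nonneg (n - r), mul_le_mul_of_nonneg_left h this.le]
  rcases le_total E 0 with h | h
  · refine ⟨D / 2, D / 2, fun n => (hstep n (D / 2) ?_).trans ?_⟩
    · exact le_trans (by linarith) (le_abs_self _)
    · gcongr; exact le_self_add
  · set ρ := √E with hρ
    have hρ0 : 0 ≤ ρ := Real.sqrt_nonneg _
    have hρE : ρ ^ 2 = E := Real.sq_sqrt h
    -- The product of the distances to the two roots is at least the square of the smaller distance.
    refine ⟨D / 2 + ρ, D / 2 - ρ, fun n => ?_⟩
    have e : |(n - D / 2) ^ 2 - E| = |n - (D / 2 + ρ)| * |n - (D / 2 - ρ)| := by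
      rw [← abs_mul, ← hρE]; congr 1; ring
    rw [mul_add]
    rcases le_total (|n - (D / 2 + ρ)|) (|n - (D / 2 - ρ)|) with h' | h'
    · refine (hstep n (D / 2 + ρ) ?_).trans le_self_add
      rw [e, ← sq_abs, sq]; gcongr
    · refine (hstep n (D / 2 - ρ) ?_).trans le_add_self
      rw [e, ← sq_abs, sq]; gcongr

theorem lintegral_comp_mul_left {c : ℝ} (hc : c ≠ 0) {f : ℝ → ℝ≥0∞} (hf : Measurable f) :
    ENNReal.ofReal |c| * ∫⁻ x, f (c * x) = ∫⁻ x, f x := by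
  have h := lintegral_map (μ := volume) hf (measurable_const_mul c)
  rw [Real.map_volume_mul_left hc, lintegral_smul_measure] at h
  rw [← h, smul_eq_mul, ← mul_assoc, ← ENNReal.ofReal_mul (abs_nonneg c), abs_inv,
    mul_inv_cancel₀ (abs_ne_zero.2 hc), ENNReal.ofReal_one, one_mul]

/-- The factor |c| is the Jacobian of the dilation, which makes the bound uniform in c. -/
theorem exists_lintegral_scaled_jap_le {p : ℝ} (hp : 1 < p) :
    ∃ C : ℝ≥0, ∀ c u : ℝ, ∫⁻ x : ℝ, ENNReal.ofReal (|c| * jap (c * (x - u)) ^ (-p)) ≤ C := by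
  obtain ⟨C, hC⟩ := exists_lintegral_jap_rpow_le hp
  refine ⟨C, fun c u => ?_⟩
  rcases eq_or_ne c 0 with rfl | hc
  · simp
  have hm : Measurable fun x : ℝ => ENNReal.ofReal (jap (x - 0) ^ (-p)) := by fun_prop
  rw [lintegral_sub_right_eq_self (fun x => ENNReal.ofReal (|c| * jap (c * x) ^ (-p))) u]
  simp_rw [ENNReal.ofReal_mul (abs_nonneg c)]
  rw [lintegral_const_mul _ (by fun_prop)]
  have := lintegral_comp_mul_left hc hm
  simp only [sub_zero] at this
  rw [this]
  simpa using hC 0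

/-! ### Integrals over the free frequency -/

theorem abs_div_rpow_neg_half (a b : ℝ) :
    |a / b| ^ (-(1 / 2) : ℝ) = |b / a| ^ (1 / 2 : ℝ) := by
  rw [Real.rpow_neg (abs_nonneg _), ← Real.inv_rpow (abs_nonneg _), ← abs_inv, inv_div]

theorem volume_setOf_abs_sub_le (a r : ℝ) :
    volume {x : ℝ | |x - a| ≤ r} = ENNReal.ofReal (2 * r) := by
  have : {x : ℝ | |x - a| ≤ r} = Metric.closedBall a r := by
    ext x; rw [Metric.mem_closedBall, Real.dist_eq]; rfl
  rw [this, Real.volume_closedBall]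

/-- The frequency integral when the dominant modulation `Λ` sits at a frequency `D` comparable to
the largest one. -/
theorem exists_setLIntegral_comparable_le : ∃ C : ℝ≥0, ∀ D Λ : ℝ, D ≠ 0 →
    ENNReal.ofReal (D ^ 2 * jap Λ ^ (-1 : ℝ) + D ^ 2 * jap D ^ (-2 : ℝ) * jap Λ ^ (-(1 / 3) : ℝ)) *
      ∫⁻ n in {n : ℝ | |n| ≤ 2 * |D| ∧ |D - n| ≤ 2 * |D| ∧ |D * (n * (D - n))| ≤ |Λ|},
        (1 + ENNReal.ofReal (|D / (n * (D - n))| ^ (-(1 / 2) : ℝ) *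
          jap (Λ + 3 * D * (n * (D - n))) ^ (1 / 2 - 2 / 3 : ℝ))) ≤ C := by
  obtain ⟨C, hC⟩ := exists_setLIntegral_singPow_le (s := 1 / 3) (by norm_num) (by norm_num)
  refine ⟨16 * (1 + 4 * C), fun D Λ hD => ?_⟩
  have hD0 := abs_pos.2 hD
  set S := {n : ℝ | |n| ≤ 2 * |D| ∧ |D - n| ≤ 2 * |D| ∧ |D * (n * (D - n))| ≤ |Λ|} with hS
  have hSm : MeasurableSet S := by
    exact (measurableSet_le (f := fun n : ℝ => |n|) (by fun_prop) (by fun_prop)).inter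
      ((measurableSet_le (f := fun n : ℝ => |D - n|) (by fun_prop) (by fun_prop)).inter
        (measurableSet_le (f := fun n : ℝ => |D * (n * (D - n))|) (by fun_prop) (by fun_prop)))
  -- The smaller of |n| and |D − n| is at most ρ: the larger one is at least |D|/2, so |D · n · (D −
  -- n)| ≤ |Λ| bounds the smaller one by 2|Λ|/D². Thus the domain has measure at most 4ρ and |n(D −
  -- n)/D| ≤ 2ρ on it.
  set ρ := min (2 * |D|) (2 * |Λ| / D ^ 2) with hρ
  have hρ0 : 0 ≤ ρ := by positivity
  have hsq : D ^ 2 = |D| ^ 2 := (sq_abs D).symm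
  have hD2 : 0 < D ^ 2 := by positivity
  have hsmall : ∀ x y : ℝ, |x| ≤ |y| → |x| ≤ 2 * |D| → x + y = D → |D * (x * y)| ≤ |Λ| →
      |x| ≤ ρ := by
    intro x y hxy hx hsum hprod
    refine le_min hx ?_
    have hy : |D| ≤ 2 * |y| := by
      have := abs_add_le x y
      rw [hsum] at this; linarith
    rw [le_div_iff₀ hD2, hsq]
    rw [abs_mul, abs_mul] at hprod
    have := mul_le_mul_of_nonneg_left hy (mul_nonneg hD0.le (abs_nonneg x))
    nlinarith
  have hmem : ∀ n ∈ S, |n * (D - n) / D| ≤ 2 * ρ ∧ (|n - 0| ≤ ρ ∨ |n - D| ≤ ρ) := by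
    rintro n ⟨h1, h2, h3⟩
    have hq : |n * (D - n) / D| = |n| * |D - n| / |D| := by rw [abs_div, abs_mul]
    rw [hq, div_le_iff₀ hD0, sub_zero, abs_sub_comm n D]
    rcases le_total (|n|) (|D - n|) with h | h
    · have := hsmall n (D - n) h h1 (by ring) h3
      exact ⟨by nlinarith [abs_nonneg n, abs_nonneg (D - n)], Or.inl this⟩
    · have := hsmall (D - n) n h h2 (by ring) (by rwa [mul_comm (D - n) n])
      exact ⟨by nlinarith [abs_nonneg n, abs_nonneg (D - n)], Or.inr this⟩
  have hvol : volume S ≤ ENNReal.ofReal (4 * ρ) := by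
    calc volume S ≤ volume ({n : ℝ | |n - 0| ≤ ρ} ∪ {n : ℝ | |n - D| ≤ ρ}) :=
          measure_mono fun n hn => (hmem n hn).2
      _ ≤ _ := measure_union_le _ _
      _ = ENNReal.ofReal (4 * ρ) := by
        rw [volume_setOf_abs_sub_le, volume_setOf_abs_sub_le,
          ← ENNReal.ofReal_add (by positivity) (by positivity)]
        congr 1; ring
  obtain ⟨r₁, r₂, hr⟩ := exists_jap_quadratic_le_singPow (p := 1 / 6) (Λ := Λ) (by norm_num) hD
  have hpt : ∀ n ∈ S, 1 + ENNReal.ofReal (|D / (n * (D - n))| ^ (-(1 / 2) : ℝ) *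
      jap (Λ + 3 * D * (n * (D - n))) ^ (1 / 2 - 2 / 3 : ℝ)) ≤
      1 + ENNReal.ofReal ((2 * ρ) ^ (1 / 2 : ℝ)) * (singPow (1 / 6) D *
        (singPow (1 / 3) (n - r₁) + singPow (1 / 3) (n - r₂))) := by
    intro n hn
    have h1 := (hmem n hn).1
    rw [abs_div_rpow_neg_half, ENNReal.ofReal_mul (by positivity)]
    have := hr n
    rw [show (2:ℝ) * (1 / 6) = 1 / 3 by norm_num] at this
    rw [show (1 / 2 - 2 / 3 : ℝ) = -(1 / 6) by norm_num]
    gcongr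
  -- The first term uses ρ ≤ 2|Λ|/D². The second uses ρ³ ≤ (2|D|)² · 2|Λ|/D² = 8|Λ|, which is where
  -- the exponent 1/3 on ⟨Λ⟩ is exactly right.
  have hmult : (D ^ 2 * jap Λ ^ (-1 : ℝ) + D ^ 2 * jap D ^ (-2 : ℝ) * jap Λ ^ (-(1 / 3) : ℝ)) * ρ
      ≤ 4 := by
    have hL := jap_pos Λ
    have ha : D ^ 2 * jap Λ ^ (-1 : ℝ) * ρ ≤ 2 := by
      rw [Real.rpow_neg_one]
      calc D ^ 2 * (jap Λ)⁻¹ * ρ ≤ D ^ 2 * (jap Λ)⁻¹ * (2 * |Λ| / D ^ 2) := by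
            gcongr; exact min_le_right _ _
        _ = 2 * (|Λ| / jap Λ) := by field_simp
        _ ≤ 2 * 1 := by gcongr; rw [div_le_one hL]; exact abs_le_jap Λ
        _ = 2 := by norm_num
    have hb : D ^ 2 * jap D ^ (-2 : ℝ) ≤ 1 := by
      rw [Real.rpow_neg (jap_nonneg D), Real.rpow_two, ← div_eq_mul_inv,
        div_le_one (by have := jap_pos D; positivity), jap_sq]
      linarith
    have hc : ρ ≤ 2 * jap Λ ^ (1 / 3 : ℝ) := by
      have h3 : ρ ^ 3 ≤ 8 * jap Λ := by
        calc ρ ^ 3 = ρ ^ 2 * ρ := by ring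
          _ ≤ (2 * |D|) ^ 2 * (2 * |Λ| / D ^ 2) := by
            gcongr
            · exact min_le_left _ _
            · exact min_le_right _ _
          _ = 8 * |Λ| := by rw [hsq]; field_simp; ring
          _ ≤ _ := by linarith [abs_le_jap Λ]
      have h4 : (2 * jap Λ ^ (1 / 3 : ℝ)) ^ 3 = 8 * jap Λ := by
        rw [mul_pow, ← Real.rpow_natCast (jap Λ ^ (1 / 3 : ℝ)) 3, ← Real.rpow_mul hL.le]
        norm_num
      exact (pow_le_pow_iff_left₀ hρ0 (by positivity) (by norm_num)).1 (h3.trans h4.ge)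
    have hd : jap Λ ^ (-(1 / 3) : ℝ) * ρ ≤ 2 := by
      rw [Real.rpow_neg hL.le, inv_mul_le_iff₀ (by positivity)]
      linarith
    have : D ^ 2 * jap D ^ (-2 : ℝ) * (jap Λ ^ (-(1 / 3) : ℝ) * ρ) ≤ 1 * 2 := by gcongr
    linarith
  -- The powers of ρ add up to 1/2 + 2/3 = 1 + 1/6, and the excess 1/6 is absorbed by |D|^(-1/6)
  -- because ρ ≤ 2|D|.
  have hscale : ENNReal.ofReal ((2 * ρ) ^ (1 / 2 : ℝ)) * (singPow (1 / 6) D *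
      ENNReal.ofReal (4 * ρ) ^ (1 - 1 / 3 : ℝ)) ≤ 2 * ENNReal.ofReal (4 * ρ) := by
    rcases hρ0.eq_or_lt with h | h
    · rw [← h]; norm_num
    rw [singPow_of_ne_zero hD, ENNReal.ofReal_rpow_of_pos (by positivity),
      ← ENNReal.ofReal_mul (by positivity), ← ENNReal.ofReal_mul (by positivity),
      show (2 : ℝ≥0∞) = ENNReal.ofReal 2 by simp, ← ENNReal.ofReal_mul (by norm_num)]
    refine ENNReal.ofReal_le_ofReal ?_
    set R := 4 * ρ with hR
    have hR0 : 0 < R := by positivity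
    have e1 : |D| ^ (-(1 / 6) : ℝ) ≤ (R / 8) ^ (-(1 / 6) : ℝ) := by
      refine Real.rpow_le_rpow_of_nonpos (by positivity) ?_ (by norm_num)
      linarith [min_le_left (2 * |D|) (2 * |Λ| / D ^ 2)]
    have e2 : (2 * ρ) ^ (1 / 2 : ℝ) ≤ R ^ (1 / 2 : ℝ) := by gcongr; linarith
    calc (2 * ρ) ^ (1 / 2 : ℝ) * (|D| ^ (-(1 / 6) : ℝ) * R ^ (1 - 1 / 3 : ℝ))
        ≤ R ^ (1 / 2 : ℝ) * ((R / 8) ^ (-(1 / 6) : ℝ) * R ^ (1 - 1 / 3 : ℝ)) := by gcongr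
      _ = 8 ^ (1 / 6 : ℝ) * R := by
        rw [Real.div_rpow hR0.le (by norm_num), Real.rpow_neg (by norm_num : (0:ℝ) ≤ 8),
          div_inv_eq_mul,
          show R ^ (1 / 2 : ℝ) * (R ^ (-(1 / 6) : ℝ) * 8 ^ (1 / 6 : ℝ) * R ^ (1 - 1 / 3 : ℝ)) =
            8 ^ (1 / 6 : ℝ) * (R ^ (1 / 2 : ℝ) * R ^ (-(1 / 6) : ℝ) * R ^ (1 - 1 / 3 : ℝ)) by ring,
          ← Real.rpow_add hR0, ← Real.rpow_add hR0]
        norm_num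
      _ ≤ 2 * R := by
        gcongr
        calc (8:ℝ) ^ (1 / 6 : ℝ) ≤ 8 ^ (1 / 3 : ℝ) :=
              Real.rpow_le_rpow_of_exponent_le (by norm_num) (by norm_num)
          _ = 2 := by
            rw [show (8:ℝ) = 2 ^ (3:ℝ) by norm_num, ← Real.rpow_mul (by norm_num)]; norm_num
  have hint : ∫⁻ n in S, (1 + ENNReal.ofReal (|D / (n * (D - n))| ^ (-(1 / 2) : ℝ) *
      jap (Λ + 3 * D * (n * (D - n))) ^ (1 / 2 - 2 / 3 : ℝ))) ≤
      (1 + 4 * C) * ENNReal.ofReal (4 * ρ) := by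
    refine (setLIntegral_mono' hSm hpt).trans ?_
    rw [lintegral_add_left measurable_const, setLIntegral_const, one_mul,
      lintegral_const_mul _ (by fun_prop), lintegral_const_mul _ (by fun_prop),
      lintegral_add_left (by fun_prop)]
    calc _ ≤ ENNReal.ofReal (4 * ρ) + ENNReal.ofReal ((2 * ρ) ^ (1 / 2 : ℝ)) * (singPow (1 / 6) D *
          (C * ENNReal.ofReal (4 * ρ) ^ (1 - 1 / 3 : ℝ) +
            C * ENNReal.ofReal (4 * ρ) ^ (1 - 1 / 3 : ℝ))) := by
          gcongr <;> refine (hC S hSm _).trans ?_ <;> gcongr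
      _ = ENNReal.ofReal (4 * ρ) + 2 * C * (ENNReal.ofReal ((2 * ρ) ^ (1 / 2 : ℝ)) *
          (singPow (1 / 6) D * ENNReal.ofReal (4 * ρ) ^ (1 - 1 / 3 : ℝ))) := by ring
      _ ≤ ENNReal.ofReal (4 * ρ) + 2 * C * (2 * ENNReal.ofReal (4 * ρ)) := by gcongr
      _ = _ := by ring
  refine (mul_le_mul_right hint _).trans ?_
  rw [mul_left_comm, ENNReal.ofReal_mul (by norm_num : (0:ℝ) ≤ 4), mul_left_comm (ENNReal.ofReal _),
    ← ENNReal.ofReal_mul (by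
      have := jap_pos D
      have := jap_pos Λ
      positivity)]
  calc _ ≤ (1 + 4 * (C : ℝ≥0∞)) * (ENNReal.ofReal 4 * ENNReal.ofReal 4) := by gcongr
    _ = _ := by
      rw [show ENNReal.ofReal 4 = 4 by simp]; push_cast; ring

/-- The frequency integral for two large frequencies producing a small one. -/
theorem exists_setLIntegral_high_high_low_le : ∃ C : ℝ≥0, ∀ α ε Λ : ℝ, 0 < α →
    ∫⁻ χ in {χ : ℝ | 0 < χ ∧ χ < ε ∧ α < ε ∧ |α + χ - ε| ≤ α ∧ |α + χ - ε| ≤ χ},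
      singPow (1 / 3) (α + χ - ε) * (singPow (1 / 3) α * singPow (1 / 3) χ) *
        (1 + ENNReal.ofReal (|ε / (χ * (ε - χ))| ^ (-(1 / 2) : ℝ) *
          jap (Λ + 3 * ε * (χ * (ε - χ))) ^ (1 / 2 - 2 / 3 : ℝ))) ≤ C := by
  obtain ⟨C, hC⟩ := exists_setLIntegral_singPow_le (s := 2 / 3) (by norm_num) (by norm_num)
  refine ⟨18 * C, fun α ε Λ hα => ?_⟩
  set S := {χ : ℝ | 0 < χ ∧ χ < ε ∧ α < ε ∧ |α + χ - ε| ≤ α ∧ |α + χ - ε| ≤ χ} with hS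
  by_cases hε : α < ε
  swap
  · have : S = ∅ := by
      ext χ; simp only [hS, Set.mem_empty_iff_false, iff_false]; exact fun h => hε h.2.2.1
    rw [this]; simp
  have hε0 : 0 < ε := hα.trans hε
  -- The output frequency is α + χ − ε; that it does not exceed α in modulus confines χ to an
  -- interval of length 2α.
  set S' := {χ : ℝ | |χ - (ε - α)| ≤ α} with hS'
  have hS'm : MeasurableSet S' := measurableSet_le (by fun_prop) (by fun_prop)
  have hsub : S ⊆ S' := fun χ h => by
    have := h.2.2.2.1
    change |χ - (ε - α)| ≤ α
    rwa [show χ - (ε - α) = α + χ - ε by ring]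
  have hSm : MeasurableSet S := by
    exact (measurableSet_lt (g := fun χ : ℝ => χ) (by fun_prop) (by fun_prop)).inter
      ((measurableSet_lt (f := fun χ : ℝ => χ) (by fun_prop) (by fun_prop)).inter
        ((MeasurableSet.const (α < ε)).inter
          ((measurableSet_le (f := fun χ : ℝ => |α + χ - ε|) (by fun_prop) (by fun_prop)).inter
            (measurableSet_le (f := fun χ : ℝ => |α + χ - ε|) (by fun_prop) (by fun_prop)))))
  obtain ⟨r₁, r₂, hr⟩ := exists_jap_quadratic_le_singPow (p := 1 / 6) (Λ := Λ) (by norm_num) hε0.ne'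
  have hpt : ∀ χ ∈ S, singPow (1 / 3) (α + χ - ε) * (singPow (1 / 3) α * singPow (1 / 3) χ) *
        (1 + ENNReal.ofReal (|ε / (χ * (ε - χ))| ^ (-(1 / 2) : ℝ) *
          jap (Λ + 3 * ε * (χ * (ε - χ))) ^ (1 / 2 - 2 / 3 : ℝ))) ≤
      singPow (1 / 3) α * (5 * singPow (2 / 3) (χ - (ε - α)) + (2 * singPow (2 / 3) (χ - r₁) +
        2 * singPow (2 / 3) (χ - r₂))) := by
    rintro χ ⟨hχ0, hχε, -, h1, h2⟩
    rw [show χ - (ε - α) = α + χ - ε by ring]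
    set n := α + χ - ε with hn
    have ht1 : singPow (1 / 3) n * (singPow (1 / 3) α * singPow (1 / 3) χ) ≤
        singPow (1 / 3) α * singPow (2 / 3) n := by
      rw [show (2 / 3 : ℝ) = 1 / 3 + 1 / 3 by norm_num, singPow_add (by norm_num) (by norm_num)]
      have : singPow (1 / 3) χ ≤ singPow (1 / 3) n :=
        singPow_anti (by norm_num) (by rwa [abs_of_pos hχ0])
      calc _ ≤ singPow (1 / 3) n * (singPow (1 / 3) α * singPow (1 / 3) n) := by gcongr
        _ = _ := by ring
    -- The quotient χ(ε − χ)/ε is at most χ and at most 2α. The exponent 1/2 is split as 1/6 + 1/3: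
    -- the power χ^(1/3) cancels the weight at χ, and α^(1/6) is compensated by the factor ε^(-1/6)
    -- of the bracket, since α < ε.
    have hcoef : |ε / (χ * (ε - χ))| ^ (-(1 / 2) : ℝ) ≤ (2 * α) ^ (1 / 6 : ℝ) * χ ^ (1 / 3 : ℝ) := by
      rw [abs_div_rpow_neg_half]
      have hq : |χ * (ε - χ) / ε| = χ * (ε - χ) / ε :=
        abs_of_nonneg (div_nonneg (mul_nonneg hχ0.le (by linarith)) hε0.le)
      have hq1 : χ * (ε - χ) / ε ≤ χ := by
        rw [div_le_iff₀ hε0]; nlinarith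
      have hq2 : χ * (ε - χ) / ε ≤ 2 * α := by
        rw [div_le_iff₀ hε0]
        have : ε - χ ≤ 2 * α := by linarith [(abs_le.1 h1).1]
        nlinarith
      have hq0 : 0 ≤ χ * (ε - χ) / ε := by rw [← hq]; exact abs_nonneg _
      rw [hq, show (1 / 2 : ℝ) = 1 / 6 + 1 / 3 by norm_num,
        Real.rpow_add_of_nonneg hq0 (by norm_num) (by norm_num)]
      gcongr
    have hcancel : singPow (1 / 3) χ * ENNReal.ofReal (χ ^ (1 / 3 : ℝ)) = 1 := by
      rw [singPow_of_ne_zero hχ0.ne', abs_of_pos hχ0, ← ENNReal.ofReal_mul (by positivity),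
        ← Real.rpow_add hχ0]
      simp
    have hcancel2 : ENNReal.ofReal ((2 * α) ^ (1 / 6 : ℝ)) * singPow (1 / 6) ε ≤ 2 := by
      rw [singPow_of_ne_zero hε0.ne', abs_of_pos hε0, ← ENNReal.ofReal_mul (by positivity),
        show (2:ℝ≥0∞) = ENNReal.ofReal 2 by simp]
      refine ENNReal.ofReal_le_ofReal ?_
      rw [Real.rpow_neg hε0.le, ← div_eq_mul_inv, div_le_iff₀ (by positivity)]
      calc (2 * α) ^ (1 / 6 : ℝ) ≤ (2 * ε) ^ (1 / 6 : ℝ) := by gcongr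
        _ = 2 ^ (1 / 6 : ℝ) * ε ^ (1 / 6 : ℝ) := Real.mul_rpow (by norm_num) hε0.le
        _ ≤ 2 ^ (1 : ℝ) * ε ^ (1 / 6 : ℝ) := by
          gcongr <;> norm_num
        _ = _ := by rw [Real.rpow_one]
    have ht2 : singPow (1 / 3) n * (singPow (1 / 3) α * singPow (1 / 3) χ) *
        ENNReal.ofReal (|ε / (χ * (ε - χ))| ^ (-(1 / 2) : ℝ) *
          jap (Λ + 3 * ε * (χ * (ε - χ))) ^ (1 / 2 - 2 / 3 : ℝ)) ≤
        singPow (1 / 3) α * (4 * singPow (2 / 3) n + (2 * singPow (2 / 3) (χ - r₁) +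
          2 * singPow (2 / 3) (χ - r₂))) := by
      have hj := hr χ
      rw [show (2:ℝ) * (1 / 6) = 1 / 3 by norm_num] at hj
      rw [show (1 / 2 - 2 / 3 : ℝ) = -(1 / 6) by norm_num, ENNReal.ofReal_mul (by positivity)]
      have hc' := (ENNReal.ofReal_le_ofReal hcoef)
      rw [ENNReal.ofReal_mul (by positivity)] at hc'
      have p1 := singPow_mul_singPow_le (s := 1 / 3) (by norm_num) n (χ - r₁)
      have p2 := singPow_mul_singPow_le (s := 1 / 3) (by norm_num) n (χ - r₂)
      rw [show (2:ℝ) * (1 / 3) = 2 / 3 by norm_num] at p1 p2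
      set s₁ := singPow (1 / 3) (χ - r₁)
      set s₂ := singPow (1 / 3) (χ - r₂)
      calc _ ≤ singPow (1 / 3) n * (singPow (1 / 3) α * singPow (1 / 3) χ) *
            ((ENNReal.ofReal ((2 * α) ^ (1 / 6 : ℝ)) * ENNReal.ofReal (χ ^ (1 / 3 : ℝ))) *
              (singPow (1 / 6) ε * (s₁ + s₂))) := by gcongr
        _ = (singPow (1 / 3) χ * ENNReal.ofReal (χ ^ (1 / 3 : ℝ))) *
            (ENNReal.ofReal ((2 * α) ^ (1 / 6 : ℝ)) * singPow (1 / 6) ε) *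
            singPow (1 / 3) α * (singPow (1 / 3) n * s₁ + singPow (1 / 3) n * s₂) := by ring
        _ ≤ 1 * 2 * singPow (1 / 3) α * ((singPow (2 / 3) n + singPow (2 / 3) (χ - r₁)) +
            (singPow (2 / 3) n + singPow (2 / 3) (χ - r₂))) := by
          rw [hcancel]; gcongr
        _ = _ := by ring
    rw [mul_add, mul_one]
    refine (add_le_add ht1 ht2).trans (le_of_eq ?_)
    ring
  have hvol : volume S' = ENNReal.ofReal (2 * α) := volume_setOf_abs_sub_le _ _
  calc _ ≤ ∫⁻ χ in S, singPow (1 / 3) α * (5 * singPow (2 / 3) (χ - (ε - α)) +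
          (2 * singPow (2 / 3) (χ - r₁) + 2 * singPow (2 / 3) (χ - r₂))) :=
        setLIntegral_mono' hSm hpt
    _ ≤ ∫⁻ χ in S', singPow (1 / 3) α * (5 * singPow (2 / 3) (χ - (ε - α)) +
          (2 * singPow (2 / 3) (χ - r₁) + 2 * singPow (2 / 3) (χ - r₂))) :=
        lintegral_mono_set hsub
    _ ≤ singPow (1 / 3) α * (5 * (C * volume S' ^ (1 - 2 / 3 : ℝ)) +
          (2 * (C * volume S' ^ (1 - 2 / 3 : ℝ)) + 2 * (C * volume S' ^ (1 - 2 / 3 : ℝ)))) := by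
        rw [lintegral_const_mul _ (by fun_prop), lintegral_add_left (by fun_prop),
          lintegral_add_left (by fun_prop), lintegral_const_mul _ (by fun_prop),
          lintegral_const_mul _ (by fun_prop), lintegral_const_mul _ (by fun_prop)]
        gcongr <;> exact hC S' hS'm _
    _ = 9 * C * (singPow (1 / 3) α * ENNReal.ofReal (2 * α) ^ (1 - 2 / 3 : ℝ)) := by
        rw [hvol]; ring
    -- The estimate is scale invariant: α^(-1/3) meets the measure of `S'` to the power 1/3.
    _ ≤ 9 * C * 2 := by
        gcongr
        rw [singPow_of_ne_zero hα.ne', abs_of_pos hα, ENNReal.ofReal_rpow_of_pos (by positivity),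
          ← ENNReal.ofReal_mul (by positivity), show (2:ℝ≥0∞) = ENNReal.ofReal 2 by simp]
        refine ENNReal.ofReal_le_ofReal ?_
        rw [Real.rpow_neg hα.le, ← div_eq_inv_mul, div_le_iff₀ (by positivity),
          show (1 - 2 / 3 : ℝ) = 1 / 3 by norm_num, Real.mul_rpow (by norm_num) hα.le]
        gcongr
        calc (2:ℝ) ^ (1 / 3 : ℝ) ≤ 2 ^ (1 : ℝ) :=
              Real.rpow_le_rpow_of_exponent_le (by norm_num) (by norm_num)
          _ = 2 := Real.rpow_one 2
    _ = _ := by push_cast; ring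

/-- The factor ξ² is twice the Jacobian of n ↦ ξ²n/2 and 25/24 > 1, so the first term is bounded
uniformly in ξ. The term 1 costs the length of the interval. -/
theorem exists_setLIntegral_low_le : ∃ C : ℝ≥0, ∀ ξ : ℝ,
    ∫⁻ n in {n : ℝ | |n| ≤ 1}, ENNReal.ofReal (ξ ^ 2 * jap (ξ ^ 2 / 2 * n) ^ (-(25 / 24) : ℝ) + 1)
      ≤ C := by
  obtain ⟨C, hC⟩ := exists_lintegral_scaled_jap_le (p := 25 / 24) (by norm_num)
  refine ⟨2 * C + 2, fun ξ => ?_⟩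
  have hpt : ∀ n : ℝ, ENNReal.ofReal (ξ ^ 2 * jap (ξ ^ 2 / 2 * n) ^ (-(25 / 24) : ℝ) + 1) =
      2 * ENNReal.ofReal (|ξ ^ 2 / 2| * jap (ξ ^ 2 / 2 * (n - 0)) ^ (-(25 / 24) : ℝ)) + 1 := by
    intro n
    have := jap_pos (ξ ^ 2 / 2 * n)
    rw [ENNReal.ofReal_add (by positivity) (by norm_num), ENNReal.ofReal_one,
      show (2:ℝ≥0∞) = ENNReal.ofReal 2 by simp, ← ENNReal.ofReal_mul (by norm_num), sub_zero,
      abs_of_nonneg (show 0 ≤ ξ ^ 2 / 2 by positivity)]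
    congr 2; ring
  simp_rw [hpt]
  rw [lintegral_add_right _ measurable_const, lintegral_const_mul _ (by fun_prop)]
  have hv : volume {n : ℝ | |n| ≤ 1} = 2 := by
    have := volume_setOf_abs_sub_le 0 1
    simpa using this
  rw [setLIntegral_const, hv]
  push_cast
  gcongr
  · exact (setLIntegral_le_lintegral _ _).trans (hC _ 0)
  · simp

/-- The integral is invariant under dilation. For |n| ≤ 2|ξ| the farther of the two singularities is
at distance at least |ξ|/2 and its factor can be frozen; for |n| > 2|ξ| one has |ξ − n| ≥ |n|/2, and
the tail |n|^(-4/3) is integrable. -/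
theorem exists_lintegral_singPow_convolution_le : ∃ C : ℝ≥0, ∀ ξ : ℝ, ξ ≠ 0 →
    ∫⁻ n, ENNReal.ofReal (|ξ| ^ (1 / 3 : ℝ)) * (singPow (2 / 3) n * singPow (2 / 3) (ξ - n)) ≤ C := by
  obtain ⟨C, hC⟩ := exists_setLIntegral_singPow_le (s := 2 / 3) (by norm_num) (by norm_num)
  refine ⟨8 * C + 24, fun ξ hξ => ?_⟩
  have hξ0 := abs_pos.2 hξ
  rw [lintegral_const_mul _ (by fun_prop)]
  set A := {n : ℝ | |n - 0| ≤ 2 * |ξ|} with hA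
  have hAm : MeasurableSet A := measurableSet_le (by fun_prop) (by fun_prop)
  have hvol : volume A = ENNReal.ofReal (2 * (2 * |ξ|)) := volume_setOf_abs_sub_le _ _
  have hAc : Aᶜ = {n : ℝ | 2 * |ξ| < |n|} := by
    ext n
    change ¬ (|n - 0| ≤ 2 * |ξ|) ↔ 2 * |ξ| < |n|
    rw [sub_zero, not_le]
  rw [← lintegral_add_compl _ hAm, mul_add]
  push_cast
  have htwo : (2:ℝ) ^ (2 / 3 : ℝ) ≤ 2 :=
    (Real.rpow_le_rpow_of_exponent_le (by norm_num) (by norm_num : (2 / 3 : ℝ) ≤ 1)).trans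
      (Real.rpow_one 2).le
  have hhalf : ∀ x : ℝ, x ≠ 0 → singPow (2 / 3) (x / 2) ≤ 2 * singPow (2 / 3) x := by
    intro x hx
    rw [singPow_of_ne_zero hx, singPow_of_ne_zero (by positivity), abs_div, abs_two,
      show (2:ℝ≥0∞) = ENNReal.ofReal 2 by simp, ← ENNReal.ofReal_mul (by norm_num)]
    refine ENNReal.ofReal_le_ofReal ?_
    rw [Real.div_rpow (abs_nonneg _) (by norm_num), Real.rpow_neg (by norm_num : (0:ℝ) ≤ 2),
      div_inv_eq_mul, mul_comm]
    gcongr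
  refine add_le_add ?_ ?_
  · have hpt : ∀ n : ℝ, singPow (2 / 3) n * singPow (2 / 3) (ξ - n) ≤
        2 * singPow (2 / 3) ξ * (singPow (2 / 3) (n - 0) + singPow (2 / 3) (n - ξ)) := by
      intro n
      rw [← singPow_neg _ (n - ξ), neg_sub, sub_zero, mul_add]
      have hs : |ξ| ≤ |n| + |ξ - n| := by
        have := abs_add_le n (ξ - n); rwa [add_sub_cancel] at this
      rcases le_total (|n|) (|ξ - n|) with h | h
      · refine le_trans ?_ le_self_add
        rw [mul_comm]; gcongr
        refine (singPow_anti (by norm_num) ?_).trans (hhalf ξ hξ)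
        rw [abs_div, abs_two]; linarith
      · refine le_trans ?_ le_add_self
        gcongr
        refine (singPow_anti (by norm_num) ?_).trans (hhalf ξ hξ)
        rw [abs_div, abs_two]; linarith
    calc _ ≤ ENNReal.ofReal (|ξ| ^ (1 / 3 : ℝ)) * ∫⁻ n in A, 2 * singPow (2 / 3) ξ *
          (singPow (2 / 3) (n - 0) + singPow (2 / 3) (n - ξ)) := by
          gcongr _ * ∫⁻ n in A, ?_ with n; exact hpt n
      _ ≤ ENNReal.ofReal (|ξ| ^ (1 / 3 : ℝ)) * (2 * singPow (2 / 3) ξ *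
          (C * volume A ^ (1 - 2 / 3 : ℝ) + C * volume A ^ (1 - 2 / 3 : ℝ))) := by
          rw [lintegral_const_mul _ (by fun_prop), lintegral_add_left (by fun_prop)]
          gcongr <;> exact hC A hAm _
      _ = 4 * C * (ENNReal.ofReal (|ξ| ^ (1 / 3 : ℝ)) * singPow (2 / 3) ξ *
          volume A ^ (1 - 2 / 3 : ℝ)) := by ring
      _ ≤ 4 * C * 2 := by
          gcongr
          rw [hvol, singPow_of_ne_zero hξ, ENNReal.ofReal_rpow_of_pos (by positivity),
            ← ENNReal.ofReal_mul (by positivity), ← ENNReal.ofReal_mul (by positivity),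
            show (2:ℝ≥0∞) = ENNReal.ofReal 2 by simp]
          refine ENNReal.ofReal_le_ofReal ?_
          rw [show (2 * (2 * |ξ|)) = 4 * |ξ| by ring, Real.mul_rpow (by norm_num) (abs_nonneg _),
            show |ξ| ^ (1 / 3 : ℝ) * |ξ| ^ (-(2 / 3) : ℝ) *
              (4 ^ (1 - 2 / 3 : ℝ) * |ξ| ^ (1 - 2 / 3 : ℝ)) = 4 ^ (1 - 2 / 3 : ℝ) *
              (|ξ| ^ (1 / 3 : ℝ) * |ξ| ^ (-(2 / 3) : ℝ) * |ξ| ^ (1 - 2 / 3 : ℝ)) by ring,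
            ← Real.rpow_add hξ0, ← Real.rpow_add hξ0]
          norm_num
          rw [show (4:ℝ) = 2 ^ (2:ℝ) by norm_num, ← Real.rpow_mul (by norm_num)]
          norm_num at htwo ⊢
          exact htwo
      _ = _ := by ring
  · rw [hAc]
    have hpt : ∀ n ∈ {n : ℝ | 2 * |ξ| < |n|}, singPow (2 / 3) n * singPow (2 / 3) (ξ - n) ≤
        2 * ENNReal.ofReal (|n| ^ (-(4 / 3) : ℝ)) := by
      intro n hn
      change 2 * |ξ| < |n| at hn
      have hn0 : n ≠ 0 := by rintro rfl; simp at hn; linarith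
      rw [← singPow_of_ne_zero hn0, show (4 / 3 : ℝ) = 2 / 3 + 2 / 3 by norm_num,
        singPow_add (by norm_num) (by norm_num), mul_left_comm]
      gcongr
      refine (singPow_anti (by norm_num) ?_).trans (hhalf n hn0)
      rw [abs_div, abs_two]
      have := abs_sub_abs_le_abs_sub n ξ
      rw [abs_sub_comm n ξ] at this
      linarith
    have hm : MeasurableSet {n : ℝ | 2 * |ξ| < |n|} := measurableSet_lt (by fun_prop) (by fun_prop)
    calc _ ≤ ENNReal.ofReal (|ξ| ^ (1 / 3 : ℝ)) * ∫⁻ n in {n : ℝ | 2 * |ξ| < |n|},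
          2 * ENNReal.ofReal (|n| ^ (-(4 / 3) : ℝ)) := by
          refine mul_le_mul_right ?_ _
          exact setLIntegral_mono' hm hpt
      _ ≤ ENNReal.ofReal (|ξ| ^ (1 / 3 : ℝ)) * (2 * (2 *
          ENNReal.ofReal ((2 * |ξ|) ^ (1 - 4 / 3 : ℝ) / (4 / 3 - 1)))) := by
          rw [lintegral_const_mul _ (by fun_prop), ← lintegral_Ioi_rpow_neg (by norm_num)
            (by positivity)]
          gcongr
          exact lintegral_comp_abs_le (f := fun x => ENNReal.ofReal (x ^ (-(4 / 3) : ℝ)))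
            (by fun_prop) _
      _ = 4 * ENNReal.ofReal (|ξ| ^ (1 / 3 : ℝ) * ((2 * |ξ|) ^ (1 - 4 / 3 : ℝ) / (4 / 3 - 1))) := by
          rw [ENNReal.ofReal_mul (by positivity)]; ring
      _ ≤ 4 * ENNReal.ofReal 6 := by
          gcongr
          rw [Real.mul_rpow (by norm_num) (abs_nonneg _), mul_div_assoc', mul_left_comm,
            ← Real.rpow_add hξ0]
          have : (2:ℝ) ^ (1 - 4 / 3 : ℝ) ≤ 1 :=
            Real.rpow_le_one_of_one_le_of_nonpos (by norm_num) (by norm_num)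
          norm_num at this ⊢
          linarith
      _ = 24 := by rw [show ENNReal.ofReal 6 = 6 by simp]; norm_num

/-- The frequency integral for the `L²_ζ L¹_τ` estimate. -/
theorem exists_lintegral_resonance_le : ∃ C : ℝ≥0, ∀ ξ : ℝ, ξ ≠ 0 →
    ∫⁻ n, ENNReal.ofReal (ξ ^ 2 * jap (ξ * (n * (ξ - n))) ^ (-(13 / 12) : ℝ)) *
      (1 + ENNReal.ofReal (|ξ / (n * (ξ - n))| ^ (-(1 / 2) : ℝ) *
        jap (3 * ξ * (n * (ξ - n))) ^ (1 / 2 - 7 / 12 : ℝ))) ≤ C := by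
  obtain ⟨C₁, hC₁⟩ := exists_lintegral_scaled_jap_le (p := 13 / 12) (by norm_num)
  obtain ⟨C₂, hC₂⟩ := exists_lintegral_singPow_convolution_le
  refine ⟨4 * C₁ + C₂, fun ξ hξ => ?_⟩
  have hξ0 := abs_pos.2 hξ
  set c := ξ ^ 2 / 2 with hc
  have hc0 : 0 < c := by positivity
  -- The larger of |n| and |ξ − n| is at least |ξ|/2, so |ξn(ξ − n)| is at least ξ²/2 times the
  -- smaller one. The prefactor ξ² is then a Jacobian.
  have h1 : ∀ n : ℝ, ENNReal.ofReal (ξ ^ 2 * jap (ξ * (n * (ξ - n))) ^ (-(13 / 12) : ℝ)) ≤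
      2 * ENNReal.ofReal (|c| * jap (c * (n - 0)) ^ (-(13 / 12) : ℝ)) +
      2 * ENNReal.ofReal (|c| * jap (c * (n - ξ)) ^ (-(13 / 12) : ℝ)) := by
    intro n
    have hs : |ξ| ≤ |n| + |ξ - n| := by
      have := abs_add_le n (ξ - n); rwa [add_sub_cancel] at this
    have hx : ∀ y : ℝ, |c * y| ≤ |ξ * (n * (ξ - n))| →
        ENNReal.ofReal (ξ ^ 2 * jap (ξ * (n * (ξ - n))) ^ (-(13 / 12) : ℝ)) ≤
        2 * ENNReal.ofReal (|c| * jap (c * y) ^ (-(13 / 12) : ℝ)) := by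
      intro y hy
      rw [show (2:ℝ≥0∞) = ENNReal.ofReal 2 by simp, ← ENNReal.ofReal_mul (by norm_num)]
      refine ENNReal.ofReal_le_ofReal ?_
      rw [abs_of_pos hc0, ← mul_assoc 2, show 2 * c = ξ ^ 2 by rw [hc]; ring]
      gcongr ?_ * ?_
      exact jap_rpow_neg_anti (by norm_num) hy
    have hc2 : c = |ξ| * |ξ| / 2 := by rw [hc, ← sq, sq_abs]
    rcases le_total (|n|) (|ξ - n|) with h | h
    · refine (hx (n - 0) ?_).trans le_self_add
      rw [abs_mul, abs_mul, abs_mul, abs_of_pos hc0, sub_zero, hc2]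
      nlinarith [mul_nonneg hξ0.le (abs_nonneg n)]
    · refine (hx (n - ξ) ?_).trans le_add_self
      rw [abs_mul, abs_mul, abs_mul, abs_of_pos hc0, hc2, abs_sub_comm n ξ]
      nlinarith [mul_nonneg hξ0.le (abs_nonneg (ξ - n))]
  -- Counting powers: 2 − 13/12 − 1/2 − 1/12 = 1/3 for ξ, and −13/12 + 1/2 − 1/12 = −2/3 for n(ξ −
  -- n).
  have h2 : ∀ n : ℝ, n ≠ 0 → n ≠ ξ →
      ENNReal.ofReal (ξ ^ 2 * jap (ξ * (n * (ξ - n))) ^ (-(13 / 12) : ℝ)) *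
      ENNReal.ofReal (|ξ / (n * (ξ - n))| ^ (-(1 / 2) : ℝ) *
        jap (3 * ξ * (n * (ξ - n))) ^ (1 / 2 - 7 / 12 : ℝ)) ≤
      ENNReal.ofReal (|ξ| ^ (1 / 3 : ℝ)) * (singPow (2 / 3) n * singPow (2 / 3) (ξ - n)) := by
    intro n hn hnξ
    have hξn : ξ - n ≠ 0 := sub_ne_zero.2 hnξ.symm
    rw [← singPow_mul]
    set m := n * (ξ - n) with hm
    have hm0 : m ≠ 0 := mul_ne_zero hn hξn
    have hm1 := abs_pos.2 hm0
    rw [singPow_of_ne_zero hm0, ← ENNReal.ofReal_mul (by have := jap_pos (ξ * m); positivity),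
      ← ENNReal.ofReal_mul (by positivity)]
    refine ENNReal.ofReal_le_ofReal ?_
    have hx0 : 0 < |ξ * m| := abs_pos.2 (mul_ne_zero hξ hm0)
    have j1 : jap (ξ * m) ^ (-(13 / 12) : ℝ) ≤ |ξ * m| ^ (-(13 / 12) : ℝ) :=
      Real.rpow_le_rpow_of_nonpos hx0 (abs_le_jap _) (by norm_num)
    have j2 : jap (3 * ξ * m) ^ (1 / 2 - 7 / 12 : ℝ) ≤ |ξ * m| ^ (1 / 2 - 7 / 12 : ℝ) := by
      refine Real.rpow_le_rpow_of_nonpos hx0 ?_ (by norm_num)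
      refine le_trans ?_ (abs_le_jap _)
      rw [mul_assoc, abs_mul 3, abs_of_pos (by norm_num : (0:ℝ) < 3)]; linarith
    rw [abs_div_rpow_neg_half]
    have hj := jap_pos (3 * ξ * m)
    calc ξ ^ 2 * jap (ξ * m) ^ (-(13 / 12) : ℝ) *
          (|m / ξ| ^ (1 / 2 : ℝ) * jap (3 * ξ * m) ^ (1 / 2 - 7 / 12 : ℝ))
        ≤ ξ ^ 2 * |ξ * m| ^ (-(13 / 12) : ℝ) *
          (|m / ξ| ^ (1 / 2 : ℝ) * |ξ * m| ^ (1 / 2 - 7 / 12 : ℝ)) := by gcongr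
      _ = |ξ| ^ (1 / 3 : ℝ) * |m| ^ (-(2 / 3) : ℝ) := by
        rw [← sq_abs, ← Real.rpow_two, abs_mul, abs_div, Real.mul_rpow hξ0.le hm1.le,
          Real.mul_rpow hξ0.le hm1.le, Real.div_rpow hm1.le hξ0.le, div_eq_mul_inv (_ ^ _),
          ← Real.rpow_neg hξ0.le]
        rw [show |ξ| ^ (2:ℝ) * (|ξ| ^ (-(13 / 12) : ℝ) * |m| ^ (-(13 / 12) : ℝ)) *
          (|m| ^ (1 / 2 : ℝ) * |ξ| ^ (-(1 / 2) : ℝ) * (|ξ| ^ (1 / 2 - 7 / 12 : ℝ) *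
            |m| ^ (1 / 2 - 7 / 12 : ℝ))) =
          (|ξ| ^ (2:ℝ) * |ξ| ^ (-(13 / 12) : ℝ) * |ξ| ^ (-(1 / 2) : ℝ) *
            |ξ| ^ (1 / 2 - 7 / 12 : ℝ)) * (|m| ^ (-(13 / 12) : ℝ) * |m| ^ (1 / 2 : ℝ) *
            |m| ^ (1 / 2 - 7 / 12 : ℝ)) by ring]
        simp only [← Real.rpow_add hξ0, ← Real.rpow_add hm1]
        norm_num
  calc _ ≤ ∫⁻ n, ((2 * ENNReal.ofReal (|c| * jap (c * (n - 0)) ^ (-(13 / 12) : ℝ)) +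
      2 * ENNReal.ofReal (|c| * jap (c * (n - ξ)) ^ (-(13 / 12) : ℝ))) +
      ENNReal.ofReal (|ξ| ^ (1 / 3 : ℝ)) * (singPow (2 / 3) n * singPow (2 / 3) (ξ - n))) := by
        refine lintegral_mono_ae ?_
        filter_upwards [Measure.ae_ne volume (0:ℝ), Measure.ae_ne volume ξ] with n hn hnξ
        rw [mul_add, mul_one]
        exact add_le_add (h1 n) (h2 n hn hnξ)
    _ ≤ (2 * C₁ + 2 * C₁) + C₂ := by
        rw [lintegral_add_left (by fun_prop), lintegral_add_left (by fun_prop),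
          lintegral_const_mul _ (by fun_prop), lintegral_const_mul _ (by fun_prop)]
        gcongr
        · exact hC₁ c 0
        · exact hC₁ c ξ
        · exact hC₂ ξ hξ
    _ = _ := by push_cast; ring

/-! ### Quadratic estimates for bilinear integral operators -/

theorem sq_lintegral_mul_le {α : Type*} [MeasurableSpace α] {μ : Measure α} {f g : α → ℝ≥0∞}
    (hf : AEMeasurable f μ) (hg : AEMeasurable g μ) :
    (∫⁻ a, f a * g a ∂μ) ^ 2 ≤ (∫⁻ a, f a ^ 2 ∂μ) * ∫⁻ a, g a ^ 2 ∂μ := by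
  have h := ENNReal.lintegral_mul_le_Lp_mul_Lq μ Real.HolderConjugate.two_two hf hg
  simp only [Pi.mul_apply, ENNReal.rpow_two] at h
  calc _ ≤ ((∫⁻ a, f a ^ 2 ∂μ) ^ (1 / 2 : ℝ) * (∫⁻ a, g a ^ 2 ∂μ) ^ (1 / 2 : ℝ)) ^ 2 := by gcongr
    _ = _ := by
      rw [mul_pow, ← ENNReal.rpow_mul_natCast, ← ENNReal.rpow_mul_natCast]; norm_num

theorem mul_le_sq_add_sq (x y : ℝ≥0∞) : x * y ≤ x ^ 2 + y ^ 2 := by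
  rw [sq, sq]
  rcases le_total x y with h | h
  · exact (mul_le_mul_left h _).trans le_add_self
  · exact (mul_le_mul_right h _).trans le_self_add

/-- A bound for the square integral by duality. -/
theorem lintegral_sq_le_of_forall_lintegral_mul_le {α : Type*} [MeasurableSpace α]
    {μ : Measure α} [SigmaFinite μ] {h : α → ℝ≥0∞} (hh : Measurable h) {A : ℝ≥0∞}
    (H : ∀ k : α → ℝ≥0∞, Measurable k → (∫⁻ x, h x * k x ∂μ) ^ 2 ≤ A * ∫⁻ x, k x ^ 2 ∂μ) :
    ∫⁻ x, h x ^ 2 ∂μ ≤ A := by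
  -- The truncations have finite energy I, which can therefore be cancelled in I² ≤ A I; monotone
  -- convergence removes the truncation.
  set k : ℕ → α → ℝ≥0∞ := fun n => (spanningSets μ n).indicator fun x => min (h x) n with hk
  have hkm : ∀ n, Measurable (k n) := fun n =>
    (hh.min measurable_const).indicator (measurableSet_spanningSets μ n)
  have hkh : ∀ n x, k n x ≤ h x := fun n x =>
    (Set.indicator_le_self _ _ x).trans (min_le_left _ _)
  have hfin : ∀ n, ∫⁻ x, k n x ^ 2 ∂μ ≠ ⊤ := by
    intro n
    have : ∫⁻ x, k n x ^ 2 ∂μ ≤ ∫⁻ x in spanningSets μ n, (n : ℝ≥0∞) ^ 2 ∂μ := by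
      rw [← lintegral_indicator (measurableSet_spanningSets μ n)]
      refine lintegral_mono fun x => ?_
      by_cases hx : x ∈ spanningSets μ n
      · simp only [hk, Set.indicator_of_mem hx]; gcongr; exact min_le_right _ _
      · simp [hk, Set.indicator_of_notMem hx]
    refine ne_top_of_le_ne_top ?_ this
    rw [setLIntegral_const]
    exact ENNReal.mul_ne_top (by simp) (measure_spanningSets_lt_top μ n).ne
  have hle : ∀ n, ∫⁻ x, k n x ^ 2 ∂μ ≤ A := by
    intro n
    set I := ∫⁻ x, k n x ^ 2 ∂μ with hI
    rcases eq_or_ne I 0 with h0 | h0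
    · rw [h0]; exact zero_le
    have h1 : I ^ 2 ≤ A * I := by
      refine le_trans ?_ (H (k n) (hkm n))
      gcongr
      refine lintegral_mono fun x => ?_
      rw [sq]; gcongr; exact hkh n x
    rw [sq] at h1
    exact (ENNReal.mul_le_mul_iff_left h0 (hfin n)).1 h1
  have hmono : Monotone k := by
    intro m n hmn x
    by_cases hx : x ∈ spanningSets μ m
    · simp only [hk, Set.indicator_of_mem hx,
        Set.indicator_of_mem (monotone_spanningSets μ hmn hx)]
      gcongr
    · simp only [hk, Set.indicator_of_notMem hx]; exact zero_le
  have hsup : ∀ x, h x ^ 2 ≤ ⨆ n, k n x ^ 2 := by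
    intro x
    have : h x = ⨆ n, k n x := by
      refine le_antisymm ?_ (iSup_le fun n => hkh n x)
      refine le_of_forall_lt fun c hc => ?_
      obtain ⟨n, hn⟩ := ENNReal.exists_nat_gt (ne_top_of_lt hc)
      refine lt_of_lt_of_le ?_ (le_iSup (fun n => k n x) (max n (spanningSetsIndex μ x)))
      have hx : x ∈ spanningSets μ (max n (spanningSetsIndex μ x)) :=
        monotone_spanningSets μ (le_max_right _ _) (mem_spanningSetsIndex μ x)
      simp only [hk, Set.indicator_of_mem hx]
      refine lt_min hc (hn.trans_le ?_)
      exact_mod_cast le_max_left _ _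
    rw [this, sq, ENNReal.iSup_mul]
    refine iSup_le fun m => ?_
    rw [ENNReal.mul_iSup]
    refine iSup_le fun n => ?_
    refine le_trans ?_ (le_iSup (fun n => k n x ^ 2) (max m n))
    rw [sq]
    gcongr
    · exact hmono (le_max_left m n) x
    · exact hmono (le_max_right m n) x
  calc ∫⁻ x, h x ^ 2 ∂μ ≤ ∫⁻ x, ⨆ n, k n x ^ 2 ∂μ := lintegral_mono hsup
    _ = ⨆ n, ∫⁻ x, k n x ^ 2 ∂μ := lintegral_iSup (fun n => (hkm n).pow_const 2)
        (fun m n hmn x => by have := hmono hmn x; dsimp only; gcongr)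
    _ ≤ A := iSup_le hle

/-- An integral operator on `L²` is bounded when its transpose is. -/
theorem lintegral_sq_le_of_transpose {α β : Type*} [MeasurableSpace α] [MeasurableSpace β]
    {μ : Measure α} {ν : Measure β} [SigmaFinite μ] [SigmaFinite ν] {M : α → β → ℝ≥0∞}
    (hM : Measurable (Function.uncurry M)) {B : ℝ≥0∞}
    (H : ∀ k : α → ℝ≥0∞, Measurable k →
      ∫⁻ b, (∫⁻ a, M a b * k a ∂μ) ^ 2 ∂ν ≤ B * ∫⁻ a, k a ^ 2 ∂μ)
    {f : β → ℝ≥0∞} (hf : Measurable f) :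
    ∫⁻ a, (∫⁻ b, M a b * f b ∂ν) ^ 2 ∂μ ≤ B * ∫⁻ b, f b ^ 2 ∂ν := by
  have hMf : Measurable (Function.uncurry fun a b => M a b * f b) :=
    hM.mul (hf.comp measurable_snd)
  refine lintegral_sq_le_of_forall_lintegral_mul_le hMf.lintegral_prod_right fun k hk => ?_
  have hMk : Measurable (Function.uncurry fun a b => M a b * k a) :=
    hM.mul (hk.comp measurable_fst)
  have e : ∫⁻ a, (∫⁻ b, M a b * f b ∂ν) * k a ∂μ =
      ∫⁻ b, f b * ∫⁻ a, M a b * k a ∂μ ∂ν := by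
    calc _ = ∫⁻ a, ∫⁻ b, M a b * f b * k a ∂ν ∂μ := by
          refine lintegral_congr fun a => ?_
          have : Measurable fun b => M a b * f b := hMf.comp measurable_prodMk_left
          rw [lintegral_mul_const _ this]
      _ = ∫⁻ b, ∫⁻ a, M a b * f b * k a ∂μ ∂ν :=
          lintegral_lintegral_swap (hMf.mul (hk.comp measurable_fst)).aemeasurable
      _ = _ := by
          refine lintegral_congr fun b => ?_
          have : Measurable fun a => M a b * k a := hMk.comp measurable_prodMk_right
          rw [← lintegral_const_mul _ this]
          refine lintegral_congr fun a => ?_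
          ring
  rw [e]
  calc _ ≤ (∫⁻ b, f b ^ 2 ∂ν) * ∫⁻ b, (∫⁻ a, M a b * k a ∂μ) ^ 2 ∂ν :=
        sq_lintegral_mul_le hf.aemeasurable hMk.lintegral_prod_left.aemeasurable
    _ ≤ (∫⁻ b, f b ^ 2 ∂ν) * (B * ∫⁻ a, k a ^ 2 ∂μ) := by gcongr; exact H k hk
    _ = _ := by ring

/-! ### Bilinear operators on an abelian group. -/

section Convolution

variable {G : Type*} [AddCommGroup G] [MeasurableSpace G] [MeasurableAdd₂ G] [MeasurableNeg G]
  {μ : Measure G} [SFinite μ] [μ.IsAddLeftInvariant]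

theorem lintegral_lintegral_mul_sub {f g : G → ℝ≥0∞} (hf : Measurable f) (hg : Measurable g) :
    ∫⁻ z, ∫⁻ a, f a * g (z - a) ∂μ ∂μ = (∫⁻ a, f a ∂μ) * ∫⁻ a, g a ∂μ := by
  rw [lintegral_lintegral_swap (by fun_prop), ← lintegral_mul_const _ hf]
  refine lintegral_congr fun a => ?_
  rw [lintegral_const_mul _ (by fun_prop)]
  congr 1
  exact lintegral_sub_right_eq_self g a

/-- Bilinear estimate by the Cauchy–Schwarz inequality with the output variable fixed. -/
theorem lintegral_sq_bilinear_le {K : G → G → ℝ≥0∞} (hK : Measurable (Function.uncurry K))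
    {f g : G → ℝ≥0∞} (hf : Measurable f) (hg : Measurable g) {C : ℝ≥0∞}
    (H : ∀ z, ∫⁻ a, K z a ^ 2 ∂μ ≤ C) :
    ∫⁻ z, (∫⁻ a, K z a * (f a * g (z - a)) ∂μ) ^ 2 ∂μ ≤
      C * ((∫⁻ a, f a ^ 2 ∂μ) * ∫⁻ a, g a ^ 2 ∂μ) := by
  rw [← lintegral_lintegral_mul_sub (hf.pow_const 2) (hg.pow_const 2),
    ← lintegral_const_mul _ (by
      have : Measurable (Function.uncurry fun z a => f a ^ 2 * g (z - a) ^ 2) := by fun_prop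
      exact this.lintegral_prod_right)]
  refine lintegral_mono fun z => ?_
  refine (sq_lintegral_mul_le (hK.comp measurable_prodMk_left).aemeasurable
    (by fun_prop)).trans ?_
  gcongr
  · exact H z
  · rw [mul_pow]

variable [μ.IsNegInvariant]

/-- Bilinear estimate through the sum of the incoming and the reflected variables. -/
theorem lintegral_sq_bilinear_le_of_reflected {w : G → G → ℝ≥0∞}
    (hw : Measurable (Function.uncurry w)) {p r f g : G → ℝ≥0∞} (hp : Measurable p)
    (hr : Measurable r) (hf : Measurable f) (hg : Measurable g) {C : ℝ≥0∞}
    (H : ∀ a e, ∫⁻ c, w (a + c - e) a * w (a + c - e) c * (p c ^ 2 * r (c - e) ^ 2) ∂μ ≤ C) :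
    ∫⁻ z, (∫⁻ a, w z a * (p a * r (z - a)) * (f a * g (z - a)) ∂μ) ^ 2 ∂μ ≤
      2 * C * ((∫⁻ a, f a ^ 2 ∂μ) * ∫⁻ a, g a ^ 2 ∂μ) := by
  have hw' : ∀ {X : Type _} [MeasurableSpace X] {u v : X → G}, Measurable u → Measurable v →
      Measurable fun x => w (u x) (v x) := fun hu hv => hw.comp (hu.prodMk hv)
  set k : G → G → ℝ≥0∞ := fun z a => w z a * (p a * r (z - a)) * (f a * g (z - a)) with hk
  have hkm : Measurable (Function.uncurry k) := by
    have := hw' (X := G × G) measurable_fst measurable_snd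
    simp only [hk, Function.uncurry_def]; fun_prop
  -- The square of the inner integral is a double integral over a and c. Its factors are crossed,
  -- f(a) with g(z − c) and f(c) with g(z − a), before xy ≤ x² + y² is applied; the two resulting
  -- terms are exchanged by a ↔ c.
  set T : G → G → G → ℝ≥0∞ := fun a c z => w z a * w z c *
    (p c ^ 2 * r (z - a) ^ 2 * (f a ^ 2 * g (z - c) ^ 2)) with hT
  have hTm : Measurable fun x : G × G × G => T x.1 x.2.1 x.2.2 := by
    have h1 := hw' (X := G × G × G) (u := fun x => x.2.2) (v := fun x => x.1)
      (by fun_prop) (by fun_prop)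
    have h2 := hw' (X := G × G × G) (u := fun x => x.2.2) (v := fun x => x.2.1)
      (by fun_prop) (by fun_prop)
    simp only [hT]; fun_prop
  have hT' : ∀ {X : Type _} [MeasurableSpace X] {u v t : X → G}, Measurable u → Measurable v →
      Measurable t → Measurable fun x => T (u x) (v x) (t x) := fun hu hv ht =>
    hTm.comp (hu.prodMk (hv.prodMk ht))
  have hpt : ∀ z a c, k z a * k z c ≤ T a c z + T c a z := by
    intro z a c
    have := mul_le_sq_add_sq (p c * r (z - a) * (f a * g (z - c)))
      (p a * r (z - c) * (f c * g (z - a)))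
    calc k z a * k z c = w z a * w z c * ((p c * r (z - a) * (f a * g (z - c))) *
          (p a * r (z - c) * (f c * g (z - a)))) := by simp only [hk]; ring
      _ ≤ w z a * w z c * ((p c * r (z - a) * (f a * g (z - c))) ^ 2 +
          (p a * r (z - c) * (f c * g (z - a))) ^ 2) := by gcongr
      _ = _ := by simp only [hT]; ring
  have hmain : ∫⁻ a, ∫⁻ c, ∫⁻ z, T a c z ∂μ ∂μ ∂μ ≤
      C * ((∫⁻ a, f a ^ 2 ∂μ) * ∫⁻ a, g a ^ 2 ∂μ) := by
    rw [← lintegral_mul_const _ (hf.pow_const 2), ← lintegral_const_mul _ (by fun_prop)]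
    refine lintegral_mono fun a => ?_
    -- With z = a + c − e the arguments z − a and z − c become c − e and a − e. Then f and g depend
    -- on (a, e) only, and the integral over c falls on the weights alone.
    calc ∫⁻ c, ∫⁻ z, T a c z ∂μ ∂μ = ∫⁻ c, ∫⁻ e, T a c (a + c - e) ∂μ ∂μ := by
          refine lintegral_congr fun c => ?_
          rw [lintegral_sub_left_eq_self (fun z => T a c z) (a + c)]
      _ = ∫⁻ e, ∫⁻ c, T a c (a + c - e) ∂μ ∂μ :=
          lintegral_lintegral_swap (hT' (by fun_prop) (by fun_prop) (by fun_prop)).aemeasurable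
      _ ≤ ∫⁻ e, C * (f a ^ 2 * g (a - e) ^ 2) ∂μ := by
          refine lintegral_mono fun e => ?_
          calc ∫⁻ c, T a c (a + c - e) ∂μ
              = ∫⁻ c, (w (a + c - e) a * w (a + c - e) c * (p c ^ 2 * r (c - e) ^ 2)) *
                (f a ^ 2 * g (a - e) ^ 2) ∂μ := by
                refine lintegral_congr fun c => ?_
                simp only [hT]
                rw [show a + c - e - a = c - e by abel, show a + c - e - c = a - e by abel]
                ring
            _ = (∫⁻ c, w (a + c - e) a * w (a + c - e) c * (p c ^ 2 * r (c - e) ^ 2) ∂μ) *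
                (f a ^ 2 * g (a - e) ^ 2) := by
                refine lintegral_mul_const _ ?_
                have h1 := hw' (u := fun c => a + c - e) (v := fun _ => a)
                  (by fun_prop) (by fun_prop)
                have h2 := hw' (u := fun c => a + c - e) (v := fun c => c)
                  (by fun_prop) (by fun_prop)
                fun_prop
            _ ≤ _ := by gcongr; exact H a e
      _ = _ := by
          rw [lintegral_const_mul _ (by fun_prop), lintegral_const_mul _ (by fun_prop),
            lintegral_sub_left_eq_self (fun x => g x ^ 2) a]
  calc ∫⁻ z, (∫⁻ a, k z a ∂μ) ^ 2 ∂μ = ∫⁻ z, ∫⁻ a, ∫⁻ c, k z a * k z c ∂μ ∂μ ∂μ := by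
        refine lintegral_congr fun z => ?_
        have hkz : Measurable (k z) := hkm.comp measurable_prodMk_left
        rw [sq, ← lintegral_mul_const _ hkz]
        refine lintegral_congr fun a => ?_
        rw [lintegral_const_mul _ hkz]
    _ ≤ ∫⁻ z, ∫⁻ a, ∫⁻ c, (T a c z + T c a z) ∂μ ∂μ ∂μ := by
        gcongr with z a c; exact hpt z a c
    _ = (∫⁻ z, ∫⁻ a, ∫⁻ c, T a c z ∂μ ∂μ ∂μ) + ∫⁻ z, ∫⁻ a, ∫⁻ c, T c a z ∂μ ∂μ ∂μ := by
        have m2 : ∀ z, Measurable (Function.uncurry fun a c => T a c z) := fun z =>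
          hT' (by fun_prop) (by fun_prop) (by fun_prop)
        have m3 : Measurable fun x : (G × G) × G => T x.1.2 x.2 x.1.1 :=
          hT' (by fun_prop) (by fun_prop) (by fun_prop)
        rw [← lintegral_add_left]
        · refine lintegral_congr fun z => ?_
          rw [← lintegral_add_left (m2 z).lintegral_prod_right]
          refine lintegral_congr fun a => ?_
          have : Measurable fun c => T a c z := (m2 z).comp measurable_prodMk_left
          rw [lintegral_add_left this]
        · have : Measurable (Function.uncurry fun z a => ∫⁻ c, T a c z ∂μ) :=
            m3.lintegral_prod_right'
          exact this.lintegral_prod_right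
    _ = 2 * ∫⁻ a, ∫⁻ c, ∫⁻ z, T a c z ∂μ ∂μ ∂μ := by
        have e1 : ∫⁻ z, ∫⁻ a, ∫⁻ c, T c a z ∂μ ∂μ ∂μ = ∫⁻ z, ∫⁻ a, ∫⁻ c, T a c z ∂μ ∂μ ∂μ := by
          refine lintegral_congr fun z => ?_
          exact lintegral_lintegral_swap
            (hT' (X := G × G) (by fun_prop) (by fun_prop) (by fun_prop)).aemeasurable
        have m3 : Measurable fun x : (G × G) × G => T x.1.2 x.2 x.1.1 :=
          hT' (by fun_prop) (by fun_prop) (by fun_prop)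
        rw [e1, two_mul]
        have e2 : ∫⁻ z, ∫⁻ a, ∫⁻ c, T a c z ∂μ ∂μ ∂μ = ∫⁻ a, ∫⁻ c, ∫⁻ z, T a c z ∂μ ∂μ ∂μ := by
          rw [lintegral_lintegral_swap
            (f := fun z a => ∫⁻ c, T a c z ∂μ) m3.lintegral_prod_right'.aemeasurable]
          refine lintegral_congr fun a => ?_
          exact lintegral_lintegral_swap
            (hT' (X := G × G) (by fun_prop) (by fun_prop) (by fun_prop)).aemeasurable
        rw [e2]
    _ ≤ _ := by rw [mul_assoc]; gcongr

end Convolution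

/-- The space of frequencies `(τ, ξ, q)`. -/
abbrev Freq : Type := ℝ × ℝ × ℤ

/-- Lebesgue measure in `(τ, ξ)` times the counting measure in `q`. -/
abbrev freqMeasure : Measure Freq :=
  (volume : Measure ℝ).prod ((volume : Measure ℝ).prod Measure.count)

instance : freqMeasure.IsNegInvariant where
  neg_eq_self := by
    have h2 : Measure.map (Prod.map Neg.neg Neg.neg)
        ((volume : Measure ℝ).prod (Measure.count : Measure ℤ)) = volume.prod Measure.count := by
      rw [← Measure.map_prod_map _ _ measurable_neg measurable_neg]
      congr 1
      · exact Measure.map_neg_eq_self _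
      · exact Measure.map_neg_eq_self _
    have h3 : Measure.map (Prod.map Neg.neg (Prod.map Neg.neg Neg.neg)) freqMeasure =
        freqMeasure := by
      rw [← Measure.map_prod_map _ _ measurable_neg (measurable_neg.prodMap measurable_neg), h2]
      congr 1
      exact Measure.map_neg_eq_self _
    exact h3

theorem lintegral_freqMeasure {f : Freq → ℝ≥0∞} (hf : Measurable f) :
    ∫⁻ z, f z ∂freqMeasure = ∫⁻ ξ, ∑' q : ℤ, ∫⁻ τ, f (τ, ξ, q) := by
  rw [lintegral_prod_symm _ hf.aemeasurable, lintegral_prod _ (by fun_prop)]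
  refine lintegral_congr fun ξ => ?_
  rw [lintegral_count]

theorem lintegral_freqMeasure' {f : Freq → ℝ≥0∞} (hf : Measurable f) :
    ∫⁻ z, f z ∂freqMeasure = ∑' q : ℤ, ∫⁻ ξ, ∫⁻ τ, f (τ, ξ, q) := by
  rw [lintegral_freqMeasure hf, lintegral_tsum]
  intro q
  have : Measurable fun x : ℝ × ℝ => f (x.2, x.1, q) := by fun_prop
  exact this.lintegral_prod_right'.aemeasurable

/-! ### Bilinear kernels on the space of frequencies -/

/-- The square root of the kernel `K` defines a bounded bilinear operator on `L²`. -/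
def BilinearBounded (K : Freq → Freq → ℝ≥0∞) : Prop :=
  ∃ C : ℝ≥0, ∀ f g : Freq → ℝ≥0∞, Measurable f → Measurable g →
    ∫⁻ z, (∫⁻ a, K z a ^ (1 / 2 : ℝ) * (f a * g (z - a)) ∂freqMeasure) ^ 2 ∂freqMeasure ≤
      C * ((∫⁻ a, f a ^ 2 ∂freqMeasure) * ∫⁻ a, g a ^ 2 ∂freqMeasure)

/-- None of the three frequencies `ξ` vanishes. -/
def Nondegenerate (z a : Freq) : Prop := z.2.1 ≠ 0 ∧ a.2.1 ≠ 0 ∧ a.2.1 ≠ z.2.1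

theorem ae_frequency_ne (c : ℝ) : ∀ᵐ a : Freq ∂freqMeasure, a.2.1 ≠ c := by
  have h1 : ∀ᵐ x : ℝ × ℤ ∂((volume : Measure ℝ).prod (Measure.count : Measure ℤ)), x.1 ≠ c :=
    Measure.quasiMeasurePreserving_fst.ae (Measure.ae_ne volume c)
  exact (Measure.quasiMeasurePreserving_snd (μ := (volume : Measure ℝ))).ae h1

theorem ae_nondegenerate : ∀ᵐ z : Freq ∂freqMeasure, ∀ᵐ a : Freq ∂freqMeasure,
    Nondegenerate z a := by
  filter_upwards [ae_frequency_ne 0] with z hz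
  filter_upwards [ae_frequency_ne 0, ae_frequency_ne z.2.1] with a h1 h2
  exact ⟨hz, h1, h2⟩

namespace BilinearBounded

/-- Degenerate pairs form a null set, so kernels need to be compared only where the resonance
identity is available. -/
theorem mono {K K' : Freq → Freq → ℝ≥0∞} (h : BilinearBounded K') (c : ℝ≥0)
    (hc : ∀ z a, Nondegenerate z a → K z a ≤ c * K' z a) : BilinearBounded K := by
  obtain ⟨C, hC⟩ := h
  refine ⟨c * C, fun f g hf hg => ?_⟩
  calc _ ≤ ∫⁻ z, (∫⁻ a, (c : ℝ≥0∞) ^ (1 / 2 : ℝ) * (K' z a ^ (1 / 2 : ℝ) * (f a * g (z - a)))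
          ∂freqMeasure) ^ 2 ∂freqMeasure := by
        refine lintegral_mono_ae ?_
        filter_upwards [ae_nondegenerate] with z hz
        gcongr ?_ ^ 2
        refine lintegral_mono_ae ?_
        filter_upwards [hz] with a ha
        rw [← mul_assoc ((c : ℝ≥0∞) ^ _), ← ENNReal.mul_rpow_of_nonneg _ _ (by norm_num)]
        gcongr
        exact hc z a ha
    _ = c * ∫⁻ z, (∫⁻ a, K' z a ^ (1 / 2 : ℝ) * (f a * g (z - a)) ∂freqMeasure) ^ 2
          ∂freqMeasure := by
        rw [← lintegral_const_mul' _ _ ENNReal.coe_ne_top]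
        refine lintegral_congr fun z => ?_
        rw [lintegral_const_mul' _ _ (by simp), mul_pow, ← ENNReal.rpow_mul_natCast]
        norm_num
    _ ≤ c * (C * ((∫⁻ a, f a ^ 2 ∂freqMeasure) * ∫⁻ a, g a ^ 2 ∂freqMeasure)) := by
        gcongr; exact hC f g hf hg
    _ = _ := by push_cast; ring

/-- The square root is subadditive, so majorants may be summed. -/
theorem add {K K' : Freq → Freq → ℝ≥0∞} (hK : Measurable (Function.uncurry K))
    (h : BilinearBounded K) (h' : BilinearBounded K') :
    BilinearBounded fun z a => K z a + K' z a := by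
  obtain ⟨C, hC⟩ := h
  obtain ⟨C', hC'⟩ := h'
  refine ⟨3 * C + 3 * C', fun f g hf hg => ?_⟩
  have hsq : ∀ x y : ℝ≥0∞, (x + y) ^ 2 ≤ 3 * x ^ 2 + 3 * y ^ 2 := fun x y => by
    have := mul_le_sq_add_sq x y
    calc (x + y) ^ 2 = x ^ 2 + y ^ 2 + 2 * (x * y) := by ring
      _ ≤ x ^ 2 + y ^ 2 + 2 * (x ^ 2 + y ^ 2) := by gcongr
      _ = _ := by ring
  have hKm : Measurable fun x : Freq × Freq => K x.1 x.2 := hK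
  have m1 : Measurable (Function.uncurry fun z a : Freq =>
      K z a ^ (1 / 2 : ℝ) * (f a * g (z - a))) := by
    simp only [Function.uncurry_def]; fun_prop
  calc _ ≤ ∫⁻ z, (3 * (∫⁻ a, K z a ^ (1 / 2 : ℝ) * (f a * g (z - a)) ∂freqMeasure) ^ 2 +
          3 * (∫⁻ a, K' z a ^ (1 / 2 : ℝ) * (f a * g (z - a)) ∂freqMeasure) ^ 2)
          ∂freqMeasure := by
        refine lintegral_mono fun z => ?_
        have m2 : Measurable fun a : Freq => K z a ^ (1 / 2 : ℝ) * (f a * g (z - a)) :=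
          m1.comp measurable_prodMk_left
        refine le_trans ?_ (hsq _ _)
        gcongr ?_ ^ 2
        rw [← lintegral_add_left m2]
        refine lintegral_mono fun a => ?_
        rw [← add_mul]
        gcongr
        exact ENNReal.rpow_add_le_add_rpow _ _ (by norm_num) (by norm_num)
    _ = 3 * (∫⁻ z, (∫⁻ a, K z a ^ (1 / 2 : ℝ) * (f a * g (z - a)) ∂freqMeasure) ^ 2
            ∂freqMeasure) +
          3 * ∫⁻ z, (∫⁻ a, K' z a ^ (1 / 2 : ℝ) * (f a * g (z - a)) ∂freqMeasure) ^ 2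
            ∂freqMeasure := by
        rw [lintegral_add_left ((m1.lintegral_prod_right.pow_const 2).const_mul 3),
          lintegral_const_mul' _ _ (by simp), lintegral_const_mul' _ _ (by simp)]
    _ ≤ 3 * (C * ((∫⁻ a, f a ^ 2 ∂freqMeasure) * ∫⁻ a, g a ^ 2 ∂freqMeasure)) +
          3 * (C' * ((∫⁻ a, f a ^ 2 ∂freqMeasure) * ∫⁻ a, g a ^ 2 ∂freqMeasure)) := by
        gcongr
        · exact hC f g hf hg
        · exact hC' f g hf hg
    _ = _ := by push_cast; ring

/-- Cauchy–Schwarz in the input variable with the output z fixed. -/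
theorem of_lintegral_le {K : Freq → Freq → ℝ≥0∞} (hK : Measurable (Function.uncurry K)) {C : ℝ≥0}
    (H : ∀ z, ∫⁻ a, K z a ∂freqMeasure ≤ C) : BilinearBounded K := by
  refine ⟨C, fun f g hf hg => ?_⟩
  have hKm : Measurable fun x : Freq × Freq => K x.1 x.2 := hK
  refine lintegral_sq_bilinear_le (K := fun z a => K z a ^ (1 / 2 : ℝ))
    (by simp only [Function.uncurry_def]; fun_prop) hf hg fun z => ?_
  refine le_trans (le_of_eq (lintegral_congr fun a => ?_)) (H z)
  rw [← ENNReal.rpow_mul_natCast]; norm_num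

/-- For fixed g the operator is linear in f, and its transpose is of the same kind with g replaced
by its reflection, which has the same L² norm. This turns bounds with a dominant output into bounds
with a dominant first input. -/
theorem transpose {K : Freq → Freq → ℝ≥0∞} (hK : Measurable (Function.uncurry K))
    (h : BilinearBounded K) : BilinearBounded fun z a => K a z := by
  obtain ⟨C, hC⟩ := h
  refine ⟨C, fun f g hf hg => ?_⟩
  have hKm : Measurable fun x : Freq × Freq => K x.2 x.1 := hK.comp measurable_swap
  have := lintegral_sq_le_of_transpose (μ := freqMeasure) (ν := freqMeasure)
    (M := fun z a => K a z ^ (1 / 2 : ℝ) * g (z - a))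
    (by simp only [Function.uncurry_def]; fun_prop)
    (B := C * ∫⁻ a, g a ^ 2 ∂freqMeasure) (fun k hk => ?_) hf
  · refine le_trans (le_of_eq ?_) (this.trans (le_of_eq ?_))
    · refine lintegral_congr fun z => ?_
      congr 1
      refine lintegral_congr fun a => ?_
      ring
    · ring
  · have h2 := hC k (fun x => g (-x)) hk (by fun_prop)
    rw [lintegral_neg_eq_self (fun x => g x ^ 2)] at h2
    refine le_trans (le_of_eq ?_) (h2.trans (le_of_eq ?_))
    · refine lintegral_congr fun a => ?_
      congr 1
      refine lintegral_congr fun z => ?_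
      rw [neg_sub]; ring
    · ring

theorem comp_neg {K : Freq → Freq → ℝ≥0∞} (h : BilinearBounded K) :
    BilinearBounded fun z a => K (-z) (-a) := by
  obtain ⟨C, hC⟩ := h
  refine ⟨C, fun f g hf hg => ?_⟩
  have h2 := hC (fun x => f (-x)) (fun x => g (-x)) (by fun_prop) (by fun_prop)
  rw [lintegral_neg_eq_self (fun x => g x ^ 2), lintegral_neg_eq_self (fun x => f x ^ 2)] at h2
  refine le_trans (le_of_eq ?_) h2
  rw [← lintegral_neg_eq_self]
  refine lintegral_congr fun z => ?_
  congr 1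
  rw [← lintegral_neg_eq_self]
  refine lintegral_congr fun a => ?_
  dsimp only
  rw [neg_neg, neg_neg, neg_sub_neg, neg_sub]

end BilinearBounded

/-! ### The modulation -/

/-- The modulation as a function on the space of frequencies. -/
def modul (z : Freq) : ℝ := modulation z.1 z.2.1 z.2.2

@[fun_prop]
theorem measurable_intCast_real : Measurable (fun q : ℤ => (q : ℝ)) := measurable_from_top

@[fun_prop]
theorem measurable_modul : Measurable modul := by
  have h : Measurable fun z : Freq => ((z.2.2 : ℤ) : ℝ) :=
    measurable_intCast_real.comp (measurable_snd.comp measurable_snd)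
  unfold modul modulation
  fun_prop

theorem modul_neg (z : Freq) : modul (-z) = -modul z := by
  simp only [modul, modulation, Prod.fst_neg, Prod.snd_neg]
  push_cast
  rw [neg_sq, div_neg]; ring

theorem jap_modul_sub_comm (z a : Freq) : jap (modul (z - a)) = jap (modul (a - z)) := by
  rw [← neg_sub a z, modul_neg, jap_neg]

/-- Completing the square in the y-frequency of the input. Both corrections to σ(z) carry the sign
of ξn(ξ − n), so they cannot cancel; this is where the sign of q²/ξ in the symbol is used. -/
theorem modul_add_modul_sub {z a : Freq} (h : Nondegenerate z a) :
    modul a + modul (z - a) = modul z + 3 * z.2.1 * (a.2.1 * (z.2.1 - a.2.1)) +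
      z.2.1 / (a.2.1 * (z.2.1 - a.2.1)) * ((a.2.2 : ℝ) - z.2.2 * a.2.1 / z.2.1) ^ 2 := by
  obtain ⟨h1, h2, h3⟩ := h
  have h4 : z.2.1 - a.2.1 ≠ 0 := sub_ne_zero.2 h3.symm
  simp only [modul, modulation, Prod.fst_sub, Prod.snd_sub]
  push_cast
  field_simp
  ring

/-- The resonance function dominates the product of the frequencies. -/
theorem abs_mul_le_abs_resonance {z a : Freq} (h : Nondegenerate z a) :
    3 * |z.2.1 * (a.2.1 * (z.2.1 - a.2.1))| ≤ |modul a + modul (z - a) - modul z| := by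
  rw [modul_add_modul_sub h]
  obtain ⟨h1, h2, h3⟩ := h
  have h4 : z.2.1 - a.2.1 ≠ 0 := sub_ne_zero.2 h3.symm
  set m := a.2.1 * (z.2.1 - a.2.1) with hm
  have hm0 : m ≠ 0 := mul_ne_zero h2 h4
  set p := (a.2.2 : ℝ) - z.2.2 * a.2.1 / z.2.1
  have e : modul z + 3 * z.2.1 * m + z.2.1 / m * p ^ 2 - modul z =
      z.2.1 * m * (3 + (p / m) ^ 2) := by field_simp; ring
  rw [e, abs_mul (z.2.1 * m), abs_of_nonneg (show 0 ≤ 3 + (p / m) ^ 2 by positivity), mul_comm]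
  gcongr
  linarith [sq_nonneg (p / m)]

/-- Summing two brackets of modulations over `(τ, q)`. -/
theorem exists_tsum_lintegral_jap_modul_le {A B γ : ℝ} (hγ : 1 / 2 < γ) (hγ1 : γ < 1)
    (hA : γ ≤ A) (hB : γ ≤ B) (h : 1 < A + B - γ) : ∃ C : ℝ≥0, ∀ (z : Freq) (n : ℝ),
      z.2.1 ≠ 0 → n ≠ 0 → n ≠ z.2.1 →
      ∑' q : ℤ, ∫⁻ τ, ENNReal.ofReal (jap (modul (τ, n, q)) ^ (-A) *
        jap (modul (z - (τ, n, q))) ^ (-B)) ≤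
      C * (1 + ENNReal.ofReal (|z.2.1 / (n * (z.2.1 - n))| ^ (-(1 / 2) : ℝ) *
        jap (modul z + 3 * z.2.1 * (n * (z.2.1 - n))) ^ (1 / 2 - γ))) := by
  obtain ⟨C₁, hC₁⟩ := exists_lintegral_jap_mul_jap_le (by linarith : 0 ≤ γ) hA hB h
  obtain ⟨C₂, hC₂⟩ := exists_tsum_jap_quadratic_le hγ hγ1
  refine ⟨C₁ * C₂, fun z n hz hn hnz => ?_⟩
  -- Both modulations are affine in τ with slopes ±1, so the τ-integral is a convolution of
  -- brackets, evaluated at σ(a) + σ(z − a). This sum does not depend on τ and is quadratic in q by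
  -- the resonance identity.
  have hstep : ∀ q : ℤ, ∫⁻ τ, ENNReal.ofReal (jap (modul (τ, n, q)) ^ (-A) *
        jap (modul (z - (τ, n, q))) ^ (-B)) ≤
      C₁ * ENNReal.ofReal (jap (modul z + 3 * z.2.1 * (n * (z.2.1 - n)) +
        z.2.1 / (n * (z.2.1 - n)) * ((q : ℝ) - z.2.2 * n / z.2.1) ^ 2) ^ (-γ)) := by
    intro q
    have hres : ∀ τ : ℝ, modul (τ, n, q) + modul (z - (τ, n, q)) = _ := fun τ =>
      modul_add_modul_sub (z := z) (a := (τ, n, q)) ⟨hz, hn, hnz⟩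
    simp only at hres
    have e1 : ∀ τ : ℝ, modul (τ, n, q) = τ - -modul (0, n, q) := fun τ => by
      simp only [modul, modulation]; ring
    have e2 : ∀ τ : ℝ, jap (modul (z - (τ, n, q))) = jap (τ - modul (z - (0, n, q))) := fun τ => by
      rw [← jap_neg]; congr 1
      simp only [modul, modulation, Prod.fst_sub, Prod.snd_sub]; ring
    have := hC₁ (-modul (0, n, q)) (modul (z - (0, n, q)))
    rw [← jap_neg, show -(-modul (0, n, q) - modul (z - (0, n, q))) =
      modul (0, n, q) + modul (z - (0, n, q)) by ring, hres 0] at this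
    refine le_trans (le_of_eq (lintegral_congr fun τ => ?_)) this
    rw [e2 τ, ← e1 τ]
  calc _ ≤ ∑' q : ℤ, C₁ * ENNReal.ofReal (jap (modul z + 3 * z.2.1 * (n * (z.2.1 - n)) +
        z.2.1 / (n * (z.2.1 - n)) * ((q : ℝ) - z.2.2 * n / z.2.1) ^ 2) ^ (-γ)) :=
        ENNReal.tsum_le_tsum hstep
    _ ≤ C₁ * (C₂ * (1 + ENNReal.ofReal (|z.2.1 / (n * (z.2.1 - n))| ^ (-(1 / 2) : ℝ) *
        jap (modul z + 3 * z.2.1 * (n * (z.2.1 - n))) ^ (1 / 2 - γ)))) := by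
        rw [ENNReal.tsum_mul_left]
        gcongr
        exact hC₂ _ _ _ (div_ne_zero hz (mul_ne_zero hn (sub_ne_zero.2 hnz.symm)))
    _ = _ := by push_cast; ring

/-- The integrations in τ and q are made at fixed n and do not see F, which can therefore encode any
weight and any restriction of the frequency. -/
theorem exists_lintegral_frequency_mul_jap_modul_le {A B γ : ℝ} (hγ : 1 / 2 < γ) (hγ1 : γ < 1)
    (hA : γ ≤ A) (hB : γ ≤ B) (h : 1 < A + B - γ) : ∃ C : ℝ≥0, ∀ (z : Freq) (F : ℝ → ℝ≥0∞),
      z.2.1 ≠ 0 → Measurable F →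
      ∫⁻ a : Freq, F a.2.1 * ENNReal.ofReal (jap (modul a) ^ (-A) *
        jap (modul (z - a)) ^ (-B)) ∂freqMeasure ≤
      C * ∫⁻ n, F n * (1 + ENNReal.ofReal (|z.2.1 / (n * (z.2.1 - n))| ^ (-(1 / 2) : ℝ) *
        jap (modul z + 3 * z.2.1 * (n * (z.2.1 - n))) ^ (1 / 2 - γ))) := by
  obtain ⟨C, hC⟩ := exists_tsum_lintegral_jap_modul_le hγ hγ1 hA hB h
  refine ⟨C, fun z F hz hF => ?_⟩
  rw [lintegral_freqMeasure (by fun_prop), ← lintegral_const_mul' _ _ ENNReal.coe_ne_top]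
  refine lintegral_mono_ae ?_
  filter_upwards [Measure.ae_ne volume (0:ℝ), Measure.ae_ne volume z.2.1] with n h1 h2
  have : ∀ q : ℤ, ∫⁻ τ, F n * ENNReal.ofReal (jap (modul (τ, n, q)) ^ (-A) *
      jap (modul (z - (τ, n, q))) ^ (-B)) = F n * ∫⁻ τ, ENNReal.ofReal
        (jap (modul (τ, n, q)) ^ (-A) * jap (modul (z - (τ, n, q))) ^ (-B)) := fun q =>
    lintegral_const_mul _ (by fun_prop)
  simp only [this, ENNReal.tsum_mul_left]
  rw [mul_left_comm]
  gcongr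
  exact hC z n hz h1 h2

/-! ### The majorant kernels -/

/-- Outputs with ξ = 0 form a null set, so the kernel may be cut off there. -/
theorem BilinearBounded.of_lintegral_le' {K : Freq → Freq → ℝ≥0∞}
    (hK : Measurable (Function.uncurry K)) {C : ℝ≥0}
    (H : ∀ z, z.2.1 ≠ 0 → ∫⁻ a, K z a ∂freqMeasure ≤ C) : BilinearBounded K := by
  classical
  have hm : MeasurableSet {x : Freq × Freq | x.1.2.1 ≠ 0} :=
    (measurableSet_eq_fun (by fun_prop) measurable_const).compl
  have h : BilinearBounded fun z a => if z.2.1 ≠ 0 then K z a else 0 := by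
    refine BilinearBounded.of_lintegral_le (C := C) (Measurable.ite hm hK measurable_const)
      fun z => ?_
    by_cases hz : z.2.1 ≠ 0
    · simpa only [if_pos hz] using H z hz
    · simp only [if_neg hz, lintegral_zero]; exact zero_le
  refine h.mono 1 fun z a hza => ?_
  rw [if_pos hza.1, ENNReal.coe_one, one_mul]

/-- The product of the modulation weights of the two inputs. -/
def modulPair (A B : ℝ) (z a : Freq) : ℝ≥0∞ :=
  ENNReal.ofReal (jap (modul a) ^ (-A) * jap (modul (z - a)) ^ (-B))

theorem measurable_modulPair (A B : ℝ) : Measurable (Function.uncurry (modulPair A B)) := by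
  simp only [Function.uncurry_def, modulPair]; fun_prop

theorem modulPair_comm_of_transpose (A B : ℝ) (z a : Freq) :
    modulPair A B a z = ENNReal.ofReal (jap (modul z) ^ (-A) * jap (modul (z - a)) ^ (-B)) := by
  rw [modulPair, jap_modul_sub_comm]

/-- The weight of the dominant modulation at a frequency comparable to the largest one. -/
def comparableWeight (z : Freq) : ℝ :=
  z.2.1 ^ 2 * jap (modul z) ^ (-1 : ℝ) +
    z.2.1 ^ 2 * jap z.2.1 ^ (-2 : ℝ) * jap (modul z) ^ (-(1 / 3) : ℝ)

theorem comparableWeight_nonneg (z : Freq) : 0 ≤ comparableWeight z := by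
  have := jap_pos (modul z)
  have := jap_pos z.2.1
  unfold comparableWeight; positivity

@[fun_prop]
theorem measurable_comparableWeight : Measurable comparableWeight := by
  unfold comparableWeight; fun_prop

/-- The output has the dominant modulation and a frequency comparable to the largest one. -/
def ComparableRegion (z a : Freq) : Prop :=
  |a.2.1| ≤ 2 * |z.2.1| ∧ |z.2.1 - a.2.1| ≤ 2 * |z.2.1| ∧
    |z.2.1 * (a.2.1 * (z.2.1 - a.2.1))| ≤ |modul z|

theorem measurableSet_comparableRegion :
    MeasurableSet {x : Freq × Freq | ComparableRegion x.1 x.2} :=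
  (measurableSet_le (f := fun x : Freq × Freq => |x.2.2.1|) (by fun_prop) (by fun_prop)).inter
    ((measurableSet_le (f := fun x : Freq × Freq => |x.1.2.1 - x.2.2.1|)
      (by fun_prop) (by fun_prop)).inter
      (measurableSet_le (f := fun x : Freq × Freq =>
        |x.1.2.1 * (x.2.2.1 * (x.1.2.1 - x.2.2.1))|) (by fun_prop) (by fun_prop)))

-- The exponent 15/16 is 2β: it is the power of the modulation in the squared weight of X^{β,0,s}.
open Classical in
def comparableKernel (z a : Freq) : ℝ≥0∞ :=
  if ComparableRegion z a then
    ENNReal.ofReal (comparableWeight z) * modulPair (15 / 16) (15 / 16) z a else 0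

theorem measurable_comparableKernel : Measurable (Function.uncurry comparableKernel) := by
  have := measurable_modulPair (15 / 16) (15 / 16)
  refine Measurable.ite measurableSet_comparableRegion (Measurable.mul (by fun_prop) this)
    measurable_const

/-- Cauchy–Schwarz at fixed output. The choice γ = 2/3 is admissible because 2 · 15/16 − 2/3 > 1,
and it leaves the power 1/2 − 2/3 = −1/6 for which the frequency integral was prepared. -/
theorem bilinearBounded_comparableKernel : BilinearBounded comparableKernel := by
  obtain ⟨C₁, hC₁⟩ := exists_lintegral_frequency_mul_jap_modul_le (A := 15 / 16) (B := 15 / 16)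
    (γ := 2 / 3) (by norm_num) (by norm_num) (by norm_num) (by norm_num) (by norm_num)
  obtain ⟨C₂, hC₂⟩ := exists_setLIntegral_comparable_le
  refine BilinearBounded.of_lintegral_le' measurable_comparableKernel (C := C₁ * C₂)
    fun z hz => ?_
  set S := {n : ℝ | |n| ≤ 2 * |z.2.1| ∧ |z.2.1 - n| ≤ 2 * |z.2.1| ∧
    |z.2.1 * (n * (z.2.1 - n))| ≤ |modul z|} with hS
  have hSm : MeasurableSet S := by
    exact (measurableSet_le (f := fun n : ℝ => |n|) (by fun_prop) (by fun_prop)).inter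
      ((measurableSet_le (f := fun n : ℝ => |z.2.1 - n|) (by fun_prop) (by fun_prop)).inter
        (measurableSet_le (f := fun n : ℝ => |z.2.1 * (n * (z.2.1 - n))|)
          (by fun_prop) (by fun_prop)))
  set F : ℝ → ℝ≥0∞ := S.indicator fun _ => ENNReal.ofReal (comparableWeight z) with hF
  have hFm : Measurable F := measurable_const.indicator hSm
  calc ∫⁻ a, comparableKernel z a ∂freqMeasure
      = ∫⁻ a, F a.2.1 * modulPair (15 / 16) (15 / 16) z a ∂freqMeasure := by
        refine lintegral_congr fun a => ?_
        by_cases h : ComparableRegion z a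
        · rw [comparableKernel, if_pos h, hF, Set.indicator_of_mem (show a.2.1 ∈ S from h)]
        · rw [comparableKernel, if_neg h, hF, Set.indicator_of_notMem (show a.2.1 ∉ S from h),
            zero_mul]
    _ ≤ _ := hC₁ z F hz hFm
    _ = C₁ * (ENNReal.ofReal (comparableWeight z) * ∫⁻ n in S,
        (1 + ENNReal.ofReal (|z.2.1 / (n * (z.2.1 - n))| ^ (-(1 / 2) : ℝ) *
          jap (modul z + 3 * z.2.1 * (n * (z.2.1 - n))) ^ (1 / 2 - 2 / 3 : ℝ)))) := by
        congr 1
        rw [← lintegral_const_mul' _ _ ENNReal.ofReal_ne_top, ← lintegral_indicator hSm]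
        refine lintegral_congr fun n => ?_
        rw [hF]
        by_cases h : n ∈ S
        · rw [Set.indicator_of_mem h, Set.indicator_of_mem h]
        · rw [Set.indicator_of_notMem h, Set.indicator_of_notMem h, zero_mul]
    _ ≤ C₁ * C₂ := by gcongr; exact hC₂ z.2.1 (modul z) hz
    _ = _ := by push_cast; rfl

/-- The first input has a low frequency. -/
def LowRegion (z a : Freq) : Prop := |a.2.1| ≤ 1 ∧ |z.2.1 - a.2.1| ≤ 2 * |z.2.1|

theorem measurableSet_lowRegion : MeasurableSet {x : Freq × Freq | LowRegion x.1 x.2} :=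
  (measurableSet_le (f := fun x : Freq × Freq => |x.2.2.1|) (by fun_prop) (by fun_prop)).inter
    (measurableSet_le (f := fun x : Freq × Freq => |x.1.2.1 - x.2.2.1|)
      (by fun_prop) (by fun_prop))

-- The dominant modulation of the low-frequency input is available to the power 5/3 = 25/24 + 5/8.
-- The part 25/24 makes ξ² integrable in n, and the part 5/8 is kept for the integration in τ and
-- the sum over q.
open Classical in
def lowKernel (z a : Freq) : ℝ≥0∞ :=
  if LowRegion z a then
    ENNReal.ofReal (z.2.1 ^ 2 * jap (z.2.1 ^ 2 / 2 * a.2.1) ^ (-(25 / 24) : ℝ) + 1) *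
      modulPair (5 / 8) (15 / 16) z a else 0

theorem measurable_lowKernel : Measurable (Function.uncurry lowKernel) := by
  have := measurable_modulPair (5 / 8) (15 / 16)
  refine Measurable.ite measurableSet_lowRegion (Measurable.mul (by fun_prop) this)
    measurable_const

theorem bilinearBounded_lowKernel : BilinearBounded lowKernel := by
  obtain ⟨C₁, hC₁⟩ := exists_lintegral_frequency_mul_jap_modul_le (A := 5 / 8) (B := 15 / 16)
    (γ := 17 / 32) (by norm_num) (by norm_num) (by norm_num) (by norm_num) (by norm_num)
  obtain ⟨C₂, hC₂⟩ := exists_setLIntegral_low_le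
  refine BilinearBounded.of_lintegral_le' measurable_lowKernel (C := C₁ * (3 * C₂))
    fun z hz => ?_
  have hz0 := abs_pos.2 hz
  set w : ℝ → ℝ≥0∞ := fun n =>
    ENNReal.ofReal (z.2.1 ^ 2 * jap (z.2.1 ^ 2 / 2 * n) ^ (-(25 / 24) : ℝ) + 1) with hw
  have hwm : Measurable w := by fun_prop
  set S := {n : ℝ | |n| ≤ 1 ∧ |z.2.1 - n| ≤ 2 * |z.2.1|} with hS
  have hSm : MeasurableSet S :=
    (measurableSet_le (f := fun n : ℝ => |n|) (by fun_prop) (by fun_prop)).inter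
      (measurableSet_le (f := fun n : ℝ => |z.2.1 - n|) (by fun_prop) (by fun_prop))
  have hSm' : MeasurableSet {n : ℝ | |n| ≤ 1} := measurableSet_le (by fun_prop) (by fun_prop)
  calc ∫⁻ a, lowKernel z a ∂freqMeasure
      = ∫⁻ a, S.indicator w a.2.1 * modulPair (5 / 8) (15 / 16) z a ∂freqMeasure := by
        refine lintegral_congr fun a => ?_
        by_cases h : LowRegion z a
        · rw [lowKernel, if_pos h, Set.indicator_of_mem (show a.2.1 ∈ S from h)]
        · rw [lowKernel, if_neg h, Set.indicator_of_notMem (show a.2.1 ∉ S from h), zero_mul]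
    _ ≤ _ := hC₁ z (S.indicator w) hz (hwm.indicator hSm)
    _ ≤ C₁ * ∫⁻ n in {n : ℝ | |n| ≤ 1}, 3 * w n := by
        rw [← lintegral_indicator hSm']
        gcongr with n
        by_cases h : n ∈ S
        · have h' : n ∈ {n : ℝ | |n| ≤ 1} := h.1
          rw [Set.indicator_of_mem h, Set.indicator_of_mem h', mul_comm]
          gcongr
          -- At low frequency the cost of the sum over q is harmless: |n(ξ − n)/ξ| ≤ 2 and the
          -- bracket has a negative exponent.
          calc _ ≤ 1 + ENNReal.ofReal 2 := by
                gcongr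
                rw [abs_div_rpow_neg_half]
                have e1 : jap (modul z + 3 * z.2.1 * (n * (z.2.1 - n))) ^ (1 / 2 - 17 / 32 : ℝ) ≤ 1 :=
                  Real.rpow_le_one_of_one_le_of_nonpos (one_le_jap _) (by norm_num)
                have e2 : |n * (z.2.1 - n) / z.2.1| ≤ 2 := by
                  rw [abs_div, abs_mul, div_le_iff₀ hz0]
                  calc |n| * |z.2.1 - n| ≤ 1 * (2 * |z.2.1|) := by
                        gcongr
                        · exact h.1
                        · exact h.2
                    _ = _ := by ring
                have hj := jap_pos (modul z + 3 * z.2.1 * (n * (z.2.1 - n)))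
                calc _ ≤ (2:ℝ) ^ (1 / 2 : ℝ) * 1 := by gcongr
                  _ ≤ 2 ^ (1 : ℝ) * 1 := by gcongr <;> norm_num
                  _ = 2 := by norm_num
            _ = 3 := by rw [show ENNReal.ofReal 2 = 2 by simp]; norm_num
        · rw [Set.indicator_of_notMem h, zero_mul]; exact zero_le
    _ = C₁ * (3 * ∫⁻ n in {n : ℝ | |n| ≤ 1}, w n) := by rw [lintegral_const_mul _ hwm]
    _ ≤ C₁ * (3 * C₂) := by gcongr; exact hC₂ z.2.1
    _ = _ := by push_cast; rfl

/-- Two large input frequencies, of which the first is positive, produce a small one. -/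
def HighHighLowRegion (z a : Freq) : Prop :=
  0 < a.2.1 ∧ z.2.1 - a.2.1 < 0 ∧ |z.2.1| ≤ |a.2.1| ∧ |z.2.1| ≤ |z.2.1 - a.2.1|

theorem measurableSet_highHighLowRegion :
    MeasurableSet {x : Freq × Freq | HighHighLowRegion x.1 x.2} :=
  (measurableSet_lt (g := fun x : Freq × Freq => x.2.2.1) (by fun_prop) (by fun_prop)).inter
    ((measurableSet_lt (f := fun x : Freq × Freq => x.1.2.1 - x.2.2.1)
      (by fun_prop) (by fun_prop)).inter
      ((measurableSet_le (f := fun x : Freq × Freq => |x.1.2.1|) (by fun_prop)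
        (by fun_prop)).inter (measurableSet_le (f := fun x : Freq × Freq => |x.1.2.1|)
          (by fun_prop) (by fun_prop))))

-- With |n| of the size of |ξ − n|, the weight has the size of (|ξ|n²)^(-1/3), a power of the lower
-- bound for the dominant modulation.
open Classical in
def highHighLowKernel (z a : Freq) : ℝ≥0∞ :=
  if HighHighLowRegion z a then
    singPow (1 / 3) z.2.1 * singPow (2 / 3) a.2.1 * modulPair (15 / 16) (15 / 16) z a else 0

theorem measurable_highHighLowKernel : Measurable (Function.uncurry highHighLowKernel) := by
  have := measurable_modulPair (15 / 16) (15 / 16)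
  refine Measurable.ite measurableSet_highHighLowRegion (Measurable.mul (by fun_prop) this)
    measurable_const

theorem singPow_rpow_half (s x : ℝ) : singPow s x ^ (1 / 2 : ℝ) = singPow (s / 2) x := by
  unfold singPow
  rw [← ENNReal.rpow_mul]; congr 1; ring

/-- With the output fixed, the bound by Cauchy–Schwarz diverges at large n. The reflected estimate
is used instead: it freezes e = a + c − z, whose frequency exceeds the positive frequencies of a and
c, and leaves an integral over c with the modulations of c and c − e, that is, a two-input integral
with output e. -/
theorem bilinearBounded_highHighLowKernel : BilinearBounded highHighLowKernel := by
  classical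
  obtain ⟨C₁, hC₁⟩ := exists_lintegral_frequency_mul_jap_modul_le (A := 15 / 16) (B := 15 / 16)
    (γ := 2 / 3) (by norm_num) (by norm_num) (by norm_num) (by norm_num) (by norm_num)
  obtain ⟨C₂, hC₂⟩ := exists_setLIntegral_high_high_low_le
  set w : Freq → Freq → ℝ≥0∞ := fun z a =>
    if HighHighLowRegion z a then singPow (1 / 6) z.2.1 * singPow (1 / 3) a.2.1 else 0 with hw
  have hwm : Measurable (Function.uncurry w) :=
    Measurable.ite measurableSet_highHighLowRegion (by fun_prop) measurable_const
  set p : Freq → ℝ≥0∞ := fun x => ENNReal.ofReal (jap (modul x) ^ (-(15 / 32) : ℝ)) with hp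
  have hpm : Measurable p := by fun_prop
  have hpsq : ∀ x, p x ^ 2 = ENNReal.ofReal (jap (modul x) ^ (-(15 / 16) : ℝ)) := by
    intro x
    have := jap_pos (modul x)
    rw [hp, ← ENNReal.ofReal_pow (by positivity), ← Real.rpow_mul_natCast this.le]
    norm_num
  have hK : ∀ z a, highHighLowKernel z a ^ (1 / 2 : ℝ) = w z a * (p a * p (z - a)) := by
    intro z a
    by_cases h : HighHighLowRegion z a
    · have hpp : modulPair (15 / 16) (15 / 16) z a = (p a * p (z - a)) ^ 2 := by
        have := jap_pos (modul a)
        have := jap_pos (modul (z - a))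
        rw [mul_pow, hpsq, hpsq, modulPair, ENNReal.ofReal_mul (by positivity)]
      rw [highHighLowKernel, if_pos h, hw, hpp]
      simp only [if_pos h]
      rw [ENNReal.mul_rpow_of_nonneg _ _ (by norm_num), ENNReal.mul_rpow_of_nonneg _ _ (by norm_num),
        singPow_rpow_half, singPow_rpow_half, ← ENNReal.rpow_natCast_mul]
      norm_num
    · rw [highHighLowKernel, if_neg h, hw]
      simp only [if_neg h]
      rw [ENNReal.zero_rpow_of_pos (by norm_num), zero_mul]
  refine ⟨2 * (C₁ * C₂), fun f g hf hg => ?_⟩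
  simp only [hK]
  refine (lintegral_sq_bilinear_le_of_reflected hwm hpm hpm hf hg (C := C₁ * C₂) ?_).trans
    (le_of_eq (by push_cast; rfl))
  intro a e
  -- In the region for the pair (z, c) the frequency of z − c = a − e is negative, which forces α <
  -- ε; elsewhere the integrand vanishes.
  by_cases hae : 0 < a.2.1 ∧ a.2.1 < e.2.1
  swap
  · have : ∀ c, w (a + c - e) a * w (a + c - e) c * (p c ^ 2 * p (c - e) ^ 2) = 0 := by
      intro c
      by_cases h1 : HighHighLowRegion (a + c - e) a
      · have h2 : ¬ HighHighLowRegion (a + c - e) c := fun h2 => by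
          refine hae ⟨h1.1, ?_⟩
          have := h2.2.1
          simp only [Prod.snd_sub, Prod.fst_sub, Prod.snd_add, Prod.fst_add] at this
          linarith
        simp only [hw, if_neg h2, mul_zero, zero_mul]
      · simp only [hw, if_neg h1, zero_mul]
    simp only [this, lintegral_zero]; exact zero_le
  obtain ⟨ha0, hae⟩ := hae
  have he0 : e.2.1 ≠ 0 := by linarith
  set α := a.2.1
  set ε := e.2.1
  set S := {χ : ℝ | 0 < χ ∧ χ < ε ∧ α < ε ∧ |α + χ - ε| ≤ α ∧ |α + χ - ε| ≤ χ} with hS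
  have hSm : MeasurableSet S := by
    exact (measurableSet_lt (g := fun χ : ℝ => χ) (by fun_prop) (by fun_prop)).inter
      ((measurableSet_lt (f := fun χ : ℝ => χ) (by fun_prop) (by fun_prop)).inter
        ((MeasurableSet.const (α < ε)).inter
          ((measurableSet_le (f := fun χ : ℝ => |α + χ - ε|) (by fun_prop) (by fun_prop)).inter
            (measurableSet_le (f := fun χ : ℝ => |α + χ - ε|) (by fun_prop) (by fun_prop)))))
  set F : ℝ → ℝ≥0∞ := fun χ =>
    singPow (1 / 3) (α + χ - ε) * (singPow (1 / 3) α * singPow (1 / 3) χ) with hF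
  have hFm : Measurable F := by fun_prop
  calc _ ≤ ∫⁻ c, S.indicator F c.2.1 * ENNReal.ofReal (jap (modul c) ^ (-(15 / 16) : ℝ) *
          jap (modul (e - c)) ^ (-(15 / 16) : ℝ)) ∂freqMeasure := by
        refine lintegral_mono fun c => ?_
        by_cases h1 : HighHighLowRegion (a + c - e) a
        swap
        · simp only [hw, if_neg h1, zero_mul]; exact zero_le
        by_cases h2 : HighHighLowRegion (a + c - e) c
        swap
        · simp only [hw, if_neg h2, zero_mul, mul_zero]; exact zero_le
        have hn : (a + c - e).2.1 = α + c.2.1 - ε := rfl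
        have hcS : c.2.1 ∈ S := by
          obtain ⟨-, i2, i3, -⟩ := h1
          obtain ⟨j1, j2, j3, -⟩ := h2
          rw [hn] at i2 i3 j2 j3
          rw [abs_of_pos ha0] at i3
          rw [abs_of_pos j1] at j3
          exact ⟨j1, by linarith, hae, i3, j3⟩
        have := jap_pos (modul c)
        simp only [hw, if_pos h1, if_pos h2]
        rw [Set.indicator_of_mem hcS, hpsq, hpsq, jap_modul_sub_comm c e,
          ← ENNReal.ofReal_mul (by positivity), hn, hF]
        have e : singPow (1 / 3) (α + c.2.1 - ε) =
            singPow (1 / 6) (α + c.2.1 - ε) * singPow (1 / 6) (α + c.2.1 - ε) := by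
          rw [← singPow_add (by norm_num) (by norm_num)]; norm_num
        refine mul_le_mul_left (le_of_eq ?_) _
        dsimp only
        rw [e]
        ring
    _ ≤ _ := hC₁ e (S.indicator F) he0 (hFm.indicator hSm)
    _ = C₁ * ∫⁻ χ in S, F χ * (1 + ENNReal.ofReal (|ε / (χ * (ε - χ))| ^ (-(1 / 2) : ℝ) *
          jap (modul e + 3 * ε * (χ * (ε - χ))) ^ (1 / 2 - 2 / 3 : ℝ))) := by
        rw [← lintegral_indicator hSm]
        congr 1
        refine lintegral_congr fun χ => ?_
        by_cases h : χ ∈ S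
        · rw [Set.indicator_of_mem h, Set.indicator_of_mem h]
        · rw [Set.indicator_of_notMem h, Set.indicator_of_notMem h, zero_mul]
    _ ≤ C₁ * C₂ := by gcongr; exact hC₂ α ε (modul e) ha0

/-! ### Comparison of the kernels with the majorants -/

/-- The square of the weight penalising modulations beyond `⟨ξ⟩³`. -/
def excess (z : Freq) : ℝ := jap (jap (modul z) / jap z.2.1 ^ 3) ^ (2 / 3 : ℝ)

@[fun_prop]
theorem measurable_excess : Measurable excess := by unfold excess; fun_prop

theorem one_le_excess (z : Freq) : 1 ≤ excess z :=
  Real.one_le_rpow (one_le_jap _) (by norm_num)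

theorem div_jap_cube_rpow (z : Freq) : (jap (modul z) / jap z.2.1 ^ 3) ^ (2 / 3 : ℝ) =
    jap z.2.1 ^ (-2 : ℝ) * jap (modul z) ^ (2 / 3 : ℝ) := by
  have h1 := jap_pos (modul z)
  have h2 := jap_pos z.2.1
  rw [Real.div_rpow h1.le (by positivity), ← Real.rpow_natCast_mul h2.le, Real.rpow_neg h2.le]
  norm_num
  field_simp

theorem excess_le (z : Freq) :
    excess z ≤ 1 + jap z.2.1 ^ (-2 : ℝ) * jap (modul z) ^ (2 / 3 : ℝ) := by
  have h1 := jap_pos (modul z)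
  have h2 := jap_pos z.2.1
  have h0 : 0 ≤ jap (modul z) / jap z.2.1 ^ 3 := by positivity
  rw [← div_jap_cube_rpow]
  calc excess z ≤ (1 + jap (modul z) / jap z.2.1 ^ 3) ^ (2 / 3 : ℝ) := by
        unfold excess
        have := jap_le_one_add_abs (jap (modul z) / jap z.2.1 ^ 3)
        rw [abs_of_nonneg h0] at this
        exact Real.rpow_le_rpow (jap_nonneg _) this (by norm_num)
    _ ≤ 1 ^ (2 / 3 : ℝ) + (jap (modul z) / jap z.2.1 ^ 3) ^ (2 / 3 : ℝ) :=
        Real.rpow_add_le_add_rpow zero_le_one h0 (by norm_num) (by norm_num)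
    _ = _ := by rw [Real.one_rpow]

/-- This is the gain from the b₁-weight of an input whose modulation dominates. -/
theorem inv_excess_le (z : Freq) :
    (excess z)⁻¹ ≤ jap z.2.1 ^ (2 : ℝ) * jap (modul z) ^ (-(2 / 3) : ℝ) := by
  have h1 := jap_pos (modul z)
  have h2 := jap_pos z.2.1
  have h0 : 0 < jap (modul z) / jap z.2.1 ^ 3 := by positivity
  have h : (jap (modul z) / jap z.2.1 ^ 3) ^ (2 / 3 : ℝ) ≤ excess z :=
    Real.rpow_le_rpow h0.le ((le_abs_self _).trans (abs_le_jap _)) (by norm_num)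
  refine (inv_anti₀ (by positivity) h).trans (le_of_eq ?_)
  rw [div_jap_cube_rpow, mul_inv, ← Real.rpow_neg h2.le, ← Real.rpow_neg h1.le, neg_neg]

theorem jap_rpow_neg_le_of_le {x y p : ℝ} (hy : 0 < y) (h : y ≤ |x|) (hp : 0 ≤ p) :
    jap x ^ (-p) ≤ y ^ (-p) :=
  Real.rpow_le_rpow_of_nonpos hy (h.trans (abs_le_jap x)) (by linarith)

theorem singPow_mul_eq_ofReal {s t x y : ℝ} (hx : x ≠ 0) (hy : y ≠ 0) :
    singPow s x * singPow t y = ENNReal.ofReal (|x| ^ (-s) * |y| ^ (-t)) := by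
  rw [singPow, singPow, ENNReal.ofReal_rpow_of_pos (abs_pos.2 hx),
    ENNReal.ofReal_rpow_of_pos (abs_pos.2 hy), ENNReal.ofReal_mul (by positivity)]

/-- If neither input frequency is comparable to the output frequency `X`, then both of them are
larger and have opposite signs. -/
theorem high_high_low_geometry {X N : ℝ} (hc : ¬ (|N| ≤ 2 * |X| ∧ |X - N| ≤ 2 * |X|)) :
    |X| ≤ |N| ∧ |X| ≤ |X - N| ∧ |N| / 2 ≤ |X - N| ∧ |X - N| ≤ 2 * |N| ∧
      ((0 < N ∧ X - N < 0) ∨ (0 < -N ∧ -X - -N < 0)) := by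
  rw [not_and_or, not_le, not_le] at hc
  have hx1 := le_abs_self X
  have hx2 := neg_abs_le X
  have hn : |X| < |N| := by
    have := abs_sub X N
    rcases hc with hc | hc <;> linarith [abs_nonneg X]
  rcases abs_cases N with ⟨e2, h2⟩ | ⟨e2, h2⟩
  · have e3 : |X - N| = N - X := by rw [abs_of_neg (by linarith)]; ring
    rw [e2, e3] at hc
    rw [e2] at hn
    rw [e2, e3]
    rcases hc with hc | hc <;>
      exact ⟨by linarith, by linarith, by linarith, by linarith, Or.inl ⟨by linarith, by linarith⟩⟩
  · have e3 : |X - N| = X - N := abs_of_pos (by linarith)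
    rw [e2, e3] at hc
    rw [e2] at hn
    rw [e2, e3]
    rcases hc with hc | hc <;>
      exact ⟨by linarith, by linarith, by linarith, by linarith, Or.inr ⟨by linarith, by linarith⟩⟩

/-- The weight of the output when the output has the dominant modulation. -/
def outputWeight (z : Freq) : ℝ := z.2.1 ^ 2 * excess z * jap (modul z) ^ (-1 : ℝ)

@[fun_prop]
theorem measurable_outputWeight : Measurable outputWeight := by unfold outputWeight; fun_prop

theorem outputWeight_le_comparableWeight (z : Freq) : outputWeight z ≤ comparableWeight z := by
  have h1 := jap_pos (modul z)
  have h2 := jap_pos z.2.1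
  have e : jap (modul z) ^ (2 / 3 : ℝ) * jap (modul z) ^ (-1 : ℝ) =
      jap (modul z) ^ (-(1 / 3) : ℝ) := by
    rw [← Real.rpow_add h1]; norm_num
  calc _ ≤ z.2.1 ^ 2 * (1 + jap z.2.1 ^ (-2 : ℝ) * jap (modul z) ^ (2 / 3 : ℝ)) *
        jap (modul z) ^ (-1 : ℝ) := by
        unfold outputWeight
        gcongr
        exact excess_le z
    _ = _ := by rw [comparableWeight, ← e]; ring

theorem sq_mul_rpow_neg_two_le {x y : ℝ} (h : |x| ≤ 2 * |y|) :
    x ^ 2 * jap x ^ (-2 : ℝ) ≤ 4 * (y ^ 2 * jap y ^ (-2 : ℝ)) := by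
  have e : ∀ t : ℝ, t ^ 2 * jap t ^ (-2 : ℝ) = t ^ 2 / (1 + t ^ 2) := fun t => by
    rw [Real.rpow_neg (jap_nonneg t), ← jap_sq t]; norm_num; rfl
  have h2 : x ^ 2 ≤ 4 * y ^ 2 := by
    rw [← sq_abs x, ← sq_abs y]; nlinarith [abs_nonneg x, abs_nonneg y]
  rw [e, e, mul_div_assoc', div_le_div_iff₀ (by positivity) (by positivity)]
  nlinarith [sq_nonneg (x * y), sq_nonneg y]

theorem sq_mul_rpow_neg_two_le_one (x : ℝ) : x ^ 2 * jap x ^ (-2 : ℝ) ≤ 1 := by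
  rw [Real.rpow_neg (jap_nonneg x), ← div_eq_mul_inv, div_le_one (by have := jap_pos x; positivity)]
  norm_num
  rw [jap_sq]; linarith

/-- Since ⟨σ⟩ is at least XN²/2, the first summand is at most a multiple of XN^(-2), where X ≤ N
exchanges X^(4/3) for N^(4/3). The second is at most a multiple of (XN²)^(-1/3), with no room to
spare. -/
theorem comparableWeight_le_of_high_high_low {z : Freq} {N : ℝ} (hz : z.2.1 ≠ 0)
    (hN : |z.2.1| ≤ N) (h : |z.2.1| * N ^ 2 / 2 ≤ |modul z|) :
    comparableWeight z ≤ 4 * (|z.2.1| ^ (-(1 / 3) : ℝ) * N ^ (-(2 / 3) : ℝ)) := by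
  set X := |z.2.1| with hX
  have hX0 : 0 < X := abs_pos.2 hz
  have hN0 : 0 < N := hX0.trans_le hN
  have hy : 0 < X * N ^ 2 / 2 := by positivity
  have t1 : z.2.1 ^ 2 * jap (modul z) ^ (-1 : ℝ) ≤ 2 * (X ^ (-(1 / 3) : ℝ) * N ^ (-(2 / 3) : ℝ)) := by
    calc _ ≤ z.2.1 ^ 2 * (X * N ^ 2 / 2) ^ (-1 : ℝ) := by
          exact mul_le_mul_of_nonneg_left (jap_rpow_neg_le_of_le hy h zero_le_one) (sq_nonneg _)
      _ = 2 * (X * N ^ (-2 : ℝ)) := by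
          rw [← sq_abs, ← hX, Real.rpow_neg_one, Real.rpow_neg hN0.le]; norm_num; field_simp
      _ = 2 * (X ^ (-(1 / 3) : ℝ) * X ^ (4 / 3 : ℝ) * N ^ (-2 : ℝ)) := by
          rw [← Real.rpow_add hX0]; norm_num
      _ ≤ 2 * (X ^ (-(1 / 3) : ℝ) * N ^ (4 / 3 : ℝ) * N ^ (-2 : ℝ)) := by gcongr
      _ = _ := by rw [mul_assoc (X ^ _), ← Real.rpow_add hN0]; norm_num
  have t2 : z.2.1 ^ 2 * jap z.2.1 ^ (-2 : ℝ) * jap (modul z) ^ (-(1 / 3) : ℝ) ≤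
      2 * (X ^ (-(1 / 3) : ℝ) * N ^ (-(2 / 3) : ℝ)) := by
    have hj := jap_pos (modul z)
    calc _ ≤ 1 * (X * N ^ 2 / 2) ^ (-(1 / 3) : ℝ) :=
          mul_le_mul (sq_mul_rpow_neg_two_le_one _) (jap_rpow_neg_le_of_le hy h (by norm_num))
            (by positivity) zero_le_one
      _ = 2 ^ (1 / 3 : ℝ) * (X ^ (-(1 / 3) : ℝ) * N ^ (-(2 / 3) : ℝ)) := by
          rw [one_mul, Real.div_rpow (by positivity) (by norm_num),
            Real.mul_rpow hX0.le (by positivity), ← Real.rpow_natCast_mul hN0.le,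
            Real.rpow_neg zero_le_two, div_inv_eq_mul]
          norm_num; ring
      _ ≤ 2 ^ (1 : ℝ) * (X ^ (-(1 / 3) : ℝ) * N ^ (-(2 / 3) : ℝ)) := by gcongr <;> norm_num
      _ = _ := by norm_num
  unfold comparableWeight
  linarith

/-- The output has the dominant modulation. -/
def OutputRegion (z a : Freq) : Prop := |modul a| ≤ |modul z| ∧ |modul (z - a)| ≤ |modul z|

/-- The first input has the dominant modulation. -/
def InputRegion (z a : Freq) : Prop := |modul z| ≤ |modul a| ∧ |modul (z - a)| ≤ |modul a|

theorem abs_mul_le_of_outputRegion {z a : Freq} (h : Nondegenerate z a) (h' : OutputRegion z a) :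
    |z.2.1 * (a.2.1 * (z.2.1 - a.2.1))| ≤ |modul z| := by
  have h1 := abs_mul_le_abs_resonance h
  have h2 := abs_sub (modul a + modul (z - a)) (modul z)
  have h3 := abs_add_le (modul a) (modul (z - a))
  obtain ⟨h4, h5⟩ := h'
  linarith

theorem abs_mul_le_of_inputRegion {z a : Freq} (h : Nondegenerate z a) (h' : InputRegion z a) :
    |z.2.1 * (a.2.1 * (z.2.1 - a.2.1))| ≤ |modul a| := by
  have h1 := abs_mul_le_abs_resonance h
  have h2 := abs_sub (modul a + modul (z - a)) (modul z)
  have h3 := abs_add_le (modul a) (modul (z - a))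
  obtain ⟨h4, h5⟩ := h'
  linarith

theorem measurableSet_outputRegion :
    MeasurableSet {x : Freq × Freq | OutputRegion x.1 x.2} :=
  (measurableSet_le (f := fun x : Freq × Freq => |modul x.2|) (by fun_prop) (by fun_prop)).inter
    (measurableSet_le (f := fun x : Freq × Freq => |modul (x.1 - x.2)|)
      (by fun_prop) (by fun_prop))

theorem measurableSet_inputRegion :
    MeasurableSet {x : Freq × Freq | InputRegion x.1 x.2} :=
  (measurableSet_le (f := fun x : Freq × Freq => |modul x.1|) (by fun_prop) (by fun_prop)).inter
    (measurableSet_le (f := fun x : Freq × Freq => |modul (x.1 - x.2)|)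
      (by fun_prop) (by fun_prop))

open Classical in
def outputKernel (z a : Freq) : ℝ≥0∞ :=
  if OutputRegion z a then
    ENNReal.ofReal (outputWeight z) * modulPair (15 / 16) (15 / 16) z a else 0

-- The output modulation carries 15/16 instead of 1. This makes the kernel symmetric enough to be
-- transposed into `modulPair`, and the spared power is what the L¹ integration in τ of the Z
-- estimate consumes.
open Classical in
def inputKernel (z a : Freq) : ℝ≥0∞ :=
  if InputRegion z a then
    ENNReal.ofReal (z.2.1 ^ 2 * excess z * jap (modul z) ^ (-(15 / 16) : ℝ) *
      ((excess a)⁻¹ * jap (modul a) ^ (-1 : ℝ)) * jap (modul (z - a)) ^ (-(15 / 16) : ℝ)) else 0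

theorem measurable_outputKernel : Measurable (Function.uncurry outputKernel) := by
  have := measurable_modulPair (15 / 16) (15 / 16)
  exact Measurable.ite measurableSet_outputRegion (Measurable.mul (by fun_prop) this)
    measurable_const

theorem measurable_inputKernel : Measurable (Function.uncurry inputKernel) :=
  Measurable.ite measurableSet_inputRegion (by fun_prop) measurable_const

theorem modulPair_neg (A B : ℝ) (z a : Freq) : modulPair A B (-z) (-a) = modulPair A B z a := by
  rw [modulPair, modulPair, modul_neg, jap_neg, show -z - -a = -(z - a) by abel, modul_neg, jap_neg]

theorem singPow_neg_freq (s x : ℝ) : singPow s (-x) = singPow s x := by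
  rw [singPow, singPow, abs_neg]

theorem ofReal_mul_le_highHighLowKernel_add {z a : Freq} {w c : ℝ} (hc : 0 ≤ c)
    (hz : z.2.1 ≠ 0) (ha : a.2.1 ≠ 0) (h : HighHighLowRegion z a ∨ HighHighLowRegion (-z) (-a))
    (hw : w ≤ c * (|z.2.1| ^ (-(1 / 3) : ℝ) * |a.2.1| ^ (-(2 / 3) : ℝ))) :
    ENNReal.ofReal w * modulPair (15 / 16) (15 / 16) z a ≤
      ENNReal.ofReal c * (highHighLowKernel z a + highHighLowKernel (-z) (-a)) := by
  have key : ENNReal.ofReal w * modulPair (15 / 16) (15 / 16) z a ≤ ENNReal.ofReal c *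
      (singPow (1 / 3) z.2.1 * singPow (2 / 3) a.2.1 * modulPair (15 / 16) (15 / 16) z a) := by
    rw [singPow_mul_eq_ofReal hz ha, ← mul_assoc, ← ENNReal.ofReal_mul hc]
    gcongr
  refine key.trans ?_
  gcongr
  rcases h with h | h
  · rw [highHighLowKernel, if_pos h]; exact le_self_add
  · refine le_add_left ?_
    rw [highHighLowKernel, if_pos h, modulPair_neg]
    simp only [Prod.snd_neg, Prod.fst_neg, singPow_neg_freq]; rfl

/-- Either the output frequency is comparable to the largest one, or the two inputs are larger and
of opposite signs. In the second case the sign of the first input selects the kernel or its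
reflection. -/
theorem outputKernel_le {z a : Freq} (h : Nondegenerate z a) :
    outputKernel z a ≤ ENNReal.ofReal 4 *
      (comparableKernel z a + (highHighLowKernel z a + highHighLowKernel (-z) (-a))) := by
  by_cases hR : OutputRegion z a
  swap
  · rw [outputKernel, if_neg hR]; exact zero_le
  rw [outputKernel, if_pos hR, mul_add]
  have hres := abs_mul_le_of_outputRegion h hR
  obtain ⟨h1, h2, h3⟩ := h
  by_cases hc : |a.2.1| ≤ 2 * |z.2.1| ∧ |z.2.1 - a.2.1| ≤ 2 * |z.2.1|
  · refine le_add_right ?_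
    rw [comparableKernel, if_pos ⟨hc.1, hc.2, hres⟩]
    calc _ ≤ 1 * (ENNReal.ofReal (comparableWeight z) * modulPair (15 / 16) (15 / 16) z a) := by
          rw [one_mul]
          gcongr
          exact outputWeight_le_comparableWeight z
      _ ≤ _ := by gcongr; simp
  · refine le_add_left ?_
    have hz0 := abs_pos.2 h1
    set X := z.2.1
    set N := a.2.1
    obtain ⟨g1, g2, g3, -, g4⟩ := high_high_low_geometry hc
    refine ofReal_mul_le_highHighLowKernel_add (by norm_num) h1 h2 ?_
      ((outputWeight_le_comparableWeight z).trans
        (comparableWeight_le_of_high_high_low h1 g1 (le_trans ?_ hres)))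
    · rcases g4 with g4 | g4
      · exact Or.inl ⟨g4.1, g4.2, g1, g2⟩
      · refine Or.inr ⟨g4.1, g4.2, ?_, ?_⟩
        · simpa only [Prod.snd_neg, Prod.fst_neg, abs_neg] using g1
        · simp only [Prod.snd_neg, Prod.fst_neg, abs_neg, neg_sub_neg]
          rw [abs_sub_comm]; exact g2
    · rw [abs_mul, abs_mul]
      calc |X| * |N| ^ 2 / 2 = |X| * (|N| * (|N| / 2)) := by ring
        _ ≤ _ := by gcongr

theorem bilinearBounded_highHighLow_symm :
    BilinearBounded fun z a => highHighLowKernel z a + highHighLowKernel (-z) (-a) :=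
  BilinearBounded.add measurable_highHighLowKernel bilinearBounded_highHighLowKernel
    bilinearBounded_highHighLowKernel.comp_neg

theorem measurable_highHighLow_symm : Measurable (Function.uncurry
    fun z a => highHighLowKernel z a + highHighLowKernel (-z) (-a)) := by
  refine Measurable.add measurable_highHighLowKernel ?_
  exact measurable_highHighLowKernel.comp
    (show Measurable fun x : Freq × Freq => (-x.1, -x.2) by fun_prop)

theorem bilinearBounded_outputKernel : BilinearBounded outputKernel :=
  (BilinearBounded.add measurable_comparableKernel bilinearBounded_comparableKernel
    bilinearBounded_highHighLow_symm).mono 4 fun _ _ h => (outputKernel_le h).trans (by simp)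

/-- The excess of the output is measured with the larger modulation σ(a), so that everything is paid
for by the dominant input. -/
theorem inputKernel_le_aux {z a : Freq} (hR : |modul z| ≤ |modul a|) :
    z.2.1 ^ 2 * excess z * ((excess a)⁻¹ * jap (modul a) ^ (-1 : ℝ)) ≤
      z.2.1 ^ 2 * ((excess a)⁻¹ * jap (modul a) ^ (-1 : ℝ)) +
      z.2.1 ^ 2 * jap z.2.1 ^ (-2 : ℝ) * ((excess a)⁻¹ * jap (modul a) ^ (-(1 / 3) : ℝ)) := by
  have h0 := jap_pos (modul a)
  have h1 := jap_pos (modul z)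
  have h2 := jap_pos z.2.1
  have h3 := zero_lt_one.trans_le (one_le_excess a)
  have e : jap (modul a) ^ (-(1 / 3) : ℝ) =
      jap (modul a) ^ (2 / 3 : ℝ) * jap (modul a) ^ (-1 : ℝ) := by
    rw [← Real.rpow_add h0]; norm_num
  calc _ ≤ z.2.1 ^ 2 * (1 + jap z.2.1 ^ (-2 : ℝ) * jap (modul a) ^ (2 / 3 : ℝ)) *
        ((excess a)⁻¹ * jap (modul a) ^ (-1 : ℝ)) := by
        gcongr
        refine (excess_le z).trans ?_
        gcongr
        exact jap_mono hR
    _ = _ := by rw [e]; ring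

/-- The first input a now plays the part of the output, hence the exchanged arguments of the first
and last kernels. When a has the smallest frequency, the factor ξ² belongs to a large frequency, and
the inverse excess of a is needed to compensate it. -/
theorem inputKernel_le {z a : Freq} (h : Nondegenerate z a) :
    inputKernel z a ≤ ENNReal.ofReal 10 *
      (comparableKernel a z + (lowKernel z a +
        (highHighLowKernel a z + highHighLowKernel (-a) (-z)))) := by
  by_cases hR : InputRegion z a
  swap
  · rw [inputKernel, if_neg hR]; exact zero_le
  have hres := abs_mul_le_of_inputRegion h hR
  have hres' : |a.2.1 * (z.2.1 * (a.2.1 - z.2.1))| ≤ |modul a| := by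
    rw [← abs_neg]; convert hres using 2; ring
  obtain ⟨h1, h2, h3⟩ := h
  have haux := inputKernel_le_aux hR.1
  set w := z.2.1 ^ 2 * excess z * ((excess a)⁻¹ * jap (modul a) ^ (-1 : ℝ)) with hw
  have j0 := jap_pos (modul a)
  have j1 := jap_pos (modul z)
  have j2 := jap_pos z.2.1
  have j3 := jap_pos (modul (z - a))
  have j4 := jap_pos a.2.1
  have hE := one_le_excess a
  have hE0 := zero_lt_one.trans_le hE
  have hE1 : (excess a)⁻¹ ≤ 1 := inv_le_one_of_one_le₀ hE
  have hw0 : 0 ≤ w := by have := one_le_excess z; positivity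
  have hK : inputKernel z a = ENNReal.ofReal w * modulPair (15 / 16) (15 / 16) a z := by
    rw [inputKernel, if_pos hR, modulPair_comm_of_transpose, ← ENNReal.ofReal_mul hw0]
    congr 1; ring
  -- Here |ξ| is at most twice the frequency of a, and the inverse excess is simply bounded by 1.
  by_cases hc : |z.2.1| ≤ 2 * |a.2.1| ∧ |a.2.1 - z.2.1| ≤ 2 * |a.2.1|
  · rw [mul_add]
    refine le_add_right ?_
    have : w ≤ 4 * comparableWeight a := by
      refine haux.trans ?_
      rw [comparableWeight, mul_add]
      have hsq : z.2.1 ^ 2 ≤ 4 * a.2.1 ^ 2 := by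
        rw [← sq_abs z.2.1, ← sq_abs a.2.1]; nlinarith [abs_nonneg z.2.1, abs_nonneg a.2.1, hc.1]
      refine add_le_add ?_ ?_
      · calc _ ≤ (4 * a.2.1 ^ 2) * (1 * jap (modul a) ^ (-1 : ℝ)) := by gcongr
          _ = _ := by ring
      · calc _ ≤ (4 * (a.2.1 ^ 2 * jap a.2.1 ^ (-2 : ℝ))) *
              (1 * jap (modul a) ^ (-(1 / 3) : ℝ)) :=
              mul_le_mul (sq_mul_rpow_neg_two_le hc.1)
                (mul_le_mul_of_nonneg_right hE1 (by positivity)) (by positivity) (by positivity)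
          _ = _ := by ring
    rw [hK, comparableKernel, if_pos ⟨hc.1, hc.2, hres'⟩, ← mul_assoc,
      ← ENNReal.ofReal_mul (by norm_num)]
    gcongr
    exact this.trans (by gcongr; exacts [comparableWeight_nonneg a, by norm_num])
  have ha0 := abs_pos.2 h2
  have hz0 := abs_pos.2 h1
  obtain ⟨g1, g2, g3, g5, g4⟩ := high_high_low_geometry hc
  have hσ : |a.2.1| * |z.2.1| ^ 2 / 2 ≤ |modul a| := by
    refine le_trans ?_ hres'
    rw [abs_mul, abs_mul]
    calc _ = |a.2.1| * (|z.2.1| * (|z.2.1| / 2)) := by ring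
      _ ≤ _ := by gcongr
  have hterm1 : z.2.1 ^ 2 * ((excess a)⁻¹ * jap (modul a) ^ (-1 : ℝ)) ≤
      z.2.1 ^ 2 * (jap a.2.1 ^ (2 : ℝ) * jap (modul a) ^ (-(5 / 3) : ℝ)) := by
    have e : jap (modul a) ^ (-(5 / 3) : ℝ) =
        jap (modul a) ^ (-(2 / 3) : ℝ) * jap (modul a) ^ (-1 : ℝ) := by
      rw [← Real.rpow_add j0]; norm_num
    rw [e, ← mul_assoc (jap a.2.1 ^ _)]
    gcongr
    exact inv_excess_le a
  have hj2 : jap a.2.1 ^ (2 : ℝ) = 1 + a.2.1 ^ 2 := by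
    rw [Real.rpow_two, jap_sq]
  by_cases hl : |a.2.1| ≤ 1
  · have hL : LowRegion z a := ⟨hl, by rw [abs_sub_comm]; exact g5⟩
    have ha2 : jap a.2.1 ^ (2 : ℝ) ≤ 2 := by
      rw [hj2, ← sq_abs]; nlinarith [abs_nonneg a.2.1]
    -- The exponent 5/3 is 1 + 2b₁. One part must exceed 1 for the integral in n, the other 1/2 for
    -- the sum over q; this splitting is what requires b₁ > 1/4.
    have e1 : jap (modul a) ^ (-(5 / 3) : ℝ) =
        jap (modul a) ^ (-(25 / 24) : ℝ) * jap (modul a) ^ (-(5 / 8) : ℝ) := by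
      rw [← Real.rpow_add j0]; norm_num
    have e2 : jap (modul a) ^ (-1 : ℝ) =
        jap (modul a) ^ (-(3 / 8) : ℝ) * jap (modul a) ^ (-(5 / 8) : ℝ) := by
      rw [← Real.rpow_add j0]; norm_num
    have j5 := jap_pos (z.2.1 ^ 2 / 2 * a.2.1)
    have hwl : w ≤ 10 * ((z.2.1 ^ 2 * jap (z.2.1 ^ 2 / 2 * a.2.1) ^ (-(25 / 24) : ℝ) + 1) *
        jap (modul a) ^ (-(5 / 8) : ℝ)) := by
      refine haux.trans ?_
      have t1 : z.2.1 ^ 2 * ((excess a)⁻¹ * jap (modul a) ^ (-1 : ℝ)) ≤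
          z.2.1 ^ 2 * (2 * (jap (z.2.1 ^ 2 / 2 * a.2.1) ^ (-(25 / 24) : ℝ) *
            jap (modul a) ^ (-(5 / 8) : ℝ))) := by
        refine hterm1.trans ?_
        rw [e1]
        have t0 : jap (modul a) ^ (-(25 / 24) : ℝ) ≤
            jap (z.2.1 ^ 2 / 2 * a.2.1) ^ (-(25 / 24) : ℝ) := by
          refine jap_rpow_neg_anti (by norm_num) (le_trans (le_of_eq ?_) hσ)
          rw [abs_mul, abs_div, abs_of_nonneg (sq_nonneg z.2.1), sq_abs, abs_two]; ring
        exact mul_le_mul_of_nonneg_left (mul_le_mul ha2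
          (mul_le_mul_of_nonneg_right t0 (by positivity)) (by positivity) zero_le_two)
          (sq_nonneg _)
      have t2 : z.2.1 ^ 2 * jap z.2.1 ^ (-2 : ℝ) *
          ((excess a)⁻¹ * jap (modul a) ^ (-(1 / 3) : ℝ)) ≤
          2 * jap (modul a) ^ (-(5 / 8) : ℝ) := by
        calc _ ≤ 1 * ((jap a.2.1 ^ (2 : ℝ) * jap (modul a) ^ (-(2 / 3) : ℝ)) *
              jap (modul a) ^ (-(1 / 3) : ℝ)) :=
              mul_le_mul (sq_mul_rpow_neg_two_le_one _)
                (mul_le_mul_of_nonneg_right (inv_excess_le a) (by positivity)) (by positivity)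
                zero_le_one
          _ = jap a.2.1 ^ (2 : ℝ) * jap (modul a) ^ (-1 : ℝ) := by
              rw [one_mul, mul_assoc, ← Real.rpow_add j0]; norm_num
          _ ≤ 2 * jap (modul a) ^ (-(5 / 8) : ℝ) :=
              mul_le_mul ha2 (jap_rpow_neg_mono_exp (by norm_num) _) (by positivity) zero_le_two
      have p1 : 0 ≤ z.2.1 ^ 2 * (jap (z.2.1 ^ 2 / 2 * a.2.1) ^ (-(25 / 24) : ℝ) *
        jap (modul a) ^ (-(5 / 8) : ℝ)) := by positivity
      have p2 : 0 ≤ jap (modul a) ^ (-(5 / 8) : ℝ) := by positivity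
      linarith
    rw [mul_add, mul_add]
    refine le_add_left (le_add_right ?_)
    rw [lowKernel, if_pos hL, modulPair, ← ENNReal.ofReal_mul (by positivity),
      ← ENNReal.ofReal_mul (by norm_num), inputKernel, if_pos hR]
    refine ENNReal.ofReal_le_ofReal ?_
    calc _ = w * jap (modul z) ^ (-(15 / 16) : ℝ) * jap (modul (z - a)) ^ (-(15 / 16) : ℝ) := by
          rw [hw]; ring
      _ ≤ w * 1 * jap (modul (z - a)) ^ (-(15 / 16) : ℝ) := by
          have := rpow_neg_jap_le_one (modul z) (p := 15 / 16) (by norm_num)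
          exact mul_le_mul_of_nonneg_right (mul_le_mul_of_nonneg_left this hw0) (by positivity)
      _ ≤ (10 * ((z.2.1 ^ 2 * jap (z.2.1 ^ 2 / 2 * a.2.1) ^ (-(25 / 24) : ℝ) + 1) *
          jap (modul a) ^ (-(5 / 8) : ℝ))) * 1 * jap (modul (z - a)) ^ (-(15 / 16) : ℝ) := by
          gcongr
      _ = _ := by ring
  · rw [mul_add, mul_add]
    refine le_add_left (le_add_left ?_)
    rw [hK]
    refine ofReal_mul_le_highHighLowKernel_add (by norm_num) h2 h1 ?_ ?_
    · rcases g4 with g4 | g4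
      · exact Or.inl ⟨g4.1, g4.2, g1, g2⟩
      · refine Or.inr ⟨g4.1, g4.2, ?_, ?_⟩
        · simpa only [Prod.snd_neg, Prod.fst_neg, abs_neg] using g1
        · simp only [Prod.snd_neg, Prod.fst_neg, abs_neg, neg_sub_neg]
          rw [abs_sub_comm]; exact g2
    refine haux.trans ?_
    rw [not_le] at hl
    set X := |a.2.1| with hX
    set N := |z.2.1| with hN
    have hy : 0 < X * N ^ 2 / 2 := by positivity
    have hj2' : jap a.2.1 ^ (2 : ℝ) ≤ 2 * X ^ 2 := by
      rw [hj2, ← sq_abs a.2.1]; nlinarith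
    -- Up to constants N² · X² · (XN²)^(-5/3) = X^(1/3) N^(-4/3), and X ≤ N exchanges X^(2/3) for
    -- N^(2/3).
    have t1 : z.2.1 ^ 2 * ((excess a)⁻¹ * jap (modul a) ^ (-1 : ℝ)) ≤
        8 * (X ^ (-(1 / 3) : ℝ) * N ^ (-(2 / 3) : ℝ)) := by
      refine hterm1.trans ?_
      calc _ ≤ z.2.1 ^ 2 * ((2 * X ^ 2) * (X * N ^ 2 / 2) ^ (-(5 / 3) : ℝ)) := by
            exact mul_le_mul_of_nonneg_left (mul_le_mul hj2' (jap_rpow_neg_le_of_le hy hσ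
              (by norm_num)) (by positivity) (by positivity)) (sq_nonneg _)
        _ = 2 * 2 ^ (5 / 3 : ℝ) * ((X ^ (2 : ℝ) * X ^ (-(5 / 3) : ℝ)) *
              (N ^ (2 : ℝ) * N ^ (-(10 / 3) : ℝ))) := by
            rw [← sq_abs z.2.1, ← hN, Real.div_rpow (by positivity) (by norm_num),
              Real.mul_rpow ha0.le (by positivity), ← Real.rpow_natCast_mul hz0.le,
              Real.rpow_neg zero_le_two, div_inv_eq_mul, Real.rpow_two, Real.rpow_two]
            norm_num; ring
        _ = 2 * 2 ^ (5 / 3 : ℝ) * ((X ^ (-(1 / 3) : ℝ) * X ^ (2 / 3 : ℝ)) * N ^ (-(4 / 3) : ℝ)) := by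
            rw [← Real.rpow_add ha0, ← Real.rpow_add hz0, ← Real.rpow_add ha0]; norm_num
        _ ≤ 2 * 2 ^ (2 : ℝ) * ((X ^ (-(1 / 3) : ℝ) * N ^ (2 / 3 : ℝ)) * N ^ (-(4 / 3) : ℝ)) := by
            gcongr <;> norm_num
        _ = _ := by rw [mul_assoc (X ^ _), ← Real.rpow_add hz0]; norm_num
    have t2 : z.2.1 ^ 2 * jap z.2.1 ^ (-2 : ℝ) *
        ((excess a)⁻¹ * jap (modul a) ^ (-(1 / 3) : ℝ)) ≤
        2 * (X ^ (-(1 / 3) : ℝ) * N ^ (-(2 / 3) : ℝ)) := by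
      calc _ ≤ 1 * (1 * (X * N ^ 2 / 2) ^ (-(1 / 3) : ℝ)) :=
            mul_le_mul (sq_mul_rpow_neg_two_le_one _)
              (mul_le_mul hE1 (jap_rpow_neg_le_of_le hy hσ (by norm_num)) (by positivity)
                zero_le_one) (by positivity) zero_le_one
        _ = 2 ^ (1 / 3 : ℝ) * (X ^ (-(1 / 3) : ℝ) * N ^ (-(2 / 3) : ℝ)) := by
            rw [one_mul, one_mul, Real.div_rpow (by positivity) (by norm_num),
              Real.mul_rpow ha0.le (by positivity), ← Real.rpow_natCast_mul hz0.le,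
              Real.rpow_neg zero_le_two, div_inv_eq_mul]
            norm_num; ring
        _ ≤ 2 ^ (1 : ℝ) * (X ^ (-(1 / 3) : ℝ) * N ^ (-(2 / 3) : ℝ)) := by gcongr <;> norm_num
        _ = _ := by norm_num
    linarith

theorem bilinearBounded_inputKernel : BilinearBounded inputKernel := by
  have hH := bilinearBounded_highHighLow_symm.transpose measurable_highHighLow_symm
  have hC := bilinearBounded_comparableKernel.transpose measurable_comparableKernel
  exact (BilinearBounded.add (K := fun z a => comparableKernel a z)
    (measurable_comparableKernel.comp measurable_swap) hC
    (BilinearBounded.add measurable_lowKernel bilinearBounded_lowKernel hH)).mono 10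
      fun _ _ h => (inputKernel_le h).trans (by simp)

/-! ### The `L²L¹` estimate when the output has the dominant modulation -/

-- Unlike the other kernels this one is used without a square root, hence the exponents 15/32.
open Classical in
def outputKernelL1 (z a : Freq) : ℝ≥0∞ :=
  if OutputRegion z a then
    ENNReal.ofReal (|z.2.1| * jap (modul z) ^ (-1 : ℝ) *
      (jap (modul a) ^ (-(15 / 32) : ℝ) * jap (modul (z - a)) ^ (-(15 / 32) : ℝ))) else 0

theorem measurable_outputKernelL1 : Measurable (Function.uncurry outputKernelL1) :=
  Measurable.ite measurableSet_outputRegion (by fun_prop) measurable_const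

/-- The resonance function. -/
def resonance (z a : Freq) : ℝ := 3 * z.2.1 * (a.2.1 * (z.2.1 - a.2.1)) +
  z.2.1 / (a.2.1 * (z.2.1 - a.2.1)) * ((a.2.2 : ℝ) - z.2.2 * a.2.1 / z.2.1) ^ 2

/-- A dominant output modulation controls the resonance function, so ⟨σ⟩^(-2) may be spent in three
parts: 13/12 on ξn(ξ − n) for the integral in n, 7/12 on the resonance for the sum over k, and 1/3
on σ itself for the integral in τ. -/
theorem outputKernelL1_sq_le {z a : Freq} (h : Nondegenerate z a) :
    outputKernelL1 z a ^ 2 ≤ ENNReal.ofReal 9 *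
      ENNReal.ofReal ((z.2.1 ^ 2 * jap (z.2.1 * (a.2.1 * (z.2.1 - a.2.1))) ^ (-(13 / 12) : ℝ) *
          jap (resonance z a) ^ (-(7 / 12) : ℝ)) *
        (jap (modul z) ^ (-(1 / 3) : ℝ) * (jap (modul a) ^ (-(15 / 16) : ℝ) *
          jap (modul (z - a)) ^ (-(15 / 16) : ℝ)))) := by
  by_cases hR : OutputRegion z a
  swap
  · rw [outputKernelL1, if_neg hR]; simp
  have hφ : resonance z a = modul a + modul (z - a) - modul z := by
    rw [modul_add_modul_sub h, resonance]; ring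
  have h1 := abs_mul_le_abs_resonance h
  rw [← hφ] at h1
  have h3 : |resonance z a| ≤ |3 * modul z| := by
    have h2 := abs_sub (modul a + modul (z - a)) (modul z)
    have h3 := abs_add_le (modul a) (modul (z - a))
    obtain ⟨h4, h5⟩ := hR
    rw [hφ, abs_mul, abs_of_pos (by norm_num : (0:ℝ) < 3)]
    linarith
  have j0 := jap_pos (modul z)
  have j1 := jap_pos (modul a)
  have j2 := jap_pos (modul (z - a))
  have j3 := jap_pos (resonance z a)
  have j4 := jap_pos (z.2.1 * (a.2.1 * (z.2.1 - a.2.1)))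
  have h4 : jap (modul z) ^ (-(5 / 3) : ℝ) ≤ 9 * jap (resonance z a) ^ (-(5 / 3) : ℝ) := by
    have h5 : jap (resonance z a) / 3 ≤ jap (modul z) := by
      rw [div_le_iff₀' (by norm_num)]
      exact (jap_mono h3).trans (jap_mul_le (by norm_num) _)
    calc _ ≤ (jap (resonance z a) / 3) ^ (-(5 / 3) : ℝ) :=
          Real.rpow_le_rpow_of_nonpos (by positivity) h5 (by norm_num)
      _ = 3 ^ (5 / 3 : ℝ) * jap (resonance z a) ^ (-(5 / 3) : ℝ) := by
          rw [Real.div_rpow j3.le (by norm_num), Real.rpow_neg (by norm_num : (0:ℝ) ≤ 3),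
            div_inv_eq_mul, mul_comm]
      _ ≤ 3 ^ (2 : ℝ) * jap (resonance z a) ^ (-(5 / 3) : ℝ) := by gcongr <;> norm_num
      _ = _ := by norm_num
  have h5 : jap (resonance z a) ^ (-(5 / 3) : ℝ) ≤
      jap (z.2.1 * (a.2.1 * (z.2.1 - a.2.1))) ^ (-(13 / 12) : ℝ) *
        jap (resonance z a) ^ (-(7 / 12) : ℝ) := by
    rw [show (-(5 / 3) : ℝ) = -(13 / 12) + -(7 / 12) by norm_num, Real.rpow_add j3]
    refine mul_le_mul_of_nonneg_right ?_ (by positivity)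
    exact jap_rpow_neg_anti (by norm_num) (by linarith [abs_nonneg (z.2.1 * (a.2.1 * (z.2.1 - a.2.1)))])
  rw [outputKernelL1, if_pos hR, ← ENNReal.ofReal_pow (by positivity),
    ← ENNReal.ofReal_mul (by norm_num)]
  refine ENNReal.ofReal_le_ofReal ?_
  have e : (|z.2.1| * jap (modul z) ^ (-1 : ℝ) *
      (jap (modul a) ^ (-(15 / 32) : ℝ) * jap (modul (z - a)) ^ (-(15 / 32) : ℝ))) ^ 2 =
      z.2.1 ^ 2 * (jap (modul z) ^ (-(5 / 3) : ℝ) * jap (modul z) ^ (-(1 / 3) : ℝ)) *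
        (jap (modul a) ^ (-(15 / 16) : ℝ) * jap (modul (z - a)) ^ (-(15 / 16) : ℝ)) := by
    rw [← Real.rpow_add j0, mul_pow, mul_pow, mul_pow, sq_abs, ← Real.rpow_mul_natCast j0.le,
      ← Real.rpow_mul_natCast j1.le, ← Real.rpow_mul_natCast j2.le]
    norm_num
  rw [e]
  calc _ ≤ z.2.1 ^ 2 * ((9 * (jap (z.2.1 * (a.2.1 * (z.2.1 - a.2.1))) ^ (-(13 / 12) : ℝ) *
        jap (resonance z a) ^ (-(7 / 12) : ℝ))) * jap (modul z) ^ (-(1 / 3) : ℝ)) *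
        (jap (modul a) ^ (-(15 / 16) : ℝ) * jap (modul (z - a)) ^ (-(15 / 16) : ℝ)) := by
        refine mul_le_mul_of_nonneg_right (mul_le_mul_of_nonneg_left
          (mul_le_mul_of_nonneg_right ?_ (by positivity)) (sq_nonneg _)) (by positivity)
        linarith
    _ = _ := by ring

/-- The integral in t leaves the power 3/4 of σ shifted by the resonance, which is constant in τ;
then 1/3 + 3/4 > 1 makes the integral in τ bounded. -/
theorem exists_lintegral_lintegral_jap_modul_le : ∃ C : ℝ≥0, ∀ (ξ n : ℝ) (q k : ℤ),
    ξ ≠ 0 → n ≠ 0 → n ≠ ξ →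
    ∫⁻ t, ∫⁻ τ, ENNReal.ofReal (jap (modul (τ, ξ, q)) ^ (-(1 / 3) : ℝ) *
      (jap (modul (t, n, k)) ^ (-(15 / 16) : ℝ) *
        jap (modul ((τ, ξ, q) - (t, n, k))) ^ (-(15 / 16) : ℝ))) ≤ C := by
  obtain ⟨C₁, hC₁⟩ := exists_lintegral_jap_mul_jap_le (c := 3 / 4) (A := 15 / 16) (B := 15 / 16)
    (by norm_num) (by norm_num) (by norm_num) (by norm_num)
  obtain ⟨C₂, hC₂⟩ := exists_lintegral_jap_mul_jap_le (c := 0) (A := 1 / 3) (B := 3 / 4)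
    (by norm_num) (by norm_num) (by norm_num) (by norm_num)
  refine ⟨C₁ * C₂, fun ξ n q k h1 h2 h3 => ?_⟩
  have hm : Measurable fun x : ℝ × ℝ => ENNReal.ofReal (jap (modul (x.2, ξ, q)) ^ (-(1 / 3) : ℝ) *
      (jap (modul (x.1, n, k)) ^ (-(15 / 16) : ℝ) *
        jap (modul ((x.2, ξ, q) - (x.1, n, k))) ^ (-(15 / 16) : ℝ))) := by
    have : Measurable fun x : ℝ × ℝ => ((x.2, ξ, q) : Freq) - (x.1, n, k) :=
      Measurable.sub (by fun_prop) (by fun_prop)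
    fun_prop
  rw [lintegral_lintegral_swap hm.aemeasurable]
  set D := resonance (0, ξ, q) (0, n, k) with hD
  have hin : ∀ τ, ∫⁻ t, ENNReal.ofReal (jap (modul (t, n, k)) ^ (-(15 / 16) : ℝ) *
      jap (modul ((τ, ξ, q) - (t, n, k))) ^ (-(15 / 16) : ℝ)) ≤
      C₁ * ENNReal.ofReal (jap (modul (τ, ξ, q) + D) ^ (-(3 / 4) : ℝ)) := by
    intro τ
    have e1 : ∀ t : ℝ, modul (t, n, k) = t - -modul (0, n, k) := fun t => by
      simp only [modul, modulation]; ring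
    have e2 : ∀ t : ℝ, jap (modul ((τ, ξ, q) - (t, n, k))) =
        jap (t - modul ((τ, ξ, q) - (0, n, k))) := fun t => by
      rw [← jap_neg]; congr 1
      simp only [modul, modulation, Prod.fst_sub, Prod.snd_sub]; ring
    have e3 : modul (0, n, k) + modul ((τ, ξ, q) - (0, n, k)) = modul (τ, ξ, q) + D := by
      rw [modul_add_modul_sub (z := (τ, ξ, q)) (a := (0, n, k)) ⟨h1, h2, h3⟩, hD, resonance]
      ring
    have := hC₁ (-modul (0, n, k)) (modul ((τ, ξ, q) - (0, n, k)))
    rw [← jap_neg, show -(-modul (0, n, k) - modul ((τ, ξ, q) - (0, n, k))) =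
      modul (0, n, k) + modul ((τ, ξ, q) - (0, n, k)) by ring, e3] at this
    refine le_trans (le_of_eq (lintegral_congr fun t => ?_)) this
    rw [e2 t, ← e1 t]
  calc _ ≤ ∫⁻ τ, C₁ * ENNReal.ofReal (jap (modul (τ, ξ, q)) ^ (-(1 / 3) : ℝ) *
        jap (modul (τ, ξ, q) + D) ^ (-(3 / 4) : ℝ)) := by
        refine lintegral_mono fun τ => ?_
        have := jap_pos (modul (τ, ξ, q))
        simp only [ENNReal.ofReal_mul (Real.rpow_nonneg this.le (-(1 / 3)))]
        rw [lintegral_const_mul' _ _ ENNReal.ofReal_ne_top, mul_left_comm]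
        gcongr
        exact hin τ
    _ = C₁ * ∫⁻ τ, ENNReal.ofReal (jap (τ - -modul (0, ξ, q)) ^ (-(1 / 3) : ℝ) *
        jap (τ - (-modul (0, ξ, q) - D)) ^ (-(3 / 4) : ℝ)) := by
        rw [lintegral_const_mul' _ _ ENNReal.coe_ne_top]
        congr 1
        refine lintegral_congr fun τ => ?_
        have e1 : modul (τ, ξ, q) = τ - -modul (0, ξ, q) := by
          simp only [modul, modulation]; ring
        rw [show τ - (-modul (0, ξ, q) - D) = τ - -modul (0, ξ, q) + D by ring, ← e1]
    _ ≤ C₁ * (C₂ * 1) := by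
        gcongr
        refine (hC₂ _ _).trans ?_
        simp
    _ = _ := by push_cast; ring

/-- The two time frequencies are integrated first; the resonance factors do not depend on them and
remain for the sum over k and the integral over n. -/
theorem exists_lintegral_lintegral_outputKernelL1_sq_le : ∃ C : ℝ≥0, ∀ (ξ : ℝ) (q : ℤ), ξ ≠ 0 →
    ∫⁻ τ, ∫⁻ a, outputKernelL1 (τ, ξ, q) a ^ 2 ∂freqMeasure ≤ C := by
  obtain ⟨C₁, hC₁⟩ := exists_lintegral_lintegral_jap_modul_le
  obtain ⟨C₂, hC₂⟩ := exists_tsum_jap_quadratic_le (γ := 7 / 12) (by norm_num) (by norm_num)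
  obtain ⟨C₃, hC₃⟩ := exists_lintegral_resonance_le
  refine ⟨9 * C₁ * C₂ * C₃, fun ξ q hξ => ?_⟩
  have hJ : Measurable (Function.uncurry fun (τ : ℝ) (a : Freq) =>
      outputKernelL1 (τ, ξ, q) a ^ 2) :=
    (measurable_outputKernelL1.comp (show Measurable fun x : ℝ × Freq =>
      (((x.1, ξ, q) : Freq), x.2) by fun_prop)).pow_const 2
  rw [lintegral_lintegral_swap hJ.aemeasurable, lintegral_freqMeasure (show Measurable fun a : Freq =>
    ∫⁻ τ, outputKernelL1 (τ, ξ, q) a ^ 2 from hJ.lintegral_prod_left')]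
  calc _ ≤ ∫⁻ n, C₁ * C₂ * 9 * (ENNReal.ofReal (ξ ^ 2 * jap (ξ * (n * (ξ - n))) ^ (-(13 / 12) : ℝ)) *
        (1 + ENNReal.ofReal (|ξ / (n * (ξ - n))| ^ (-(1 / 2) : ℝ) *
          jap (3 * ξ * (n * (ξ - n))) ^ (1 / 2 - 7 / 12 : ℝ)))) := by
        refine lintegral_mono_ae ?_
        filter_upwards [Measure.ae_ne volume (0:ℝ), Measure.ae_ne volume ξ] with n h1 h2
        have hstep : ∀ k : ℤ, ∫⁻ t, ∫⁻ τ, outputKernelL1 (τ, ξ, q) (t, n, k) ^ 2 ≤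
            C₁ * 9 * ENNReal.ofReal (ξ ^ 2 * jap (ξ * (n * (ξ - n))) ^ (-(13 / 12) : ℝ)) *
              ENNReal.ofReal (jap (3 * ξ * (n * (ξ - n)) + ξ / (n * (ξ - n)) *
                ((k : ℝ) - q * n / ξ) ^ 2) ^ (-(7 / 12) : ℝ)) := by
          intro k
          have j4 := jap_pos (ξ * (n * (ξ - n)))
          set P := ξ ^ 2 * jap (ξ * (n * (ξ - n))) ^ (-(13 / 12) : ℝ) with hP
          have hP0 : 0 ≤ P := by positivity
          set Q := jap (3 * ξ * (n * (ξ - n)) + ξ / (n * (ξ - n)) *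
                ((k : ℝ) - q * n / ξ) ^ 2) ^ (-(7 / 12) : ℝ) with hQ
          have hQ0 : 0 ≤ Q := Real.rpow_nonneg (jap_nonneg _) _
          calc _ ≤ ∫⁻ t, ∫⁻ τ, ENNReal.ofReal 9 * ENNReal.ofReal (P * Q) *
                ENNReal.ofReal (jap (modul (τ, ξ, q)) ^ (-(1 / 3) : ℝ) *
                  (jap (modul (t, n, k)) ^ (-(15 / 16) : ℝ) *
                    jap (modul ((τ, ξ, q) - (t, n, k))) ^ (-(15 / 16) : ℝ))) := by
                refine lintegral_mono fun t => lintegral_mono fun τ => ?_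
                refine (outputKernelL1_sq_le (z := (τ, ξ, q)) (a := (t, n, k))
                  ⟨hξ, h1, h2⟩).trans (le_of_eq ?_)
                rw [mul_assoc (ENNReal.ofReal 9), ← ENNReal.ofReal_mul (mul_nonneg hP0 hQ0)]
                rfl
            _ = ENNReal.ofReal 9 * ENNReal.ofReal (P * Q) * ∫⁻ t, ∫⁻ τ,
                ENNReal.ofReal (jap (modul (τ, ξ, q)) ^ (-(1 / 3) : ℝ) *
                  (jap (modul (t, n, k)) ^ (-(15 / 16) : ℝ) *
                    jap (modul ((τ, ξ, q) - (t, n, k))) ^ (-(15 / 16) : ℝ))) := by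
                have hne : ENNReal.ofReal 9 * ENNReal.ofReal (P * Q) ≠ ∞ :=
                  ENNReal.mul_ne_top ENNReal.ofReal_ne_top ENNReal.ofReal_ne_top
                simp only [lintegral_const_mul' _ _ hne]
            _ ≤ ENNReal.ofReal 9 * ENNReal.ofReal (P * Q) * C₁ := by
                gcongr; exact hC₁ ξ n q k hξ h1 h2
            _ = _ := by
                rw [ENNReal.ofReal_mul hP0, show ENNReal.ofReal 9 = 9 by simp]; ring
        calc _ ≤ ∑' k : ℤ, C₁ * 9 * ENNReal.ofReal (ξ ^ 2 * jap (ξ * (n * (ξ - n))) ^ (-(13 / 12) : ℝ)) *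
              ENNReal.ofReal (jap (3 * ξ * (n * (ξ - n)) + ξ / (n * (ξ - n)) *
                ((k : ℝ) - q * n / ξ) ^ 2) ^ (-(7 / 12) : ℝ)) := ENNReal.tsum_le_tsum hstep
          _ ≤ C₁ * 9 * ENNReal.ofReal (ξ ^ 2 * jap (ξ * (n * (ξ - n))) ^ (-(13 / 12) : ℝ)) *
              (C₂ * (1 + ENNReal.ofReal (|ξ / (n * (ξ - n))| ^ (-(1 / 2) : ℝ) *
                jap (3 * ξ * (n * (ξ - n))) ^ (1 / 2 - 7 / 12 : ℝ)))) := by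
              rw [ENNReal.tsum_mul_left]
              gcongr
              exact hC₂ _ _ _ (div_ne_zero hξ (mul_ne_zero h1 (sub_ne_zero.2 h2.symm)))
          _ = _ := by ring
    _ = C₁ * C₂ * 9 * ∫⁻ n, ENNReal.ofReal (ξ ^ 2 * jap (ξ * (n * (ξ - n))) ^ (-(13 / 12) : ℝ)) *
        (1 + ENNReal.ofReal (|ξ / (n * (ξ - n))| ^ (-(1 / 2) : ℝ) *
          jap (3 * ξ * (n * (ξ - n))) ^ (1 / 2 - 7 / 12 : ℝ))) := by
        rw [lintegral_const_mul']
        exact ENNReal.mul_ne_top (ENNReal.mul_ne_top ENNReal.coe_ne_top ENNReal.coe_ne_top)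
          (by norm_num)
    _ ≤ C₁ * C₂ * 9 * C₃ := by gcongr; exact hC₃ ξ hξ
    _ = _ := by push_cast; ring

/-- At fixed (ξ, q), Cauchy–Schwarz in (τ, a) jointly; the square of the product then integrates
over all outputs to the product of the two energies. -/
theorem exists_lintegral_outputKernelL1_le : ∃ C : ℝ≥0, ∀ f g : Freq → ℝ≥0∞,
    Measurable f → Measurable g →
    ∑' q : ℤ, ∫⁻ ξ, (∫⁻ τ, ∫⁻ a, outputKernelL1 (τ, ξ, q) a * (f a * g ((τ, ξ, q) - a))
      ∂freqMeasure) ^ 2 ≤ C * ((∫⁻ a, f a ^ 2 ∂freqMeasure) * ∫⁻ a, g a ^ 2 ∂freqMeasure) := by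
  obtain ⟨C, hC⟩ := exists_lintegral_lintegral_outputKernelL1_sq_le
  refine ⟨C, fun f g hf hg => ?_⟩
  have hfg : Measurable (Function.uncurry fun z a : Freq => f a ^ 2 * g (z - a) ^ 2) := by
    fun_prop
  rw [← lintegral_lintegral_mul_sub (hf.pow_const 2) (hg.pow_const 2),
    lintegral_freqMeasure' hfg.lintegral_prod_right, ← ENNReal.tsum_mul_left]
  refine ENNReal.tsum_le_tsum fun q => ?_
  rw [← lintegral_const_mul' _ _ ENNReal.coe_ne_top]
  refine lintegral_mono_ae ?_
  filter_upwards [Measure.ae_ne volume (0:ℝ)] with ξ hξ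
  have hp : Measurable fun x : ℝ × Freq => (((x.1, ξ, q) : Freq), x.2) := by fun_prop
  have m1 : Measurable fun x : ℝ × Freq => outputKernelL1 (x.1, ξ, q) x.2 :=
    measurable_outputKernelL1.comp hp
  have m2 : Measurable fun x : ℝ × Freq => f x.2 * g ((x.1, ξ, q) - x.2) := by
    have : Measurable (Function.uncurry fun z a : Freq => f a * g (z - a)) := by fun_prop
    exact this.comp hp
  have hcs := sq_lintegral_mul_le (μ := (volume : Measure ℝ).prod freqMeasure)
    m1.aemeasurable m2.aemeasurable
  have m12 : Measurable fun x : ℝ × Freq =>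
    outputKernelL1 (x.1, ξ, q) x.2 * (f x.2 * g ((x.1, ξ, q) - x.2)) := m1.mul m2
  rw [lintegral_prod _ m12.aemeasurable, lintegral_prod _ (m1.pow_const 2).aemeasurable,
    lintegral_prod _ (m2.pow_const 2).aemeasurable] at hcs
  refine hcs.trans ?_
  simp only [mul_pow]
  gcongr
  exact hC ξ q hξ

/-! ### The bilinear estimates on the Fourier side -/

theorem japZeta_pos (ξ : ℝ) (q : ℤ) : 0 < japZeta ξ q := Real.sqrt_pos.2 (by positivity)

theorem japZeta_sq (ξ : ℝ) (q : ℤ) : japZeta ξ q ^ 2 = 1 + (ξ ^ 2 + (q : ℝ) ^ 2) :=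
  Real.sq_sqrt (by positivity)

/-- From ⟨ζ⟩² ≤ 2⟨ζ₁⟩²⟨ζ − ζ₁⟩², raised to the power s ≥ 0: the regularity weight passes to the
inputs and plays no further part in the kernels. -/
theorem japZeta_rpow_le {s : ℝ} (hs : 0 ≤ s) (z a : Freq) :
    japZeta z.2.1 z.2.2 ^ (2 * s) ≤ 2 ^ s *
      (japZeta a.2.1 a.2.2 ^ (2 * s) * japZeta (z - a).2.1 (z - a).2.2 ^ (2 * s)) := by
  have h0 := japZeta_pos z.2.1 z.2.2
  have h1 := japZeta_pos a.2.1 a.2.2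
  have h2 := japZeta_pos (z - a).2.1 (z - a).2.2
  have h : japZeta z.2.1 z.2.2 ^ 2 ≤
      2 * (japZeta a.2.1 a.2.2 ^ 2 * japZeta (z - a).2.1 (z - a).2.2 ^ 2) := by
    rw [japZeta_sq, japZeta_sq, japZeta_sq]
    simp only [Prod.snd_sub, Prod.fst_sub]
    push_cast
    nlinarith [sq_nonneg (z.2.1 - 2 * a.2.1), sq_nonneg ((z.2.2 : ℝ) - 2 * a.2.2),
      mul_nonneg (add_nonneg (sq_nonneg a.2.1) (sq_nonneg (a.2.2 : ℝ)))
        (add_nonneg (sq_nonneg (z.2.1 - a.2.1)) (sq_nonneg ((z.2.2 : ℝ) - a.2.2)))]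
  rw [Real.rpow_mul h0.le, Real.rpow_mul h1.le, Real.rpow_mul h2.le, Real.rpow_two, Real.rpow_two,
    Real.rpow_two, ← Real.mul_rpow (by positivity) (by positivity),
    ← Real.mul_rpow zero_le_two (by positivity)]
  exact Real.rpow_le_rpow (by positivity) h hs

@[fun_prop]
theorem measurable_japZeta_comp {α : Type*} [MeasurableSpace α] {f : α → ℝ} {g : α → ℤ}
    (hf : Measurable f) (hg : Measurable g) : Measurable fun x => japZeta (f x) (g x) := by
  have : Measurable fun x => ((g x : ℤ) : ℝ) := measurable_intCast_real.comp hg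
  unfold japZeta
  fun_prop

/-- The weight of `X^{1/2,1/3,s}`. -/
def weightHigh (s : ℝ) (z : Freq) : ℝ := weightX (1 / 2) (1 / 3) s z.1 z.2.1 z.2.2

/-- The weight of `X^{15/32,0,s}`. -/
def weightLow (s : ℝ) (z : Freq) : ℝ := weightX (15 / 32) 0 s z.1 z.2.1 z.2.2

theorem weightHigh_eq (s : ℝ) (z : Freq) :
    weightHigh s z = excess z * japZeta z.2.1 z.2.2 ^ (2 * s) * jap (modul z) := by
  rw [weightHigh, weightX, excess, modul]; norm_num

theorem weightLow_eq (s : ℝ) (z : Freq) :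
    weightLow s z = japZeta z.2.1 z.2.2 ^ (2 * s) * jap (modul z) ^ (15 / 16 : ℝ) := by
  rw [weightLow, weightX, modul]; norm_num

theorem weightOut_eq (s : ℝ) (z : Freq) : weightX (-1 / 2) (1 / 3) s z.1 z.2.1 z.2.2 =
    excess z * japZeta z.2.1 z.2.2 ^ (2 * s) * jap (modul z) ^ (-1 : ℝ) := by
  rw [weightX, excess, modul]; norm_num

@[fun_prop]
theorem measurable_weightHigh (s : ℝ) : Measurable (weightHigh s) := by
  simp only [funext (weightHigh_eq s)]; fun_prop

@[fun_prop]
theorem measurable_weightLow (s : ℝ) : Measurable (weightLow s) := by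
  simp only [funext (weightLow_eq s)]; fun_prop

/-- The function `f` weighted so that its `L²` norm is the one of weight `w`. -/
def weighted (w : Freq → ℝ) (f : Freq → ℝ≥0∞) (a : Freq) : ℝ≥0∞ :=
  ENNReal.ofReal (w a) ^ (1 / 2 : ℝ) * f a

theorem measurable_weighted {w : Freq → ℝ} (hw : Measurable w) {f : Freq → ℝ≥0∞}
    (hf : Measurable f) : Measurable (weighted w f) := by
  unfold weighted; fun_prop

theorem rpow_half_sq (x : ℝ≥0∞) : (x ^ (1 / 2 : ℝ)) ^ 2 = x := by
  rw [← ENNReal.rpow_mul_natCast]; norm_num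

theorem weighted_sq (w : Freq → ℝ) (f : Freq → ℝ≥0∞) (a : Freq) :
    weighted w f a ^ 2 = ENNReal.ofReal (w a) * f a ^ 2 := by
  rw [weighted, mul_pow, rpow_half_sq]

theorem ENNReal.le_of_sq_le_sq {x y : ℝ≥0∞} (h : x ^ 2 ≤ y ^ 2) : x ≤ y :=
  (ENNReal.pow_le_pow_left_iff two_ne_zero).1 h

/-! ### Pointwise bounds of the weighted integrand by the kernels. -/

section Pointwise

variable {s : ℝ} {z a : Freq}

/-- Squaring removes all the half powers, so that a real inequality between the squared weights is
enough. -/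
theorem mul_weighted_le {w₁ w₂ : Freq → ℝ} {A B : ℝ} {K : ℝ≥0∞} (hB : 0 ≤ B) (hw₁ : 0 ≤ w₁ a)
    (hK : ENNReal.ofReal B ≤ K ^ 2)
    (h : A ≤ 2 ^ s * (B * (w₁ a * w₂ (z - a)))) (f g : Freq → ℝ≥0∞) :
    ENNReal.ofReal A ^ (1 / 2 : ℝ) * (f a * g (z - a)) ≤
      ENNReal.ofReal (2 ^ s) ^ (1 / 2 : ℝ) * (K * (weighted w₁ f a * weighted w₂ g (z - a))) := by
  refine ENNReal.le_of_sq_le_sq ?_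
  simp only [mul_pow, rpow_half_sq, weighted_sq]
  calc _ ≤ ENNReal.ofReal (2 ^ s) * (ENNReal.ofReal B * (ENNReal.ofReal (w₁ a) *
        ENNReal.ofReal (w₂ (z - a)))) * (f a ^ 2 * g (z - a) ^ 2) := by
        rw [← ENNReal.ofReal_mul hw₁, ← ENNReal.ofReal_mul hB, ← ENNReal.ofReal_mul (by positivity)]
        gcongr
    _ ≤ ENNReal.ofReal (2 ^ s) * (K ^ 2 * (ENNReal.ofReal (w₁ a) *
        ENNReal.ofReal (w₂ (z - a)))) * (f a ^ 2 * g (z - a) ^ 2) := by gcongr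
    _ = _ := by ring

theorem weightHigh_nonneg (s : ℝ) (a : Freq) : 0 ≤ weightHigh s a := by
  have := jap_pos (modul a)
  have := japZeta_pos a.2.1 a.2.2
  have := one_le_excess a
  rw [weightHigh_eq]; positivity

theorem weightLow_nonneg (s : ℝ) (a : Freq) : 0 ≤ weightLow s a := by
  have := jap_pos (modul a)
  have := japZeta_pos a.2.1 a.2.2
  rw [weightLow_eq]; positivity

theorem jap_rpow_neg_mul_rpow (x p : ℝ) : jap x ^ (-p) * jap x ^ p = 1 := by
  rw [← Real.rpow_add (jap_pos x), neg_add_cancel, Real.rpow_zero]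

theorem output_le (hs : 0 ≤ s) {c : ℝ} (hc : 0 ≤ c) :
    c * japZeta z.2.1 z.2.2 ^ (2 * s) ≤ 2 ^ s * (c * (jap (modul a) ^ (-(15 / 16) : ℝ) *
      jap (modul (z - a)) ^ (-(15 / 16) : ℝ)) * (weightLow s a * weightLow s (z - a))) := by
  have e1 := jap_rpow_neg_mul_rpow (modul a) (15 / 16)
  have e2 := jap_rpow_neg_mul_rpow (modul (z - a)) (15 / 16)
  calc _ ≤ c * (2 ^ s * (japZeta a.2.1 a.2.2 ^ (2 * s) *
        japZeta (z - a).2.1 (z - a).2.2 ^ (2 * s))) :=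
        mul_le_mul_of_nonneg_left (japZeta_rpow_le hs z a) hc
    _ = 2 ^ s * (c * (japZeta a.2.1 a.2.2 ^ (2 * s) * japZeta (z - a).2.1 (z - a).2.2 ^ (2 * s)) *
        ((jap (modul a) ^ (-(15 / 16) : ℝ) * jap (modul a) ^ (15 / 16 : ℝ)) *
          (jap (modul (z - a)) ^ (-(15 / 16) : ℝ) * jap (modul (z - a)) ^ (15 / 16 : ℝ)))) := by
        rw [e1, e2]; ring
    _ = _ := by rw [weightLow_eq, weightLow_eq]; ring

theorem input_le (hs : 0 ≤ s) {c : ℝ} (hc : 0 ≤ c) :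
    c * japZeta z.2.1 z.2.2 ^ (2 * s) ≤ 2 ^ s * (c * ((excess a)⁻¹ * jap (modul a) ^ (-1 : ℝ)) *
      jap (modul (z - a)) ^ (-(15 / 16) : ℝ) * (weightHigh s a * weightLow s (z - a))) := by
  have e1 := jap_rpow_neg_mul_rpow (modul a) 1
  rw [Real.rpow_one] at e1
  have e2 := jap_rpow_neg_mul_rpow (modul (z - a)) (15 / 16)
  have e3 : (excess a)⁻¹ * excess a = 1 :=
    inv_mul_cancel₀ (zero_lt_one.trans_le (one_le_excess a)).ne'
  calc _ ≤ c * (2 ^ s * (japZeta a.2.1 a.2.2 ^ (2 * s) *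
        japZeta (z - a).2.1 (z - a).2.2 ^ (2 * s))) :=
        mul_le_mul_of_nonneg_left (japZeta_rpow_le hs z a) hc
    _ = 2 ^ s * (c * (japZeta a.2.1 a.2.2 ^ (2 * s) * japZeta (z - a).2.1 (z - a).2.2 ^ (2 * s)) *
        ((jap (modul a) ^ (-1 : ℝ) * jap (modul a)) * ((excess a)⁻¹ * excess a) *
          (jap (modul (z - a)) ^ (-(15 / 16) : ℝ) * jap (modul (z - a)) ^ (15 / 16 : ℝ)))) := by
        rw [e1, e2, e3]; ring
    _ = _ := by rw [weightHigh_eq, weightLow_eq]; ring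

/-- The square of the weight of the output of the `X` estimate. -/
def outX (s : ℝ) (z : Freq) : ℝ := weightX (-1 / 2) (1 / 3) s z.1 z.2.1 z.2.2 * z.2.1 ^ 2

/-- The square of the weight of the output of the `Z` estimate. -/
def outZ (s : ℝ) (z : Freq) : ℝ :=
  jap (modul z) ^ (-2 : ℝ) * japZeta z.2.1 z.2.2 ^ (2 * s) * z.2.1 ^ 2

theorem outX_output_le (hs : 0 ≤ s) (h : OutputRegion z a) (f g : Freq → ℝ≥0∞) :
    ENNReal.ofReal (outX s z) ^ (1 / 2 : ℝ) * (f a * g (z - a)) ≤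
      ENNReal.ofReal (2 ^ s) ^ (1 / 2 : ℝ) * (outputKernel z a ^ (1 / 2 : ℝ) *
        (weighted (weightLow s) f a * weighted (weightLow s) g (z - a))) := by
  have h1 := jap_pos (modul z)
  have h2 := jap_pos (modul a)
  have h3 := jap_pos (modul (z - a))
  have h4 := one_le_excess z
  have hc : 0 ≤ outputWeight z := by unfold outputWeight; positivity
  refine mul_weighted_le (by positivity) (weightLow_nonneg s a) ?_
    (le_trans (le_of_eq ?_) (output_le hs hc)) f g
  · rw [rpow_half_sq, outputKernel, if_pos h, modulPair, ← ENNReal.ofReal_mul hc]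
  · rw [outX, weightOut_eq, outputWeight]; ring

theorem outX_input_le (hs : 0 ≤ s) (h : InputRegion z a) (f g : Freq → ℝ≥0∞) :
    ENNReal.ofReal (outX s z) ^ (1 / 2 : ℝ) * (f a * g (z - a)) ≤
      ENNReal.ofReal (2 ^ s) ^ (1 / 2 : ℝ) * (inputKernel z a ^ (1 / 2 : ℝ) *
        (weighted (weightHigh s) f a * weighted (weightLow s) g (z - a))) := by
  have h1 := jap_pos (modul z)
  have h2 := jap_pos (modul a)
  have h3 := jap_pos (modul (z - a))
  have h4 := one_le_excess z
  have h5 := one_le_excess a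
  have h6 := japZeta_pos z.2.1 z.2.2
  have hc : 0 ≤ z.2.1 ^ 2 * excess z * jap (modul z) ^ (-(15 / 16) : ℝ) := by positivity
  refine mul_weighted_le (B := z.2.1 ^ 2 * excess z * jap (modul z) ^ (-(15 / 16) : ℝ) *
      ((excess a)⁻¹ * jap (modul a) ^ (-1 : ℝ)) * jap (modul (z - a)) ^ (-(15 / 16) : ℝ))
    (by positivity) (weightHigh_nonneg s a) ?_ (le_trans ?_ (input_le hs hc)) f g
  · rw [rpow_half_sq, inputKernel, if_pos h]
  · have := jap_rpow_neg_mono_exp (show (15 / 16 : ℝ) ≤ 1 by norm_num) (modul z)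
    rw [outX, weightOut_eq]
    calc _ = z.2.1 ^ 2 * excess z * jap (modul z) ^ (-1 : ℝ) * japZeta z.2.1 z.2.2 ^ (2 * s) := by
          ring
      _ ≤ _ := mul_le_mul_of_nonneg_right (mul_le_mul_of_nonneg_left this (by positivity))
          (by positivity)

theorem outZ_output_le (hs : 0 ≤ s) (h : OutputRegion z a) (f g : Freq → ℝ≥0∞) :
    ENNReal.ofReal (outZ s z) ^ (1 / 2 : ℝ) * (f a * g (z - a)) ≤
      ENNReal.ofReal (2 ^ s) ^ (1 / 2 : ℝ) * (outputKernelL1 z a *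
        (weighted (weightLow s) f a * weighted (weightLow s) g (z - a))) := by
  have h1 := jap_pos (modul z)
  have h2 := jap_pos (modul a)
  have h3 := jap_pos (modul (z - a))
  have hc : 0 ≤ z.2.1 ^ 2 * jap (modul z) ^ (-2 : ℝ) := by positivity
  refine mul_weighted_le (by positivity) (weightLow_nonneg s a) ?_
    (le_trans (le_of_eq ?_) (output_le hs hc)) f g
  · rw [outputKernelL1, if_pos h, ← ENNReal.ofReal_pow (by positivity)]
    refine ENNReal.ofReal_le_ofReal (le_of_eq ?_)
    rw [mul_pow, mul_pow, mul_pow, sq_abs, ← Real.rpow_mul_natCast h1.le,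
      ← Real.rpow_mul_natCast h2.le, ← Real.rpow_mul_natCast h3.le]
    norm_num
  · rw [outZ]; ring

/-- In squared weights ⟨σ⟩^(-2) = ⟨σ⟩^(-17/16) ⟨σ⟩^(-15/16): the second factor belongs to
`inputKernel`, and the first stays outside for Cauchy–Schwarz in τ. -/
theorem outZ_input_le (hs : 0 ≤ s) (h : InputRegion z a) (f g : Freq → ℝ≥0∞) :
    ENNReal.ofReal (outZ s z) ^ (1 / 2 : ℝ) * (f a * g (z - a)) ≤
      ENNReal.ofReal (2 ^ s) ^ (1 / 2 : ℝ) * (ENNReal.ofReal (jap (modul z) ^ (-(17 / 32) : ℝ)) *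
        inputKernel z a ^ (1 / 2 : ℝ) *
        (weighted (weightHigh s) f a * weighted (weightLow s) g (z - a))) := by
  have h1 := jap_pos (modul z)
  have h2 := jap_pos (modul a)
  have h3 := jap_pos (modul (z - a))
  have h4 := one_le_excess z
  have h5 := one_le_excess a
  have h6 := japZeta_pos z.2.1 z.2.2
  have e : jap (modul z) ^ (-(17 / 16) : ℝ) * jap (modul z) ^ (-(15 / 16) : ℝ) =
      jap (modul z) ^ (-2 : ℝ) := by rw [← Real.rpow_add h1]; norm_num
  have hc : 0 ≤ jap (modul z) ^ (-(17 / 16) : ℝ) *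
      (z.2.1 ^ 2 * excess z * jap (modul z) ^ (-(15 / 16) : ℝ)) := by positivity
  refine mul_weighted_le (B := jap (modul z) ^ (-(17 / 16) : ℝ) *
      (z.2.1 ^ 2 * excess z * jap (modul z) ^ (-(15 / 16) : ℝ)) *
      ((excess a)⁻¹ * jap (modul a) ^ (-1 : ℝ)) * jap (modul (z - a)) ^ (-(15 / 16) : ℝ))
    (by positivity) (weightHigh_nonneg s a) (le_of_eq ?_) (le_trans ?_ (input_le hs hc)) f g
  · rw [mul_pow, rpow_half_sq, inputKernel, if_pos h, ← ENNReal.ofReal_pow (by positivity),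
      ← Real.rpow_mul_natCast h1.le, ← ENNReal.ofReal_mul (by positivity)]
    congr 1
    norm_num
    ring
  · rw [outZ]
    calc _ = z.2.1 ^ 2 * 1 * jap (modul z) ^ (-2 : ℝ) * japZeta z.2.1 z.2.2 ^ (2 * s) := by
          ring
      _ ≤ z.2.1 ^ 2 * excess z * jap (modul z) ^ (-2 : ℝ) * japZeta z.2.1 z.2.2 ^ (2 * s) :=
          mul_le_mul_of_nonneg_right (mul_le_mul_of_nonneg_right
            (mul_le_mul_of_nonneg_left h4 (sq_nonneg _)) (by positivity)) (by positivity)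
      _ = _ := by rw [← e]; ring

/-- The last alternative is the second one after exchanging the inputs, which produces the second
product on the right of the estimates. -/
theorem region_cases (z a : Freq) : OutputRegion z a ∨ InputRegion z a ∨ InputRegion z (z - a) := by
  unfold OutputRegion InputRegion
  rw [sub_sub_cancel]
  rcases le_total |modul a| |modul z| with h1 | h1
  · rcases le_total |modul (z - a)| |modul z| with h2 | h2
    · exact Or.inl ⟨h1, h2⟩
    · exact Or.inr (Or.inr ⟨h2, h1.trans h2⟩)
  · rcases le_total |modul (z - a)| |modul a| with h2 | h2
    · exact Or.inr (Or.inl ⟨h1, h2⟩)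
    · exact Or.inr (Or.inr ⟨h1.trans h2, h2⟩)

theorem outX_le (hs : 0 ≤ s) (z a : Freq) (f g : Freq → ℝ≥0∞) :
    ENNReal.ofReal (outX s z) ^ (1 / 2 : ℝ) * (f a * g (z - a)) ≤
      ENNReal.ofReal (2 ^ s) ^ (1 / 2 : ℝ) * (outputKernel z a ^ (1 / 2 : ℝ) *
          (weighted (weightLow s) f a * weighted (weightLow s) g (z - a)) +
        (inputKernel z a ^ (1 / 2 : ℝ) *
          (weighted (weightHigh s) f a * weighted (weightLow s) g (z - a)) +
        inputKernel z (z - a) ^ (1 / 2 : ℝ) *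
          (weighted (weightHigh s) g (z - a) * weighted (weightLow s) f a))) := by
  rcases region_cases z a with h | h | h
  · refine (outX_output_le hs h f g).trans ?_
    gcongr; exact le_self_add
  · refine (outX_input_le hs h f g).trans ?_
    gcongr; exact le_add_left le_self_add
  · have := outX_input_le hs h g f
    rw [sub_sub_cancel, mul_comm (g _)] at this
    refine this.trans ?_
    gcongr; exact le_add_left le_add_self

theorem outZ_le (hs : 0 ≤ s) (z a : Freq) (f g : Freq → ℝ≥0∞) :
    ENNReal.ofReal (outZ s z) ^ (1 / 2 : ℝ) * (f a * g (z - a)) ≤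
      ENNReal.ofReal (2 ^ s) ^ (1 / 2 : ℝ) * (outputKernelL1 z a *
          (weighted (weightLow s) f a * weighted (weightLow s) g (z - a)) +
        ENNReal.ofReal (jap (modul z) ^ (-(17 / 32) : ℝ)) * (inputKernel z a ^ (1 / 2 : ℝ) *
          (weighted (weightHigh s) f a * weighted (weightLow s) g (z - a)) +
        inputKernel z (z - a) ^ (1 / 2 : ℝ) *
          (weighted (weightHigh s) g (z - a) * weighted (weightLow s) f a))) := by
  rw [mul_add (ENNReal.ofReal (jap (modul z) ^ (-(17 / 32) : ℝ))), ← mul_assoc (ENNReal.ofReal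
    (jap (modul z) ^ (-(17 / 32) : ℝ))), ← mul_assoc (ENNReal.ofReal
    (jap (modul z) ^ (-(17 / 32) : ℝ)))]
  rcases region_cases z a with h | h | h
  · refine (outZ_output_le hs h f g).trans ?_
    gcongr; exact le_self_add
  · refine (outZ_input_le hs h f g).trans ?_
    gcongr; exact le_add_left le_self_add
  · have := outZ_input_le hs h g f
    rw [sub_sub_cancel, mul_comm (g _)] at this
    refine this.trans ?_
    gcongr; exact le_add_left le_add_self

end Pointwise

/-! ### Integrated estimates for nonnegative functions of the frequency. -/

theorem add_sq_le_three (x y : ℝ≥0∞) : (x + y) ^ 2 ≤ 3 * (x ^ 2 + y ^ 2) := by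
  have := mul_le_sq_add_sq x y
  calc (x + y) ^ 2 = x ^ 2 + y ^ 2 + 2 * (x * y) := by ring
    _ ≤ x ^ 2 + y ^ 2 + 2 * (x ^ 2 + y ^ 2) := by gcongr
    _ = _ := by ring

/-- The bilinear operator of the kernel `inputKernel`. -/
def inputOp (f g : Freq → ℝ≥0∞) (z : Freq) : ℝ≥0∞ :=
  ∫⁻ a, inputKernel z a ^ (1 / 2 : ℝ) * (f a * g (z - a)) ∂freqMeasure

theorem measurable_inputKernel_mul {f g : Freq → ℝ≥0∞} (hf : Measurable f) (hg : Measurable g) :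
    Measurable (Function.uncurry fun z a => inputKernel z a ^ (1 / 2 : ℝ) * (f a * g (z - a))) := by
  have h := measurable_inputKernel.pow_const (1 / 2 : ℝ)
  have h2 : Measurable (Function.uncurry fun z a : Freq => f a * g (z - a)) := by fun_prop
  exact h.mul h2

theorem measurable_inputOp {f g : Freq → ℝ≥0∞} (hf : Measurable f) (hg : Measurable g) :
    Measurable (inputOp f g) :=
  (measurable_inputKernel_mul hf hg).lintegral_prod_right

theorem lintegral_inputKernel_sub (f g : Freq → ℝ≥0∞) (z : Freq) :
    ∫⁻ a, inputKernel z (z - a) ^ (1 / 2 : ℝ) * (f (z - a) * g a) ∂freqMeasure =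
      inputOp f g z := by
  rw [inputOp, ← lintegral_sub_left_eq_self _ z]
  simp only [sub_sub_cancel]

theorem lintegral_outX_le {s : ℝ} (hs : 0 ≤ s) {f g : Freq → ℝ≥0∞} (hf : Measurable f)
    (hg : Measurable g) (z : Freq) :
    ENNReal.ofReal (outX s z) ^ (1 / 2 : ℝ) * ∫⁻ a, f a * g (z - a) ∂freqMeasure ≤
      ENNReal.ofReal (2 ^ s) ^ (1 / 2 : ℝ) * ((∫⁻ a, outputKernel z a ^ (1 / 2 : ℝ) *
          (weighted (weightLow s) f a * weighted (weightLow s) g (z - a)) ∂freqMeasure) +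
        (inputOp (weighted (weightHigh s) f) (weighted (weightLow s) g) z +
         inputOp (weighted (weightHigh s) g) (weighted (weightLow s) f) z)) := by
  have hfl := measurable_weighted (measurable_weightLow s) hf
  have hgl := measurable_weighted (measurable_weightLow s) hg
  have hfh := measurable_weighted (measurable_weightHigh s) hf
  have hgh := measurable_weighted (measurable_weightHigh s) hg
  have m1 : Measurable fun a => outputKernel z a ^ (1 / 2 : ℝ) *
      (weighted (weightLow s) f a * weighted (weightLow s) g (z - a)) := by
    have := (measurable_outputKernel.comp (measurable_prodMk_left (x := z))).pow_const (1 / 2 : ℝ)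
    exact this.mul (by fun_prop)
  have m2 : Measurable fun a => inputKernel z a ^ (1 / 2 : ℝ) *
      (weighted (weightHigh s) f a * weighted (weightLow s) g (z - a)) :=
    (measurable_inputKernel_mul hfh hgl).comp measurable_prodMk_left
  rw [← lintegral_const_mul' _ _ (by simp)]
  refine (lintegral_mono fun a => outX_le hs z a f g).trans (le_of_eq ?_)
  rw [lintegral_const_mul' _ _ (by simp), lintegral_add_left m1, lintegral_add_left m2,
    lintegral_inputKernel_sub]
  rfl

theorem lintegral_outZ_le {s : ℝ} (hs : 0 ≤ s) {f g : Freq → ℝ≥0∞} (hf : Measurable f)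
    (hg : Measurable g) (z : Freq) :
    ENNReal.ofReal (outZ s z) ^ (1 / 2 : ℝ) * ∫⁻ a, f a * g (z - a) ∂freqMeasure ≤
      ENNReal.ofReal (2 ^ s) ^ (1 / 2 : ℝ) * ((∫⁻ a, outputKernelL1 z a *
          (weighted (weightLow s) f a * weighted (weightLow s) g (z - a)) ∂freqMeasure) +
        ENNReal.ofReal (jap (modul z) ^ (-(17 / 32) : ℝ)) *
        (inputOp (weighted (weightHigh s) f) (weighted (weightLow s) g) z +
         inputOp (weighted (weightHigh s) g) (weighted (weightLow s) f) z)) := by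
  have hfl := measurable_weighted (measurable_weightLow s) hf
  have hgl := measurable_weighted (measurable_weightLow s) hg
  have hfh := measurable_weighted (measurable_weightHigh s) hf
  have hgh := measurable_weighted (measurable_weightHigh s) hg
  have m1 : Measurable fun a => outputKernelL1 z a *
      (weighted (weightLow s) f a * weighted (weightLow s) g (z - a)) := by
    have := measurable_outputKernelL1.comp (measurable_prodMk_left (x := z))
    exact this.mul (by fun_prop)
  have m2 : Measurable fun a => inputKernel z a ^ (1 / 2 : ℝ) *
      (weighted (weightHigh s) f a * weighted (weightLow s) g (z - a)) :=
    (measurable_inputKernel_mul hfh hgl).comp measurable_prodMk_left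
  rw [← lintegral_const_mul' _ _ (by simp)]
  refine (lintegral_mono fun a => outZ_le hs z a f g).trans (le_of_eq ?_)
  rw [lintegral_const_mul' _ _ (by simp), lintegral_add_left m1,
    lintegral_const_mul' _ _ (by simp), lintegral_add_left m2, lintegral_inputKernel_sub]
  rfl

/-- The square of the norm of weight `w`. -/
def weightedEnergy (w : Freq → ℝ) (f : Freq → ℝ≥0∞) : ℝ≥0∞ :=
  ∫⁻ a, ENNReal.ofReal (w a) * f a ^ 2 ∂freqMeasure

theorem lintegral_weighted_sq (w : Freq → ℝ) (f : Freq → ℝ≥0∞) :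
    ∫⁻ a, weighted w f a ^ 2 ∂freqMeasure = weightedEnergy w f := by
  simp only [weighted_sq, weightedEnergy]

theorem weightLow_le_weightHigh (s : ℝ) (z : Freq) : weightLow s z ≤ weightHigh s z := by
  have h1 := jap_pos (modul z)
  have h2 := japZeta_pos z.2.1 z.2.2
  have h3 : jap (modul z) ^ (15 / 16 : ℝ) ≤ jap (modul z) := by
    conv_rhs => rw [← Real.rpow_one (jap (modul z))]
    exact Real.rpow_le_rpow_of_exponent_le (one_le_jap _) (by norm_num)
  rw [weightHigh_eq, weightLow_eq]
  calc _ = 1 * japZeta z.2.1 z.2.2 ^ (2 * s) * jap (modul z) ^ (15 / 16 : ℝ) := by rw [one_mul]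
    _ ≤ _ := by
      have := one_le_excess z
      gcongr

/-- With a dominant output both inputs need only the low weight; one of them is raised here to fit
the right-hand side. -/
theorem weightedEnergy_low_le (s : ℝ) (f : Freq → ℝ≥0∞) :
    weightedEnergy (weightLow s) f ≤ weightedEnergy (weightHigh s) f := by
  refine lintegral_mono fun a => ?_
  gcongr
  exact weightLow_le_weightHigh s a

/-- The right-hand side of the bilinear estimates, with squared norms. -/
def bilinearBound (s : ℝ) (f g : Freq → ℝ≥0∞) : ℝ≥0∞ :=
  weightedEnergy (weightHigh s) f * weightedEnergy (weightLow s) g +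
    weightedEnergy (weightLow s) f * weightedEnergy (weightHigh s) g

theorem exists_lintegral_inputOp_le : ∃ C : ℝ≥0, ∀ (s : ℝ) (f g : Freq → ℝ≥0∞),
    Measurable f → Measurable g →
    ∫⁻ z, (inputOp (weighted (weightHigh s) f) (weighted (weightLow s) g) z +
      inputOp (weighted (weightHigh s) g) (weighted (weightLow s) f) z) ^ 2 ∂freqMeasure ≤
      C * bilinearBound s f g := by
  obtain ⟨C, hC⟩ := bilinearBounded_inputKernel
  refine ⟨3 * C, fun s f g hf hg => ?_⟩
  have hfl := measurable_weighted (measurable_weightLow s) hf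
  have hgl := measurable_weighted (measurable_weightLow s) hg
  have hfh := measurable_weighted (measurable_weightHigh s) hf
  have hgh := measurable_weighted (measurable_weightHigh s) hg
  calc _ ≤ ∫⁻ z, 3 * (inputOp (weighted (weightHigh s) f) (weighted (weightLow s) g) z ^ 2 +
        inputOp (weighted (weightHigh s) g) (weighted (weightLow s) f) z ^ 2) ∂freqMeasure :=
        lintegral_mono fun z => add_sq_le_three _ _
    _ = 3 * ((∫⁻ z, inputOp (weighted (weightHigh s) f) (weighted (weightLow s) g) z ^ 2
          ∂freqMeasure) +
        ∫⁻ z, inputOp (weighted (weightHigh s) g) (weighted (weightLow s) f) z ^ 2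
          ∂freqMeasure) := by
        rw [lintegral_const_mul' _ _ (by simp),
          lintegral_add_left ((measurable_inputOp hfh hgl).pow_const 2)]
    _ ≤ 3 * (C * (weightedEnergy (weightHigh s) f * weightedEnergy (weightLow s) g) +
        C * (weightedEnergy (weightHigh s) g * weightedEnergy (weightLow s) f)) := by
        simp only [← lintegral_weighted_sq]
        gcongr
        · exact hC _ _ hfh hgl
        · exact hC _ _ hgh hfl
    _ = _ := by rw [bilinearBound]; push_cast; ring

theorem exists_lintegral_outX_le {s : ℝ} (hs : 0 ≤ s) : ∃ C : ℝ≥0, ∀ f g : Freq → ℝ≥0∞,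
    Measurable f → Measurable g →
    ∫⁻ z, ENNReal.ofReal (outX s z) * (∫⁻ a, f a * g (z - a) ∂freqMeasure) ^ 2 ∂freqMeasure ≤
      C * bilinearBound s f g := by
  obtain ⟨C₁, hC₁⟩ := bilinearBounded_outputKernel
  obtain ⟨C₂, hC₂⟩ := exists_lintegral_inputOp_le
  refine ⟨Real.toNNReal (2 ^ s) * 3 * (C₁ + C₂), fun f g hf hg => ?_⟩
  have hfl := measurable_weighted (measurable_weightLow s) hf
  have hgl := measurable_weighted (measurable_weightLow s) hg
  have hfh := measurable_weighted (measurable_weightHigh s) hf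
  have hgh := measurable_weighted (measurable_weightHigh s) hg
  have hI : Measurable fun z =>
      (inputOp (weighted (weightHigh s) f) (weighted (weightLow s) g) z +
        inputOp (weighted (weightHigh s) g) (weighted (weightLow s) f) z) ^ 2 :=
    ((measurable_inputOp hfh hgl).add (measurable_inputOp hgh hfl)).pow_const 2
  calc _ = ∫⁻ z, (ENNReal.ofReal (outX s z) ^ (1 / 2 : ℝ) *
          ∫⁻ a, f a * g (z - a) ∂freqMeasure) ^ 2 ∂freqMeasure := by
        simp only [mul_pow, rpow_half_sq]
    _ ≤ ∫⁻ z, ENNReal.ofReal (2 ^ s) * 3 * ((∫⁻ a, outputKernel z a ^ (1 / 2 : ℝ) *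
          (weighted (weightLow s) f a * weighted (weightLow s) g (z - a)) ∂freqMeasure) ^ 2 +
        (inputOp (weighted (weightHigh s) f) (weighted (weightLow s) g) z +
         inputOp (weighted (weightHigh s) g) (weighted (weightLow s) f) z) ^ 2) ∂freqMeasure := by
        refine lintegral_mono fun z => ?_
        refine (pow_le_pow_left₀ zero_le (lintegral_outX_le hs hf hg z) 2).trans ?_
        rw [mul_pow, rpow_half_sq, mul_assoc]
        gcongr
        exact add_sq_le_three _ _
    _ = ENNReal.ofReal (2 ^ s) * 3 * ((∫⁻ z, (∫⁻ a, outputKernel z a ^ (1 / 2 : ℝ) *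
          (weighted (weightLow s) f a * weighted (weightLow s) g (z - a)) ∂freqMeasure) ^ 2
            ∂freqMeasure) + ∫⁻ z,
        (inputOp (weighted (weightHigh s) f) (weighted (weightLow s) g) z +
         inputOp (weighted (weightHigh s) g) (weighted (weightLow s) f) z) ^ 2 ∂freqMeasure) := by
        rw [lintegral_const_mul' _ _ (ENNReal.mul_ne_top ENNReal.ofReal_ne_top (by simp)),
          lintegral_add_right _ hI]
    _ ≤ ENNReal.ofReal (2 ^ s) * 3 * (C₁ * bilinearBound s f g + C₂ * bilinearBound s f g) := by
        gcongr
        · refine (hC₁ _ _ hfl hgl).trans ?_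
          rw [lintegral_weighted_sq, lintegral_weighted_sq]
          gcongr
          refine le_add_right ?_
          gcongr
          exact weightedEnergy_low_le s f
        · exact hC₂ s f g hf hg
    _ = _ := by push_cast; rw [ENNReal.ofReal]; ring

theorem exists_lintegral_outZ_le {s : ℝ} (hs : 0 ≤ s) : ∃ C : ℝ≥0, ∀ f g : Freq → ℝ≥0∞,
    Measurable f → Measurable g →
    ∑' q : ℤ, ∫⁻ ξ, (∫⁻ τ, ENNReal.ofReal (outZ s (τ, ξ, q)) ^ (1 / 2 : ℝ) *
      ∫⁻ a, f a * g ((τ, ξ, q) - a) ∂freqMeasure) ^ 2 ≤ C * bilinearBound s f g := by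
  obtain ⟨C₁, hC₁⟩ := exists_lintegral_outputKernelL1_le
  obtain ⟨C₂, hC₂⟩ := exists_lintegral_inputOp_le
  obtain ⟨C₃, hC₃⟩ := exists_lintegral_jap_rpow_le (p := 17 / 16) (by norm_num)
  refine ⟨Real.toNNReal (2 ^ s) * 3 * (C₁ + C₃ * C₂), fun f g hf hg => ?_⟩
  have hfl := measurable_weighted (measurable_weightLow s) hf
  have hgl := measurable_weighted (measurable_weightLow s) hg
  have hfh := measurable_weighted (measurable_weightHigh s) hf
  have hgh := measurable_weighted (measurable_weightHigh s) hg
  set I : Freq → ℝ≥0∞ := fun z =>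
    inputOp (weighted (weightHigh s) f) (weighted (weightLow s) g) z +
      inputOp (weighted (weightHigh s) g) (weighted (weightLow s) f) z with hI
  have hIm : Measurable I := (measurable_inputOp hfh hgl).add (measurable_inputOp hgh hfl)
  set O : Freq → ℝ≥0∞ := fun z => ∫⁻ a, outputKernelL1 z a *
    (weighted (weightLow s) f a * weighted (weightLow s) g (z - a)) ∂freqMeasure with hO
  have hOm : Measurable O := by
    have h1 : Measurable (Function.uncurry fun z a : Freq =>
        weighted (weightLow s) f a * weighted (weightLow s) g (z - a)) := by fun_prop
    exact (measurable_outputKernelL1.mul h1).lintegral_prod_right'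
  have hne : ENNReal.ofReal (2 ^ s) * 3 ≠ ∞ := ENNReal.mul_ne_top ENNReal.ofReal_ne_top (by simp)
  have hstep : ∀ (ξ : ℝ) (q : ℤ), (∫⁻ τ, ENNReal.ofReal (outZ s (τ, ξ, q)) ^ (1 / 2 : ℝ) *
      ∫⁻ a, f a * g ((τ, ξ, q) - a) ∂freqMeasure) ^ 2 ≤ ENNReal.ofReal (2 ^ s) * 3 *
      ((∫⁻ τ, O (τ, ξ, q)) ^ 2 + C₃ * ∫⁻ τ, I (τ, ξ, q) ^ 2) := by
    intro ξ q
    have mO : Measurable fun τ : ℝ => O (τ, ξ, q) := by fun_prop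
    have mI : Measurable fun τ : ℝ => I (τ, ξ, q) := by fun_prop
    have mp : Measurable fun τ : ℝ => ((τ, ξ, q) : Freq) := by fun_prop
    have mj : Measurable fun τ : ℝ =>
      ENNReal.ofReal (jap (modul (τ, ξ, q)) ^ (-(17 / 32) : ℝ)) := by fun_prop
    -- The square has exponent 17/16 > 1, and σ is a translate of τ; the bound is uniform in (ξ, q).
    have hj : ∫⁻ τ, ENNReal.ofReal (jap (modul (τ, ξ, q)) ^ (-(17 / 32) : ℝ)) ^ 2 ≤ C₃ := by
      refine le_trans (le_of_eq (lintegral_congr fun τ => ?_)) (hC₃ (-modul (0, ξ, q)))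
      have h0 := jap_pos (modul (τ, ξ, q))
      rw [← ENNReal.ofReal_pow (by positivity), ← Real.rpow_mul_natCast h0.le]
      have e : modul (τ, ξ, q) = τ - -modul (0, ξ, q) := by simp only [modul, modulation]; ring
      rw [← e]; norm_num
    calc _ ≤ (∫⁻ τ, ENNReal.ofReal (2 ^ s) ^ (1 / 2 : ℝ) * (O (τ, ξ, q) +
          ENNReal.ofReal (jap (modul (τ, ξ, q)) ^ (-(17 / 32) : ℝ)) * I (τ, ξ, q))) ^ 2 := by
          exact pow_le_pow_left₀ zero_le
            (lintegral_mono fun τ => lintegral_outZ_le hs hf hg (τ, ξ, q)) 2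
      _ = ENNReal.ofReal (2 ^ s) * ((∫⁻ τ, O (τ, ξ, q)) +
          ∫⁻ τ, ENNReal.ofReal (jap (modul (τ, ξ, q)) ^ (-(17 / 32) : ℝ)) * I (τ, ξ, q)) ^ 2 := by
          rw [lintegral_const_mul' _ _ (by simp), lintegral_add_left mO, mul_pow, rpow_half_sq]
      _ ≤ ENNReal.ofReal (2 ^ s) * (3 * ((∫⁻ τ, O (τ, ξ, q)) ^ 2 +
          (∫⁻ τ, ENNReal.ofReal (jap (modul (τ, ξ, q)) ^ (-(17 / 32) : ℝ)) *
            I (τ, ξ, q)) ^ 2)) := by gcongr; exact add_sq_le_three _ _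
      _ ≤ ENNReal.ofReal (2 ^ s) * (3 * ((∫⁻ τ, O (τ, ξ, q)) ^ 2 +
          C₃ * ∫⁻ τ, I (τ, ξ, q) ^ 2)) := by
          gcongr
          refine (sq_lintegral_mul_le mj.aemeasurable mI.aemeasurable).trans ?_
          gcongr
      _ = _ := by ring
  calc _ ≤ ∑' q : ℤ, ∫⁻ ξ, ENNReal.ofReal (2 ^ s) * 3 *
      ((∫⁻ τ, O (τ, ξ, q)) ^ 2 + C₃ * ∫⁻ τ, I (τ, ξ, q) ^ 2) :=
        ENNReal.tsum_le_tsum fun q => lintegral_mono fun ξ => hstep ξ q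
    _ = ENNReal.ofReal (2 ^ s) * 3 * ((∑' q : ℤ, ∫⁻ ξ, (∫⁻ τ, O (τ, ξ, q)) ^ 2) +
        C₃ * ∫⁻ z, I z ^ 2 ∂freqMeasure) := by
        rw [lintegral_freqMeasure' (hIm.pow_const 2), ← ENNReal.tsum_mul_left, ← ENNReal.tsum_add,
          ← ENNReal.tsum_mul_left]
        refine tsum_congr fun q => ?_
        have mO : Measurable fun ξ : ℝ => (∫⁻ τ, O (τ, ξ, q)) ^ 2 := by
          have : Measurable fun x : ℝ × ℝ => O (x.2, x.1, q) := by fun_prop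
          exact this.lintegral_prod_right'.pow_const 2
        rw [lintegral_const_mul' _ _ hne, lintegral_add_left mO,
          lintegral_const_mul' _ _ ENNReal.coe_ne_top]
    _ ≤ ENNReal.ofReal (2 ^ s) * 3 * (C₁ * bilinearBound s f g +
        C₃ * (C₂ * bilinearBound s f g)) := by
        gcongr
        · refine (hC₁ _ _ hfl hgl).trans ?_
          rw [lintegral_weighted_sq, lintegral_weighted_sq]
          gcongr
          refine le_add_right ?_
          gcongr
          exact weightedEnergy_low_le s f
        · exact hC₂ s f g hf hg
    _ = _ := by push_cast; rw [ENNReal.ofReal]; ring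

/-! ### Functions determined by their pairings with Schwartz functions -/

/-- A smooth bump equal to 1 on a ball is a Schwartz function. -/
theorem locallyIntegrable_of_schwartz_mul {G : Plane → ℂ}
    (hG : ∀ φ : 𝓢(Plane, ℂ), Integrable fun p => φ p * G p) : LocallyIntegrable G := by
  intro x
  let b : ContDiffBump x := ⟨1, 2, one_pos, one_lt_two⟩
  have hb : HasCompactSupport fun p : Plane => ((b p : ℝ) : ℂ) :=
    b.hasCompactSupport.comp_left Complex.ofReal_zero
  have hb' : ContDiff ℝ (⊤ : ℕ∞) fun p : Plane => ((b p : ℝ) : ℂ) :=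
    Complex.ofRealCLM.contDiff.comp b.contDiff
  refine ⟨Metric.closedBall x 1, Metric.closedBall_mem_nhds x one_pos, ?_⟩
  refine ((hG (hb.toSchwartzMap hb')).integrableOn (s := Metric.closedBall x 1)).congr_fun
    (fun p hp => ?_) Metric.isClosed_closedBall.measurableSet
  have h1 : b p = 1 := b.one_of_mem_closedBall hp
  change ((b p : ℝ) : ℂ) * G p = G p
  rw [h1, Complex.ofReal_one, one_mul]

theorem ae_eq_of_schwartz {G H : Plane → ℂ}
    (hG : ∀ φ : 𝓢(Plane, ℂ), Integrable fun p => φ p * G p)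
    (hH : ∀ φ : 𝓢(Plane, ℂ), Integrable fun p => φ p * H p)
    (h : ∀ φ : 𝓢(Plane, ℂ), ∫ p, φ p * G p = ∫ p, φ p * H p) : G =ᵐ[volume] H := by
  refine ae_eq_of_integral_contDiff_smul_eq (locallyIntegrable_of_schwartz_mul hG)
    (locallyIntegrable_of_schwartz_mul hH) fun g hg hc => ?_
  have hb : HasCompactSupport fun p : Plane => ((g p : ℝ) : ℂ) :=
    hc.comp_left Complex.ofReal_zero
  have hb' : ContDiff ℝ (⊤ : ℕ∞) fun p : Plane => ((g p : ℝ) : ℂ) :=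
    Complex.ofRealCLM.contDiff.comp hg
  exact h (hb.toSchwartzMap hb')

/-! ### The dilation relating the two normalisations of frequencies -/

/-- The dilation `p ↦ (2πp₀, 2πp₁)`. -/
def dilate (p : Plane) : ℝ × ℝ := (2 * π * p 0, 2 * π * p 1)

@[fun_prop]
theorem measurable_dilate : Measurable dilate := by unfold dilate; fun_prop

/-- The Jacobian factor of `dilate`. -/
def dilateConst : ℝ≥0∞ := ENNReal.ofReal |((2 * π) ^ Module.finrank ℝ (ℝ × ℝ))⁻¹|

theorem dilateConst_ne_zero : dilateConst ≠ 0 := by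
  have := Real.pi_pos
  rw [dilateConst, Ne, ENNReal.ofReal_eq_zero, not_le]
  positivity

theorem dilateConst_ne_top : dilateConst ≠ ∞ := ENNReal.ofReal_ne_top

theorem map_dilate : Measure.map dilate volume = dilateConst • (volume : Measure (ℝ × ℝ)) := by
  have h1 : MeasurePreserving (fun p : Plane => (p 0, p 1)) volume (volume : Measure (ℝ × ℝ)) :=
    (volume_preserving_finTwoArrow ℝ).comp (PiLp.volume_preserving_ofLp (Fin 2))
  have h2 : dilate = (fun x : ℝ × ℝ => (2 * π) • x) ∘ fun p : Plane => (p 0, p 1) := by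
    funext p; rfl
  rw [h2, ← Measure.map_map (measurable_const_smul _) h1.measurable, h1.map_eq,
    Measure.map_addHaar_smul volume Real.two_pi_pos.ne']
  rfl

theorem lintegral_comp_dilate {f : ℝ × ℝ → ℝ≥0∞} (hf : Measurable f) :
    ∫⁻ p, f (dilate p) = dilateConst * ∫⁻ x, f x := by
  rw [← lintegral_map hf measurable_dilate, map_dilate, lintegral_smul_measure, smul_eq_mul]

theorem ae_of_ae_dilate {P : ℝ × ℝ → Prop} (hP : MeasurableSet {x | P x})
    (h : ∀ᵐ p, P (dilate p)) : ∀ᵐ x, P x := by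
  rw [← ae_map_iff measurable_dilate.aemeasurable hP, map_dilate] at h
  rwa [ae_iff, Measure.smul_apply, smul_eq_mul, mul_eq_zero, or_iff_right dilateConst_ne_zero] at h

/-! ### Uniqueness of the Fourier transform -/

theorem IsFourierTransform.ae_eq {T : STDistribution} {F F' : ℝ → ℝ → ℤ → ℂ}
    (hF : IsFourierTransform T F) (hF' : IsFourierTransform T F') (q : ℤ) :
    ∀ᵐ x : ℝ × ℝ, F x.1 x.2 q = F' x.1 x.2 q := by
  refine ae_of_ae_dilate (measurableSet_eq_fun (hF q).1 (hF' q).1) ?_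
  exact ae_eq_of_schwartz (fun φ => ((hF q).2 φ).1) (fun φ => ((hF' q).2 φ).1)
    fun φ => ((hF q).2 φ).2.symm.trans ((hF' q).2 φ).2

/-- The absolute value of `F` as a function on the space of frequencies. -/
def enormFreq (F : ℝ → ℝ → ℤ → ℂ) (a : Freq) : ℝ≥0∞ := ‖F a.1 a.2.1 a.2.2‖ₑ

theorem measurable_uncurry_freq {F : ℝ → ℝ → ℤ → ℂ}
    (hF : ∀ q, Measurable fun z : ℝ × ℝ => F z.1 z.2 q) :
    Measurable fun a : Freq => F a.1 a.2.1 a.2.2 := by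
  have h : Measurable fun x : (ℝ × ℝ) × ℤ => F x.1.1 x.1.2 x.2 :=
    measurable_from_prod_countable_left fun q => hF q
  exact h.comp (show Measurable fun a : Freq => ((a.1, a.2.1), a.2.2) by fun_prop)

theorem measurable_enormFreq {F : ℝ → ℝ → ℤ → ℂ}
    (hF : ∀ q, Measurable fun z : ℝ × ℝ => F z.1 z.2 q) : Measurable (enormFreq F) :=
  (measurable_uncurry_freq hF).enorm

/-- The norm of a distribution is computed by any representative of its Fourier transform. -/
theorem normX_eq {b b₁ s : ℝ} {T : STDistribution} {F : ℝ → ℝ → ℤ → ℂ}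
    (hF : IsFourierTransform T F) :
    normX b b₁ s T = (∑' q : ℤ, ∫⁻ ξ : ℝ, ∫⁻ τ : ℝ,
      ENNReal.ofReal (weightX b b₁ s τ ξ q) * ‖F τ ξ q‖ₑ ^ 2) ^ (1 / 2 : ℝ) := by
  refine le_antisymm (iInf₂_le F hF) (le_iInf₂ fun F' hF' => le_of_eq ?_)
  congr 1
  refine tsum_congr fun q => ?_
  have h := hF.ae_eq hF' q
  have h' : ∀ᵐ ξ : ℝ, ∀ᵐ τ : ℝ, F τ ξ q = F' τ ξ q := by
    have hsw : ∀ᵐ x : ℝ × ℝ, F x.2 x.1 q = F' x.2 x.1 q :=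
      (Measure.measurePreserving_swap (μ := (volume : Measure ℝ))
        (ν := (volume : Measure ℝ))).quasiMeasurePreserving.ae h
    exact Measure.ae_ae_of_ae_prod hsw
  refine lintegral_congr_ae ?_
  filter_upwards [h'] with ξ hξ
  refine lintegral_congr_ae ?_
  filter_upwards [hξ] with τ hτ
  rw [hτ]

/-- Elements of X^{1/2,1/3,s} thus have square integrable transforms, as the convolution formula
requires. -/
theorem one_le_weightHigh {s : ℝ} (hs : 0 ≤ s) (z : Freq) : 1 ≤ weightHigh s z := by
  rw [weightHigh_eq]
  have h1 : 1 ≤ japZeta z.2.1 z.2.2 ^ (2 * s) :=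
    Real.one_le_rpow (Real.one_le_sqrt.2 (by nlinarith [sq_nonneg z.2.1, sq_nonneg (z.2.2 : ℝ)]))
      (by linarith)
  exact one_le_mul_of_one_le_of_one_le
    (one_le_mul_of_one_le_of_one_le (one_le_excess z) h1) (one_le_jap _)

theorem normX_high_eq {s : ℝ} {T : STDistribution} {F : ℝ → ℝ → ℤ → ℂ}
    (hF : IsFourierTransform T F) :
    normX (1 / 2) (1 / 3) s T = weightedEnergy (weightHigh s) (enormFreq F) ^ (1 / 2 : ℝ) := by
  have hm := measurable_enormFreq fun q => (hF q).1
  rw [normX_eq hF, weightedEnergy, lintegral_freqMeasure' (by fun_prop)]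
  rfl

theorem normX_low_eq {s : ℝ} {T : STDistribution} {F : ℝ → ℝ → ℤ → ℂ}
    (hF : IsFourierTransform T F) :
    normX (15 / 32) 0 s T = weightedEnergy (weightLow s) (enormFreq F) ^ (1 / 2 : ℝ) := by
  have hm := measurable_enormFreq fun q => (hF q).1
  rw [normX_eq hF, weightedEnergy, lintegral_freqMeasure' (by fun_prop)]
  rfl

/-! ### Integrability of the triple product -/

theorem lintegral_mul_sub_le {G : Type*} [MeasurableSpace G] [AddCommGroup G] [MeasurableAdd₂ G]
    [MeasurableNeg G] [MeasurableSub₂ G] {μ : Measure G} [SigmaFinite μ] [μ.IsAddLeftInvariant]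
    [μ.IsNegInvariant] {f g : G → ℝ≥0∞} (hf : Measurable f) (z : G) :
    ∫⁻ a, f a * g (z - a) ∂μ ≤ (∫⁻ a, f a ^ 2 ∂μ) + ∫⁻ a, g a ^ 2 ∂μ := by
  calc _ ≤ ∫⁻ a, (f a ^ 2 + g (z - a) ^ 2) ∂μ := lintegral_mono fun a => mul_le_sq_add_sq _ _
    _ = _ := by
      rw [lintegral_add_left (hf.pow_const 2), lintegral_sub_left_eq_self (fun a => g a ^ 2)]

/-- The integral of |f(a) g(z − a)| is bounded uniformly in z by the two energies, so that
integrability of ψ suffices. This justifies the exchanges of integrals in the convolution formulas.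
-/
theorem integrable_mul_sub {P G : Type*} [MeasurableSpace P] {ν : Measure P} [SFinite ν]
    [MeasurableSpace G] [AddCommGroup G] [MeasurableAdd₂ G]
    [MeasurableNeg G] [MeasurableSub₂ G] {μ : Measure G} [SigmaFinite μ] [μ.IsAddLeftInvariant]
    [μ.IsNegInvariant] {f g : G → ℂ} (hf : Measurable f) (hg : Measurable g)
    (hf2 : ∫⁻ a, ‖f a‖ₑ ^ 2 ∂μ ≠ ∞) (hg2 : ∫⁻ a, ‖g a‖ₑ ^ 2 ∂μ ≠ ∞) {ψ : P → ℂ}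
    (hψ : Integrable ψ ν) {z : P → G} (hz : Measurable z) :
    Integrable (fun x : P × G => ψ x.1 * (f x.2 * g (z x.1 - x.2))) (ν.prod μ) := by
  have hfg : Measurable fun x : P × G => f x.2 * g (z x.1 - x.2) := by fun_prop
  have hψm : AEStronglyMeasurable (fun x : P × G => ψ x.1) (ν.prod μ) := hψ.1.comp_fst
  refine ⟨hψm.mul hfg.aestronglyMeasurable, ?_⟩
  rw [hasFiniteIntegral_iff_enorm]
  simp only [enorm_mul]
  rw [lintegral_prod _ (by
    exact hψm.enorm.mul ((hf.comp measurable_snd).enorm.mul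
      (hg.comp ((hz.comp measurable_fst).sub measurable_snd)).enorm).aemeasurable)]
  calc _ ≤ ∫⁻ x, ‖ψ x‖ₑ * ((∫⁻ a, ‖f a‖ₑ ^ 2 ∂μ) + ∫⁻ a, ‖g a‖ₑ ^ 2 ∂μ) ∂ν := by
        refine lintegral_mono fun x => ?_
        dsimp only
        rw [lintegral_const_mul' _ _ enorm_ne_top]
        gcongr
        exact lintegral_mul_sub_le (g := fun a => ‖g a‖ₑ) hf.enorm (z x)
    _ = (∫⁻ x, ‖ψ x‖ₑ ∂ν) * ((∫⁻ a, ‖f a‖ₑ ^ 2 ∂μ) + ∫⁻ a, ‖g a‖ₑ ^ 2 ∂μ) :=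
        lintegral_mul_const' _ _ (ENNReal.add_ne_top.2 ⟨hf2, hg2⟩)
    _ < ∞ := ENNReal.mul_lt_top (hasFiniteIntegral_iff_enorm.1 hψ.2)
        (ENNReal.add_lt_top.2 ⟨hf2.lt_top, hg2.lt_top⟩)

/-! ### The Fourier transform of a product of two square integrable functions -/

theorem MeasureTheory.MemLp.lintegral_enorm_sq_ne_top {α : Type*} [MeasurableSpace α]
    {μ : Measure α} {f : α → ℂ} (hf : MemLp f 2 μ) : ∫⁻ a, ‖f a‖ₑ ^ 2 ∂μ ≠ ∞ := by
  have h := lintegral_rpow_enorm_lt_top_of_eLpNorm_lt_top two_ne_zero ENNReal.ofNat_ne_top hf.2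
  simp only [ENNReal.toReal_ofNat, ENNReal.rpow_two] at h
  exact h.ne

theorem memLp_two_of_lintegral {α : Type*} [MeasurableSpace α]
    {μ : Measure α} {f : α → ℂ} (hf : AEStronglyMeasurable f μ)
    (h : ∫⁻ a, ‖f a‖ₑ ^ 2 ∂μ ≠ ∞) : MemLp f 2 μ := by
  refine ⟨hf, (eLpNorm_lt_top_iff_lintegral_rpow_enorm_lt_top two_ne_zero
    ENNReal.ofNat_ne_top).2 ?_⟩
  simp only [ENNReal.toReal_ofNat, ENNReal.rpow_two]
  exact h.lt_top

/-- Multiplication formula for the Fourier transform on `L²`. -/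
theorem integral_mul_eq_integral_fourier_mul (U W : Lp ℂ 2 (volume : Measure Plane)) :
    ∫ x, U x * W x = ∫ p, (𝓕 U : Lp ℂ 2 (volume : Measure Plane)) p *
      (𝓕⁻ W : Lp ℂ 2 (volume : Measure Plane)) p := by
  have hl : ∀ U W : Lp ℂ 2 (volume : Measure Plane), ∫ x, U x * W x =
      (ContinuousLinearMap.mul ℂ ℂ).lpPairing volume 2 2 U W := fun U W =>
    ((ContinuousLinearMap.mul ℂ ℂ).lpPairing_eq_integral U W).symm
  -- Both sides are continuous in W, and for W a Schwartz function the formula is the definition of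
  -- the Fourier transform of the tempered distribution U.
  refine DenseRange.induction_on
    (p := fun W => ∫ x, U x * W x = ∫ p, (𝓕 U : Lp ℂ 2 (volume : Measure Plane)) p *
      (𝓕⁻ W : Lp ℂ 2 (volume : Measure Plane)) p)
    (SchwartzMap.denseRange_toLpCLM (E := Plane) (F := ℂ) (p := 2) (μ := volume)
      ENNReal.ofNat_ne_top) W ?_ ?_
  · simp only [hl]
    exact isClosed_eq (ContinuousLinearMap.continuous _)
      ((ContinuousLinearMap.continuous _).comp
        (ContinuousFourierInv.continuous_fourierInv (E := Lp ℂ 2 (volume : Measure Plane))))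
  · intro w
    have h1 := congrArg (fun T : 𝓢'(Plane, ℂ) => T (𝓕⁻ w)) (Lp.fourier_toTemperedDistribution_eq U)
    simp only [TemperedDistribution.fourier_apply, Lp.toTemperedDistribution_apply,
      FourierTransform.fourier_fourierInv_eq, smul_eq_mul] at h1
    change ∫ x, U x * (w.toLp 2 volume) x = ∫ p, (𝓕 U : Lp ℂ 2 (volume : Measure Plane)) p *
      (𝓕⁻ (w.toLp 2 volume) : Lp ℂ 2 (volume : Measure Plane)) p
    rw [SchwartzMap.toLp_fourierInv_eq]
    refine Eq.trans (integral_congr_ae ?_) (h1.trans (integral_congr_ae ?_))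
    · filter_upwards [w.coeFn_toLp 2 volume] with x hx
      rw [hx, mul_comm]
    · filter_upwards [(𝓕⁻ w).coeFn_toLp 2 volume] with x hx
      rw [hx, mul_comm]

theorem fourier_modulate (v : Plane → ℂ) (p p' : Plane) :
    𝓕 (fun x : Plane => 𝐞 (inner ℝ x p) • v x) p' = 𝓕 v (p' - p) := by
  rw [Real.fourier_eq, Real.fourier_eq]
  refine integral_congr_ae (Filter.Eventually.of_forall fun x => ?_)
  dsimp only
  rw [smul_smul, ← AddChar.map_add_eq_mul, inner_sub_right]
  congr 2
  ring

/-- The inverse Fourier transform of `v 𝓕ψ` is a convolution. -/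
theorem fourierInv_mul_fourier (v ψ : 𝓢(Plane, ℂ)) (p : Plane) :
    𝓕⁻ (SchwartzMap.pairing (ContinuousLinearMap.mul ℂ ℂ) v (𝓕 ψ)) p =
      ∫ p', ψ p' * (𝓕 v) (p' - p) := by
  have hg : Integrable fun x : Plane => 𝐞 (inner ℝ x p) • v x := by
    have h : Continuous fun x : Plane => 𝐞 (inner ℝ x p) :=
      Real.continuous_fourierChar.comp (by fun_prop)
    refine v.integrable.mono (h.smul v.continuous).aestronglyMeasurable
      (Filter.Eventually.of_forall fun x => ?_)
    rw [Circle.norm_smul]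
  have h := VectorFourier.integral_fourierIntegral_smul_eq_flip (L := innerₗ Plane)
    (μ := volume) (ν := volume) Real.continuous_fourierChar continuous_inner ψ.integrable hg
  rw [flip_innerₗ] at h
  rw [SchwartzMap.fourierInv_coe, Real.fourierInv_eq]
  calc _ = ∫ x, 𝓕 (ψ : Plane → ℂ) x • (𝐞 (inner ℝ x p) • v x) := by
        refine integral_congr_ae (Filter.Eventually.of_forall fun x => ?_)
        simp only [SchwartzMap.pairing_apply_apply, ContinuousLinearMap.mul_apply', smul_eq_mul,
          SchwartzMap.fourier_coe, Circle.smul_def]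
        ring
    _ = ∫ x, ψ x • 𝓕 (fun x : Plane => 𝐞 (inner ℝ x p) • v x) x := h
    _ = _ := by simp only [fourier_modulate, smul_eq_mul, SchwartzMap.fourier_coe]

theorem integral_mul_integral_sub_swap {f g ψ : Plane → ℂ} (hf : Measurable f) (hg : Measurable g)
    (hf2 : ∫⁻ a, ‖f a‖ₑ ^ 2 ≠ ∞) (hg2 : ∫⁻ a, ‖g a‖ₑ ^ 2 ≠ ∞) (hψ : Integrable ψ) :
    ∫ p, f p * ∫ p', ψ p' * g (p' - p) = ∫ p', ψ p' * ∫ p, f p * g (p' - p) := by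
  have h := integrable_mul_sub (μ := (volume : Measure Plane)) hf hg hf2 hg2 hψ measurable_id
  simp only [← integral_const_mul]
  rw [integral_integral_swap (f := fun p' p => ψ p' * (f p * g (p' - p))) h]
  refine integral_congr_ae (Filter.Eventually.of_forall fun p => ?_)
  refine integral_congr_ae (Filter.Eventually.of_forall fun p' => ?_)
  dsimp only
  ring

theorem integrable_mul_integral_sub {f g ψ : Plane → ℂ} (hf : Measurable f) (hg : Measurable g)
    (hf2 : ∫⁻ a, ‖f a‖ₑ ^ 2 ≠ ∞) (hg2 : ∫⁻ a, ‖g a‖ₑ ^ 2 ≠ ∞) (hψ : Integrable ψ) :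
    Integrable fun p => f p * ∫ p', ψ p' * g (p' - p) := by
  have h := integrable_mul_sub (μ := (volume : Measure Plane)) hf hg hf2 hg2 hψ measurable_id
  refine h.integral_prod_right.congr (Filter.Eventually.of_forall fun p => ?_)
  dsimp only
  rw [← integral_const_mul]
  refine integral_congr_ae (Filter.Eventually.of_forall fun p' => ?_)
  simp only [id]
  ring

theorem integral_mul_sub_comm (f g : Plane → ℂ) (z : Plane) :
    ∫ p, f p * g (z - p) = ∫ p, g p * f (z - p) := by
  rw [← integral_sub_left_eq_self _ volume z]
  simp only [sub_sub_cancel, mul_comm]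

theorem measurable_coeFn_Lp (U : Lp ℂ 2 (volume : Measure Plane)) : Measurable U :=
  (Lp.stronglyMeasurable U).measurable

/-- The pairing of a product of two `L²` functions with the Fourier transform of a Schwartz
function. -/
theorem integral_fourier_mul_mul (U V : Lp ℂ 2 (volume : Measure Plane)) (ψ : 𝓢(Plane, ℂ)) :
    ∫ x, 𝓕 ψ x * (U x * V x) = ∫ p', ψ p' * ∫ p, (𝓕 U : Lp ℂ 2 (volume : Measure Plane)) p *
      (𝓕 V : Lp ℂ 2 (volume : Measure Plane)) (p' - p) := by
  -- The triple product is read as the pairing of V with W = 𝓕ψ · U, so that only products of two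
  -- square integrable functions are transformed.
  have hW : MemLp (fun x => 𝓕 ψ x * U x) 2 volume :=
    (Lp.memLp U).mul ((𝓕 ψ).memLp_top)
  set W := hW.toLp with hWdef
  set Uh := (𝓕 U : Lp ℂ 2 (volume : Measure Plane)) with hUh
  set Vh := (𝓕 V : Lp ℂ 2 (volume : Measure Plane)) with hVh
  have mU := measurable_coeFn_Lp Uh
  have mV := measurable_coeFn_Lp Vh
  have fU := (Lp.memLp Uh).lintegral_enorm_sq_ne_top
  have fV := (Lp.memLp Vh).lintegral_enorm_sq_ne_top
  -- The inverse transform of W is identified by testing against φ: the multiplication formula moves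
  -- the transform to the Schwartz function 𝓕⁻φ · 𝓕ψ, for which it is an explicit convolution.
  have hR : ((𝓕⁻ W : Lp ℂ 2 (volume : Measure Plane)) : Plane → ℂ) =ᵐ[volume]
      fun p => ∫ p', ψ p' * Uh (p' - p) := by
    refine ae_eq_of_schwartz (fun φ => ?_) (fun φ => ?_) (fun φ => ?_)
    · have := (Lp.memLp (𝓕⁻ W : Lp ℂ 2 (volume : Measure Plane))).mul' (φ.memLp 2 volume) (r := 1)
      exact memLp_one_iff_integrable.1 this
    · exact integrable_mul_integral_sub φ.continuous.measurable mU
        (φ.memLp 2 volume).lintegral_enorm_sq_ne_top fU ψ.integrable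
    · have fφ := (φ.memLp 2 volume).lintegral_enorm_sq_ne_top
      have mφ := φ.continuous.measurable
      have h1 := integral_mul_eq_integral_fourier_mul ((𝓕⁻ φ).toLp 2 volume) W
      rw [SchwartzMap.toLp_fourier_eq, FourierTransform.fourier_fourierInv_eq] at h1
      have h2 := integral_mul_eq_integral_fourier_mul U
        ((SchwartzMap.pairing (ContinuousLinearMap.mul ℂ ℂ) (𝓕⁻ φ) (𝓕 ψ)).toLp 2 volume)
      rw [SchwartzMap.toLp_fourierInv_eq] at h2
      calc ∫ p, φ p * (𝓕⁻ W : Lp ℂ 2 (volume : Measure Plane)) p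
          = ∫ x, ((𝓕⁻ φ).toLp 2 volume) x * W x := by
            rw [h1]
            refine integral_congr_ae ?_
            filter_upwards [φ.coeFn_toLp 2 volume] with x hx
            rw [hx]
        _ = ∫ x, U x * ((SchwartzMap.pairing (ContinuousLinearMap.mul ℂ ℂ) (𝓕⁻ φ)
              (𝓕 ψ)).toLp 2 volume) x := by
            refine integral_congr_ae ?_
            filter_upwards [(𝓕⁻ φ).coeFn_toLp 2 volume, hW.coeFn_toLp,
              (SchwartzMap.pairing (ContinuousLinearMap.mul ℂ ℂ) (𝓕⁻ φ) (𝓕 ψ)).coeFn_toLp 2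
                volume] with x e1 e2 e3
            rw [e1, e2, e3, SchwartzMap.pairing_apply_apply, ContinuousLinearMap.mul_apply']
            ring
        _ = ∫ p, Uh p * ∫ p', ψ p' * φ (p' - p) := by
            rw [h2]
            refine integral_congr_ae ?_
            filter_upwards [(𝓕⁻ (SchwartzMap.pairing (ContinuousLinearMap.mul ℂ ℂ) (𝓕⁻ φ)
              (𝓕 ψ))).coeFn_toLp 2 volume] with x e1
            rw [e1, fourierInv_mul_fourier, FourierTransform.fourier_fourierInv_eq]
        _ = ∫ p', ψ p' * ∫ p, φ p * Uh (p' - p) := by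
            rw [integral_mul_integral_sub_swap mU mφ fU fφ ψ.integrable]
            simp only [integral_mul_sub_comm Uh φ]
        _ = _ := (integral_mul_integral_sub_swap mφ mU fφ fU ψ.integrable).symm
  calc _ = ∫ x, V x * W x := by
        refine integral_congr_ae ?_
        filter_upwards [hW.coeFn_toLp] with x hx
        rw [hx]; ring
    _ = ∫ p, Vh p * ∫ p', ψ p' * Uh (p' - p) := by
        rw [integral_mul_eq_integral_fourier_mul V W]
        refine integral_congr_ae ?_
        filter_upwards [hR] with x hx
        rw [hx]
    _ = _ := by
        rw [integral_mul_integral_sub_swap mV mU fV fU ψ.integrable]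
        simp only [integral_mul_sub_comm Vh Uh]

/-! ### Fourier coefficients in the periodic variable -/

/-- The Fourier coefficients of a product are the convolution of the Fourier coefficients. -/
theorem hasSum_fourierCoeff_mul {f g : Torus → ℂ} (hf : MemLp f 2 AddCircle.haarAddCircle)
    (hg : MemLp g 2 AddCircle.haarAddCircle) (q : ℤ) :
    HasSum (fun k => fourierCoeff f k * fourierCoeff g (q - k))
      (fourierCoeff (fun y => f y * g y) q) := by
  have hc : Continuous fun y : Torus => (fourier q y : ℂ) := (fourier q).continuous
  -- The conjugate undoes the one in the inner product, so Parseval's identity for h and f yields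
  -- the coefficient of fg.
  have hh : MemLp (fun y : Torus => (starRingEnd ℂ) (fourier (-q) y * g y)) 2
      AddCircle.haarAddCircle := by
    refine hg.of_le (RCLike.continuous_conj.comp_aestronglyMeasurable
      ((fourier (-q)).continuous.aestronglyMeasurable.mul hg.1))
      (Filter.Eventually.of_forall fun z => ?_)
    rw [RCLike.norm_conj, norm_mul, fourier_apply, Circle.norm_coe, one_mul]
  have h := fourierBasis.hasSum_inner_mul_inner hh.toLp hf.toLp
  have e1 : ∀ k, inner ℂ (fourierBasis k) hf.toLp = fourierCoeff f k := fun k => by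
    rw [← HilbertBasis.repr_apply_apply, fourierBasis_repr, fourierCoeff_congr_ae hf.coeFn_toLp]
  have e2 : ∀ k, inner ℂ hh.toLp (fourierBasis (T := 2 * π) k) = fourierCoeff g (q - k) :=
    fun k => by
    rw [L2.inner_def, fourierCoeff, coe_fourierBasis]
    refine integral_congr_ae ?_
    filter_upwards [hh.coeFn_toLp, coeFn_fourierLp (T := 2 * π) 2 k] with y h1 h2
    rw [h1, h2, RCLike.inner_apply, Complex.conj_conj, smul_eq_mul, neg_sub, sub_eq_add_neg,
      fourier_add]
    ring
  have e3 : inner ℂ hh.toLp hf.toLp = fourierCoeff (fun y => f y * g y) q := by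
    rw [L2.inner_def, fourierCoeff]
    refine integral_congr_ae ?_
    filter_upwards [hh.coeFn_toLp, hf.coeFn_toLp] with y h1 h2
    rw [h1, h2, RCLike.inner_apply, Complex.conj_conj, smul_eq_mul]
    ring
  simp only [e1, e2, e3] at h
  simpa only [mul_comm] using h

theorem tsum_enorm_fourierCoeff_sq {f : Torus → ℂ} (hf : MemLp f 2 AddCircle.haarAddCircle) :
    ∑' k, ‖fourierCoeff f k‖ₑ ^ 2 = ∫⁻ y, ‖f y‖ₑ ^ 2 ∂AddCircle.haarAddCircle := by
  have h := hasSum_sq_fourierCoeff hf.toLp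
  rw [fourierCoeff_congr_ae hf.coeFn_toLp] at h
  have e : ∀ z : ℂ, ‖z‖ₑ ^ 2 = ENNReal.ofReal (‖z‖ ^ 2) := fun z => by
    rw [ENNReal.ofReal_pow (norm_nonneg _), ofReal_norm]
  simp only [e]
  rw [← ENNReal.ofReal_tsum_of_nonneg (fun _ => by positivity) h.summable, h.tsum_eq,
    ofReal_integral_eq_lintegral_ofReal (Lp.memLp hf.toLp).integrable_norm_pow'
      (Filter.Eventually.of_forall fun _ => by positivity)]
  refine lintegral_congr_ae ?_
  filter_upwards [hf.coeFn_toLp] with y hy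
  rw [hy]

/-- The Fourier coefficients in `y` of a function on space-time. -/
def sliceCoeff (u : SpaceTime → ℂ) (q : ℤ) (x : Plane) : ℂ := fourierCoeff (fun y => u (x, y)) q

theorem aestronglyMeasurable_sliceCoeff {p : ℝ≥0∞} {u : SpaceTime → ℂ} (hu : MemLp u p stMeasure)
    (q : ℤ) : AEStronglyMeasurable (sliceCoeff u q) volume :=
  (memLp_fourier_mul hu q).1.integral_prod_right'

theorem lintegral_enorm_sq_slice {u : SpaceTime → ℂ} (hu : MemLp u 2 stMeasure) :
    ∫⁻ x, ∫⁻ y, ‖u (x, y)‖ₑ ^ 2 ∂AddCircle.haarAddCircle = ∫⁻ z, ‖u z‖ₑ ^ 2 ∂stMeasure :=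
  (lintegral_prod _ (hu.1.enorm.pow_const 2)).symm

theorem memLp_slice {u : SpaceTime → ℂ} (hu : MemLp u 2 stMeasure) :
    ∀ᵐ x : Plane, MemLp (fun y => u (x, y)) 2 AddCircle.haarAddCircle := by
  have h1 : ∀ᵐ x : Plane, ∫⁻ y, ‖u (x, y)‖ₑ ^ 2 ∂AddCircle.haarAddCircle < ∞ := by
    refine ae_lt_top' (hu.1.enorm.pow_const 2).lintegral_prod_right' ?_
    rw [lintegral_enorm_sq_slice hu]
    exact hu.lintegral_enorm_sq_ne_top
  filter_upwards [hu.1.prodMk_left, h1] with x h2 h3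
  exact memLp_two_of_lintegral h2 h3.ne

theorem tsum_lintegral_enorm_sliceCoeff_sq {u : SpaceTime → ℂ} (hu : MemLp u 2 stMeasure) :
    ∑' k, ∫⁻ x, ‖sliceCoeff u k x‖ₑ ^ 2 = ∫⁻ z, ‖u z‖ₑ ^ 2 ∂stMeasure := by
  rw [← lintegral_tsum fun k => (aestronglyMeasurable_sliceCoeff hu k).enorm.pow_const 2,
    ← lintegral_enorm_sq_slice hu]
  refine lintegral_congr_ae ?_
  filter_upwards [memLp_slice hu] with x hx
  exact tsum_enorm_fourierCoeff_sq hx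

theorem memLp_sliceCoeff {u : SpaceTime → ℂ} (hu : MemLp u 2 stMeasure) (q : ℤ) :
    MemLp (sliceCoeff u q) 2 volume := by
  refine memLp_two_of_lintegral (aestronglyMeasurable_sliceCoeff hu q) (ne_top_of_le_ne_top
    hu.lintegral_enorm_sq_ne_top ?_)
  rw [← tsum_lintegral_enorm_sliceCoeff_sq hu]
  exact ENNReal.le_tsum q

theorem integrable_schwartz_mul {p : ℝ≥0∞} [hp : Fact (1 ≤ p)] {w : SpaceTime → ℂ}
    (hw : MemLp w p stMeasure) (q : ℤ) (φ : 𝓢(Plane, ℂ)) :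
    Integrable (fun z : SpaceTime => φ z.1 * fourier (-q) z.2 * w z) stMeasure := by
  have := ENNReal.HolderConjugate.inv_one_sub_inv' hp.out
  have h := (memLp_fourier_mul hw q).mul'
    ((φ.memLp (1 - p⁻¹)⁻¹ volume).comp_measurePreserving measurePreserving_fst_stMeasure) (r := 1)
  refine (memLp_one_iff_integrable.1 h).congr (Filter.Eventually.of_forall fun z => ?_)
  simp only [Function.comp_apply]
  ring

theorem ofFunction_apply_eq_integral_sliceCoeff {p : ℝ≥0∞} [hp : Fact (1 ≤ p)] {w : SpaceTime → ℂ}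
    (hw : MemLp w p stMeasure) (q : ℤ) (φ : 𝓢(Plane, ℂ)) :
    ofFunction hw q φ = ∫ x, φ x * sliceCoeff w q x := by
  rw [ofFunction_apply, stMeasure, integral_prod _ (integrable_schwartz_mul hw q φ)]
  refine integral_congr_ae (Filter.Eventually.of_forall fun x => ?_)
  dsimp only [sliceCoeff, fourierCoeff]
  rw [← integral_const_mul]
  simp only [smul_eq_mul, mul_assoc]

theorem ofFunction_eq_toTemperedDistribution {u : SpaceTime → ℂ} (hu : MemLp u 2 stMeasure)
    (q : ℤ) : ofFunction hu q = Lp.toTemperedDistribution (memLp_sliceCoeff hu q).toLp := by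
  ext φ
  rw [ofFunction_apply_eq_integral_sliceCoeff, Lp.toTemperedDistribution_apply]
  refine integral_congr_ae ?_
  filter_upwards [(memLp_sliceCoeff hu q).coeFn_toLp] with x hx
  rw [hx, smul_eq_mul]

/-- The Fourier transform of an `L²` function is given by the Fourier transforms of its
coefficients in `y`. -/
theorem IsFourierTransform.ae_eq_fourier_slice {u : SpaceTime → ℂ} {hu : MemLp u 2 stMeasure}
    {F : ℝ → ℝ → ℤ → ℂ} (hF : IsFourierTransform (ofFunction hu) F) (q : ℤ) :
    (fun p : Plane => F (2 * π * p 0) (2 * π * p 1) q) =ᵐ[volume]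
      (𝓕 (memLp_sliceCoeff hu q).toLp : Lp ℂ 2 (volume : Measure Plane)) := by
  refine ae_eq_of_schwartz (fun φ => ((hF q).2 φ).1) (fun φ => ?_) (fun φ => ?_)
  · have := (Lp.memLp (𝓕 (memLp_sliceCoeff hu q).toLp : Lp ℂ 2 (volume : Measure Plane))).mul'
      (φ.memLp 2 volume) (r := 1)
    exact memLp_one_iff_integrable.1 this
  · rw [← ((hF q).2 φ).2, ofFunction_eq_toTemperedDistribution,
      Lp.fourier_toTemperedDistribution_eq, Lp.toTemperedDistribution_apply]
    simp only [smul_eq_mul]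

theorem sliceCoeff_mul {u v : SpaceTime → ℂ} (hu : MemLp u 2 stMeasure)
    (hv : MemLp v 2 stMeasure) (q : ℤ) :
    ∀ᵐ x : Plane, sliceCoeff (u * v) q x = ∑' k, sliceCoeff u k x * sliceCoeff v (q - k) x := by
  filter_upwards [memLp_slice hu, memLp_slice hv] with x h1 h2
  exact (hasSum_fourierCoeff_mul h1 h2 q).tsum_eq.symm

/-- Each product is at most a sum of squares; k ↦ q − k is a bijection and Parseval's identity sums
the squares. The absolute convergence allows the sum over k to leave the integral. -/
theorem tsum_lintegral_mul_sliceCoeff_ne_top {u v : SpaceTime → ℂ} (hu : MemLp u 2 stMeasure)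
    (hv : MemLp v 2 stMeasure) (q : ℤ) :
    ∑' k, ∫⁻ x, ‖sliceCoeff u k x‖ₑ * ‖sliceCoeff v (q - k) x‖ₑ ≠ ∞ := by
  refine ne_top_of_le_ne_top (ENNReal.add_ne_top.2
    ⟨hu.lintegral_enorm_sq_ne_top, hv.lintegral_enorm_sq_ne_top⟩) ?_
  rw [← tsum_lintegral_enorm_sliceCoeff_sq hu, ← tsum_lintegral_enorm_sliceCoeff_sq hv,
    ← (Equiv.subLeft q).tsum_eq fun k => ∫⁻ x, ‖sliceCoeff v k x‖ₑ ^ 2, ← ENNReal.tsum_add]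
  refine ENNReal.tsum_le_tsum fun k => ?_
  rw [← lintegral_add_left' ((aestronglyMeasurable_sliceCoeff hu k).enorm.pow_const 2)]
  exact lintegral_mono fun x => mul_le_sq_add_sq _ _

/-- The product is only integrable, so its transform is tested against ψ. Parseval's identity in y
resolves it into a sum over k, each term of which is a product of two L² functions on the plane. -/
theorem fourier_ofFunction_mul {u v : SpaceTime → ℂ} {hu : MemLp u 2 stMeasure}
    {hv : MemLp v 2 stMeasure} {F K : ℝ → ℝ → ℤ → ℂ} (hF : IsFourierTransform (ofFunction hu) F)
    (hK : IsFourierTransform (ofFunction hv) K) (q : ℤ) (ψ : 𝓢(Plane, ℂ)) :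
    𝓕 (ofFunction (p := 1) (w := u * v) (hv.mul hu) q) ψ = ∑' k, ∫ p', ψ p' *
      ∫ p : Plane, F (2 * π * p 0) (2 * π * p 1) k *
        K (2 * π * (p' - p) 0) (2 * π * (p' - p) 1) (q - k) := by
  rw [TemperedDistribution.fourier_apply, ofFunction_apply_eq_integral_sliceCoeff]
  set B := ‖(𝓕 ψ).toBoundedContinuousFunction‖
  have hB' : ∀ x, ‖𝓕 ψ x‖ₑ ≤ ENNReal.ofReal B := fun x => by
    rw [← ofReal_norm]
    exact ENNReal.ofReal_le_ofReal ((𝓕 ψ).toBoundedContinuousFunction.norm_coe_le_norm x)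
  calc ∫ x, 𝓕 ψ x * sliceCoeff (u * v) q x
      = ∫ x, ∑' k, 𝓕 ψ x * (sliceCoeff u k x * sliceCoeff v (q - k) x) := by
        refine integral_congr_ae ?_
        filter_upwards [sliceCoeff_mul hu hv q] with x hx
        rw [hx, tsum_mul_left]
    _ = ∑' k, ∫ x, 𝓕 ψ x * (sliceCoeff u k x * sliceCoeff v (q - k) x) := by
        refine integral_tsum (fun k => (𝓕 ψ).continuous.aestronglyMeasurable.mul
          ((aestronglyMeasurable_sliceCoeff hu k).mul
            (aestronglyMeasurable_sliceCoeff hv (q - k)))) ?_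
        refine ne_top_of_le_ne_top (ENNReal.mul_ne_top (ENNReal.ofReal_ne_top (r := B))
          (tsum_lintegral_mul_sliceCoeff_ne_top hu hv q)) ?_
        rw [← ENNReal.tsum_mul_left]
        refine ENNReal.tsum_le_tsum fun k => ?_
        rw [← lintegral_const_mul' _ _ ENNReal.ofReal_ne_top]
        refine lintegral_mono fun x => ?_
        rw [enorm_mul, enorm_mul]
        exact mul_le_mul_left (hB' x) _
    _ = _ := by
        refine tsum_congr fun k => ?_
        have h := integral_fourier_mul_mul (memLp_sliceCoeff hu k).toLp
          (memLp_sliceCoeff hv (q - k)).toLp ψ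
        refine Eq.trans (integral_congr_ae ?_) (h.trans (integral_congr_ae
          (Filter.Eventually.of_forall fun p' => ?_)))
        · filter_upwards [(memLp_sliceCoeff hu k).coeFn_toLp,
            (memLp_sliceCoeff hv (q - k)).coeFn_toLp] with x h1 h2
          rw [h1, h2]
        · dsimp only
          congr 1
          refine integral_congr_ae ?_
          have h2 := (Measure.measurePreserving_sub_left (volume : Measure Plane)
            p').quasiMeasurePreserving.ae_eq_comp (hK.ae_eq_fourier_slice (q - k))
          filter_upwards [hF.ae_eq_fourier_slice k, h2] with p e1 e2
          simp only [Function.comp_apply] at e2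
          rw [← e1, ← e2]

/-! ### The Fourier transform of the product as a convolution -/

/-- Lebesgue measure times counting measure on the frequencies in Mathlib's normalisation. -/
abbrev planeFreqMeasure : Measure (Plane × ℤ) := (volume : Measure Plane).prod Measure.count

instance : planeFreqMeasure.IsNegInvariant where
  neg_eq_self := ((Measure.measurePreserving_neg (volume : Measure Plane)).prod
    (Measure.measurePreserving_neg (Measure.count : Measure ℤ))).map_eq

/-- Fubini's theorem merges the sum over k and the integral over p into one integral over the
frequency space. -/
theorem tsum_integral_mul_integral_sub {f g : Plane × ℤ → ℂ} (hf : Measurable f)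
    (hg : Measurable g) (hf2 : ∫⁻ a, ‖f a‖ₑ ^ 2 ∂planeFreqMeasure ≠ ∞)
    (hg2 : ∫⁻ a, ‖g a‖ₑ ^ 2 ∂planeFreqMeasure ≠ ∞) {ψ : Plane → ℂ} (hψ : Integrable ψ) (q : ℤ) :
    ∑' k, ∫ p', ψ p' * ∫ p, f (p, k) * g (p' - p, q - k) =
      ∫ p', ψ p' * ∫ a, f a * g ((p', q) - a) ∂planeFreqMeasure := by
  have hslice : ∀ {h : Plane × ℤ → ℂ}, Measurable h →
      ∫⁻ a, ‖h a‖ₑ ^ 2 ∂planeFreqMeasure ≠ ∞ → ∀ k, ∫⁻ p, ‖h (p, k)‖ₑ ^ 2 ≠ ∞ := by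
    intro h hh h2 k
    refine ne_top_of_le_ne_top h2 ?_
    rw [lintegral_prod_symm' _ (hh.enorm.pow_const 2), lintegral_count]
    exact ENNReal.le_tsum (f := fun k => ∫⁻ p, ‖h (p, k)‖ₑ ^ 2) k
  have h := integrable_mul_sub hf hg hf2 hg2 hψ (z := fun p' : Plane => (p', q)) (by fun_prop)
  have h' := h.integral_prod_right
  simp only [← integral_const_mul]
  rw [integral_integral_swap (f := fun p' a => ψ p' * (f a * g ((p', q) - a))) h,
    integral_prod_symm _ h', integral_countable h'.integral_prod_right]
  refine tsum_congr fun k => ?_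
  have hs := integral_mul_integral_sub_swap (f := fun p => f (p, k)) (g := fun p => g (p, q - k))
    (by fun_prop) (by fun_prop) (hslice hf hf2 k) (hslice hg hg2 (q - k)) hψ
  rw [Measure.real, Measure.count_singleton, ENNReal.toReal_one, one_smul]
  simp only [integral_const_mul]
  refine hs.symm.trans (integral_congr_ae (Filter.Eventually.of_forall fun p => ?_))
  dsimp only
  rw [← integral_const_mul]
  refine integral_congr_ae (Filter.Eventually.of_forall fun p' => ?_)
  simp only [Prod.mk_sub_mk]
  ring

/-- The dilation by `2π` of the continuous frequencies. -/
def dilateFreq (a : Plane × ℤ) : Freq := (2 * π * a.1 0, 2 * π * a.1 1, a.2)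

@[fun_prop]
theorem measurable_dilateFreq : Measurable dilateFreq := by unfold dilateFreq; fun_prop

theorem dilateFreq_sub (a b : Plane × ℤ) : dilateFreq (a - b) = dilateFreq a - dilateFreq b := by
  simp [dilateFreq, mul_sub]

theorem lintegral_comp_dilateFreq {h : Freq → ℝ≥0∞} (hh : Measurable h) :
    ∫⁻ a, h (dilateFreq a) ∂planeFreqMeasure = dilateConst * ∫⁻ z, h z ∂freqMeasure := by
  rw [planeFreqMeasure, lintegral_prod_symm' (fun a => h (dilateFreq a)) (by fun_prop), lintegral_count,
    lintegral_freqMeasure' hh, ← ENNReal.tsum_mul_left]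
  refine tsum_congr fun q => ?_
  have h1 : Measurable fun x : ℝ × ℝ => h (x.1, x.2, q) := by fun_prop
  have h2 := lintegral_comp_dilate h1
  rw [Measure.volume_eq_prod, lintegral_prod_symm' _ h1] at h2
  exact h2

/-- `F` as a function on the space of frequencies. -/
def uncurryFreq (F : ℝ → ℝ → ℤ → ℂ) (a : Freq) : ℂ := F a.1 a.2.1 a.2.2

/-- The convolution of `F` and `K`, in Mathlib's normalisation of frequencies. -/
def convFreq (F K : ℝ → ℝ → ℤ → ℂ) (z : Freq) : ℂ :=
  ∫ a, uncurryFreq F (dilateFreq a) * uncurryFreq K (z - dilateFreq a) ∂planeFreqMeasure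

theorem measurable_convFreq {F K : ℝ → ℝ → ℤ → ℂ}
    (hF : Measurable (uncurryFreq F)) (hK : Measurable (uncurryFreq K)) :
    Measurable (convFreq F K) := by
  have h : Measurable fun x : Freq × (Plane × ℤ) =>
      uncurryFreq F (dilateFreq x.2) * uncurryFreq K (x.1 - dilateFreq x.2) := by fun_prop
  exact (h.stronglyMeasurable.integral_prod_right' (ν := planeFreqMeasure)).measurable

theorem enorm_convFreq_le {F K : ℝ → ℝ → ℤ → ℂ}
    (hF : Measurable (uncurryFreq F)) (hK : Measurable (uncurryFreq K)) (z : Freq) :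
    ‖convFreq F K z‖ₑ ≤
      dilateConst * ∫⁻ a, enormFreq F a * enormFreq K (z - a) ∂freqMeasure := by
  have h : Measurable fun a : Freq => enormFreq F a * enormFreq K (z - a) :=
    hF.enorm.mul (hK.comp (measurable_const.sub measurable_id)).enorm
  rw [← lintegral_comp_dilateFreq h]
  refine (enorm_integral_le_lintegral_enorm _).trans (le_of_eq ?_)
  simp only [enorm_mul]
  rfl

/-- The Fourier transform of the `x`-derivative of the product of two functions with Fourier
transforms `F` and `K`. -/
def derivConv (F K : ℝ → ℝ → ℤ → ℂ) (τ ξ : ℝ) (q : ℤ) : ℂ :=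
  Complex.I * ξ * convFreq F K (τ, ξ, q)

/-- The derivative acts as 2πi p₁ = iξ at ξ = 2πp₁, and the product acts as a convolution.
Convolving in the undilated variable p matches the normalising factor (2π)⁻¹ of the transform in
three variables. -/
theorem isFourierTransform_dx_mul {u v : SpaceTime → ℂ} {hu : MemLp u 2 stMeasure}
    {hv : MemLp v 2 stMeasure} {F K : ℝ → ℝ → ℤ → ℂ} (hF : IsFourierTransform (ofFunction hu) F)
    (hK : IsFourierTransform (ofFunction hv) K)
    (hF2 : ∫⁻ a, enormFreq F a ^ 2 ∂freqMeasure ≠ ∞)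
    (hK2 : ∫⁻ a, enormFreq K a ^ 2 ∂freqMeasure ≠ ∞) :
    IsFourierTransform (dx (ofFunction (p := 1) (w := u * v) (hv.mul hu))) (derivConv F K) := by
  have mF : Measurable (uncurryFreq F) := measurable_uncurry_freq fun q => (hF q).1
  have mK : Measurable (uncurryFreq K) := measurable_uncurry_freq fun q => (hK q).1
  have mF' : Measurable fun a => uncurryFreq F (dilateFreq a) := by fun_prop
  have mK' : Measurable fun a => uncurryFreq K (dilateFreq a) := by fun_prop
  have hF2' : ∫⁻ a, ‖uncurryFreq F (dilateFreq a)‖ₑ ^ 2 ∂planeFreqMeasure ≠ ∞ := by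
    rw [lintegral_comp_dilateFreq (h := fun z => ‖uncurryFreq F z‖ₑ ^ 2) (by fun_prop)]
    exact ENNReal.mul_ne_top dilateConst_ne_top hF2
  have hK2' : ∫⁻ a, ‖uncurryFreq K (dilateFreq a)‖ₑ ^ 2 ∂planeFreqMeasure ≠ ∞ := by
    rw [lintegral_comp_dilateFreq (h := fun z => ‖uncurryFreq K z‖ₑ ^ 2) (by fun_prop)]
    exact ENNReal.mul_ne_top dilateConst_ne_top hK2
  intro q
  have mC := measurable_convFreq mF mK
  refine ⟨?_, fun φ => ?_⟩
  · unfold derivConv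
    fun_prop
  set e : Plane := EuclideanSpace.single 1 1 with he
  have hconv : ∀ p : Plane, convFreq F K (2 * π * p 0, 2 * π * p 1, q) =
      ∫ a, uncurryFreq F (dilateFreq a) * uncurryFreq K (dilateFreq ((p, q) - a))
        ∂planeFreqMeasure := fun p => by
    simp only [dilateFreq_sub]
    rfl
  -- The multiplier p₁ is moved to the test function, so that the formula for the product without
  -- derivative applies.
  set ψ : 𝓢(Plane, ℂ) := SchwartzMap.smulLeftCLM ℂ (fun x : Plane => ((inner ℝ x e : ℝ) : ℂ)) φ
  have hψ : ∀ p : Plane, ψ p = p 1 * φ p := fun p => by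
    rw [SchwartzMap.smulLeftCLM_apply_apply (by fun_prop)]
    simp [he, PiLp.inner_apply]
  have hpt : ∀ p : Plane, φ p * derivConv F K (2 * π * p 0) (2 * π * p 1) q =
      (2 * π * Complex.I) * (ψ p * convFreq F K (2 * π * p 0, 2 * π * p 1, q)) := fun p => by
    rw [hψ, derivConv]
    push_cast
    ring
  have hint := integrable_mul_sub mF' mK' hF2' hK2' (ψ.integrable (μ := volume))
    (z := fun p' : Plane => (p', q)) (by fun_prop)
  have hint' : Integrable fun p : Plane =>
      ψ p * convFreq F K (2 * π * p 0, 2 * π * p 1, q) := by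
    refine hint.integral_prod_left.congr (Filter.Eventually.of_forall fun p => ?_)
    dsimp only
    rw [hconv, integral_const_mul]
  simp only [hpt]
  refine ⟨hint'.const_mul _, ?_⟩
  rw [integral_const_mul]
  have h1 : 𝓕 (dx (ofFunction (p := 1) (w := u * v) (hv.mul hu)) q) φ =
      (2 * π * Complex.I) * 𝓕 (ofFunction (p := 1) (w := u * v) (hv.mul hu) q) ψ := by
    rw [dx, TemperedDistribution.fourier_lineDerivOp_eq]
    change (2 * π * Complex.I) • (TemperedDistribution.smulLeftCLM ℂ
      (fun x : Plane => ((inner ℝ x e : ℝ) : ℂ)) (𝓕 _)) φ = _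
    rw [TemperedDistribution.smulLeftCLM_apply_apply, smul_eq_mul]
  rw [h1, fourier_ofFunction_mul hF hK]
  simp only [hconv]
  rw [← tsum_integral_mul_integral_sub mF' mK' hF2' hK2' ψ.integrable q]
  rfl

/-! ### Norm estimates for the distributions. -/

theorem exists_isFourierTransform {b b₁ s : ℝ} {T : STDistribution} (h : normX b b₁ s T < ∞) :
    ∃ F, IsFourierTransform T F := by
  by_contra hne
  push Not at hne
  simp [normX, hne] at h

theorem lintegral_enormFreq_sq_ne_top {s : ℝ} (hs : 0 ≤ s) {T : STDistribution}
    {F : ℝ → ℝ → ℤ → ℂ} (hF : IsFourierTransform T F) (h : normX (1 / 2) (1 / 3) s T < ∞) :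
    ∫⁻ a, enormFreq F a ^ 2 ∂freqMeasure ≠ ∞ := by
  rw [normX_high_eq hF] at h
  have h' : weightedEnergy (weightHigh s) (enormFreq F) ≠ ∞ := fun h0 => by
    rw [h0] at h
    simp at h
  refine ne_top_of_le_ne_top h' (lintegral_mono fun a => ?_)
  refine le_mul_of_one_le_left zero_le ?_
  exact ENNReal.one_le_ofReal.2 (one_le_weightHigh hs a)

theorem rpow_half_bilinearBound_le {s : ℝ} {T T' : STDistribution} {F K : ℝ → ℝ → ℤ → ℂ}
    (hF : IsFourierTransform T F) (hK : IsFourierTransform T' K) :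
    bilinearBound s (enormFreq F) (enormFreq K) ^ (1 / 2 : ℝ) ≤
      normX (1 / 2) (1 / 3) s T * normX (15 / 32) 0 s T' +
        normX (15 / 32) 0 s T * normX (1 / 2) (1 / 3) s T' := by
  rw [normX_high_eq hF, normX_high_eq hK, normX_low_eq hF, normX_low_eq hK, bilinearBound,
    ← ENNReal.mul_rpow_of_nonneg _ _ (by norm_num), ← ENNReal.mul_rpow_of_nonneg _ _ (by norm_num)]
  exact ENNReal.rpow_add_le_add_rpow _ _ (by norm_num) (by norm_num)

theorem enorm_derivConv_le {F K : ℝ → ℝ → ℤ → ℂ}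
    (hF : Measurable (uncurryFreq F)) (hK : Measurable (uncurryFreq K)) (τ ξ : ℝ) (q : ℤ) :
    ‖derivConv F K τ ξ q‖ₑ ≤ dilateConst * (ENNReal.ofReal |ξ| *
      ∫⁻ a, enormFreq F a * enormFreq K ((τ, ξ, q) - a) ∂freqMeasure) := by
  have h : ‖Complex.I * (ξ : ℂ)‖ₑ = ENNReal.ofReal |ξ| := by
    rw [← ofReal_norm]; simp
  rw [derivConv, enorm_mul, h, mul_left_comm]
  gcongr
  exact enorm_convFreq_le hF hK _

/-- The norm is an infimum over representatives of the transform, so bounding it with the explicit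
one `derivConv` is enough. -/
theorem exists_normX_dx_mul_le {s : ℝ} (hs : 0 ≤ s) : ∃ C : ℝ≥0, ∀ (u v : SpaceTime → ℂ)
    (hu : MemLp u 2 stMeasure) (hv : MemLp v 2 stMeasure) (F K : ℝ → ℝ → ℤ → ℂ),
    IsFourierTransform (ofFunction hu) F → IsFourierTransform (ofFunction hv) K →
    IsFourierTransform (dx (ofFunction (p := 1) (w := u * v) (hv.mul hu))) (derivConv F K) →
    normX (-1 / 2) (1 / 3) s (dx (ofFunction (p := 1) (w := u * v) (hv.mul hu))) ≤
      C * bilinearBound s (enormFreq F) (enormFreq K) ^ (1 / 2 : ℝ) := by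
  obtain ⟨C, hC⟩ := exists_lintegral_outX_le hs
  refine ⟨dilateConst.toNNReal * C ^ (1 / 2 : ℝ), fun u v hu hv F K hF hK hD => ?_⟩
  have mF : Measurable (uncurryFreq F) := measurable_uncurry_freq fun q => (hF q).1
  have mK : Measurable (uncurryFreq K) := measurable_uncurry_freq fun q => (hK q).1
  have hm := measurable_enormFreq fun q => (hD q).1
  refine (iInf₂_le _ hD).trans ?_
  have key : (∑' q : ℤ, ∫⁻ ξ : ℝ, ∫⁻ τ : ℝ, ENNReal.ofReal (weightX (-1 / 2) (1 / 3) s τ ξ q) *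
      ‖derivConv F K τ ξ q‖ₑ ^ 2) ≤
      dilateConst ^ 2 * (C * bilinearBound s (enormFreq F) (enormFreq K)) := by
    have hw : Measurable fun z : Freq =>
        ENNReal.ofReal (outX s z) * (∫⁻ a, enormFreq F a * enormFreq K (z - a) ∂freqMeasure) ^ 2 := by
      have h1 : Measurable (outX s) := by
        unfold outX weightX jap japZeta modulation
        fun_prop
      have h2 : Measurable fun x : Freq × Freq =>
          enormFreq F x.2 * enormFreq K (x.1 - x.2) :=
        (mF.comp measurable_snd).enorm.mul (mK.comp (measurable_fst.sub measurable_snd)).enorm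
      exact h1.ennreal_ofReal.mul (h2.lintegral_prod_right'.pow_const 2)
    refine le_trans ?_ (mul_le_mul_right (hC (enormFreq F) (enormFreq K) mF.enorm mK.enorm) _)
    rw [lintegral_freqMeasure' hw, ← ENNReal.tsum_mul_left]
    refine ENNReal.tsum_le_tsum fun q => ?_
    rw [← lintegral_const_mul' _ _ (ENNReal.pow_ne_top dilateConst_ne_top)]
    refine lintegral_mono fun ξ => ?_
    rw [← lintegral_const_mul' _ _ (ENNReal.pow_ne_top dilateConst_ne_top)]
    refine lintegral_mono fun τ => ?_
    dsimp only
    have e : ENNReal.ofReal (outX s (τ, ξ, q)) =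
        ENNReal.ofReal (weightX (-1 / 2) (1 / 3) s τ ξ q) * ENNReal.ofReal |ξ| ^ 2 := by
      rw [← ENNReal.ofReal_pow (abs_nonneg _), sq_abs, ← ENNReal.ofReal_mul' (sq_nonneg _)]
      rfl
    calc _ ≤ ENNReal.ofReal (weightX (-1 / 2) (1 / 3) s τ ξ q) * (dilateConst *
          (ENNReal.ofReal |ξ| * ∫⁻ a, enormFreq F a * enormFreq K ((τ, ξ, q) - a)
            ∂freqMeasure)) ^ 2 := by
          gcongr
          exact enorm_derivConv_le mF mK τ ξ q
      _ = _ := by rw [e]; simp only [mul_pow]; ring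
  refine (ENNReal.rpow_le_rpow key (by norm_num : (0 : ℝ) ≤ 1 / 2)).trans (le_of_eq ?_)
  rw [ENNReal.mul_rpow_of_nonneg _ _ (by norm_num), ENNReal.mul_rpow_of_nonneg _ _ (by norm_num),
    ← ENNReal.rpow_natCast, ← ENNReal.rpow_mul, ENNReal.coe_mul,
    ENNReal.coe_toNNReal dilateConst_ne_top, ENNReal.coe_rpow_of_nonneg _ (by norm_num)]
  norm_num [mul_assoc]

theorem exists_normZ_dx_mul_le {s : ℝ} (hs : 0 ≤ s) : ∃ C : ℝ≥0, ∀ (u v : SpaceTime → ℂ)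
    (hu : MemLp u 2 stMeasure) (hv : MemLp v 2 stMeasure) (F K : ℝ → ℝ → ℤ → ℂ),
    IsFourierTransform (ofFunction hu) F → IsFourierTransform (ofFunction hv) K →
    IsFourierTransform (dx (ofFunction (p := 1) (w := u * v) (hv.mul hu))) (derivConv F K) →
    normZ (-1 / 2) s (dx (ofFunction (p := 1) (w := u * v) (hv.mul hu))) ≤
      C * bilinearBound s (enormFreq F) (enormFreq K) ^ (1 / 2 : ℝ) := by
  obtain ⟨C, hC⟩ := exists_lintegral_outZ_le hs
  refine ⟨dilateConst.toNNReal * C ^ (1 / 2 : ℝ), fun u v hu hv F K hF hK hD => ?_⟩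
  have mF : Measurable (uncurryFreq F) := measurable_uncurry_freq fun q => (hF q).1
  have mK : Measurable (uncurryFreq K) := measurable_uncurry_freq fun q => (hK q).1
  refine (iInf₂_le _ hD).trans ?_
  have key : (∑' q : ℤ, ∫⁻ ξ : ℝ, (∫⁻ τ : ℝ, ENNReal.ofReal
      (jap (modulation τ ξ q) ^ ((-1 / 2 : ℝ) - 1 / 2) * japZeta ξ q ^ s) *
      ‖derivConv F K τ ξ q‖ₑ) ^ 2) ≤
      dilateConst ^ 2 * (C * bilinearBound s (enormFreq F) (enormFreq K)) := by
    refine le_trans ?_ (mul_le_mul_right (hC (enormFreq F) (enormFreq K) mF.enorm mK.enorm) _)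
    rw [← ENNReal.tsum_mul_left]
    refine ENNReal.tsum_le_tsum fun q => ?_
    rw [← lintegral_const_mul' _ _ (ENNReal.pow_ne_top dilateConst_ne_top)]
    refine lintegral_mono fun ξ => ?_
    dsimp only
    rw [← mul_pow, ← lintegral_const_mul' _ _ dilateConst_ne_top]
    refine pow_le_pow_left₀ zero_le (lintegral_mono fun τ => ?_) 2
    have e : ENNReal.ofReal (outZ s (τ, ξ, q)) ^ (1 / 2 : ℝ) =
        ENNReal.ofReal (jap (modulation τ ξ q) ^ ((-1 / 2 : ℝ) - 1 / 2) * japZeta ξ q ^ s) *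
          ENNReal.ofReal |ξ| := by
      have h1 : 0 < jap (modulation τ ξ q) := jap_pos _
      have h2 : 0 ≤ japZeta ξ q := Real.sqrt_nonneg _
      rw [← ENNReal.ofReal_mul' (abs_nonneg _), ENNReal.ofReal_rpow_of_nonneg (by
        unfold outZ; positivity) (by norm_num)]
      congr 1
      rw [← Real.sqrt_eq_rpow, Real.sqrt_eq_iff_mul_self_eq (by unfold outZ; positivity)
        (by positivity), outZ, ← sq_abs ξ]
      have e1 : jap (modul (τ, ξ, q)) ^ (-2 : ℝ) =
          (jap (modulation τ ξ q) ^ ((-1 / 2 : ℝ) - 1 / 2)) ^ 2 := by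
        rw [← Real.rpow_mul_natCast h1.le]; norm_num; rfl
      have e2 : japZeta ξ q ^ (2 * s) = (japZeta ξ q ^ s) ^ 2 := by
        rw [← Real.rpow_mul_natCast h2, mul_comm]; norm_num
      rw [e1, e2]
      ring
    calc _ ≤ ENNReal.ofReal (jap (modulation τ ξ q) ^ ((-1 / 2 : ℝ) - 1 / 2) * japZeta ξ q ^ s) *
          (dilateConst * (ENNReal.ofReal |ξ| * ∫⁻ a, enormFreq F a * enormFreq K ((τ, ξ, q) - a)
            ∂freqMeasure)) := by
          gcongr
          exact enorm_derivConv_le mF mK τ ξ q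
      _ = _ := by rw [e]; ring_nf
  refine (ENNReal.rpow_le_rpow key (by norm_num : (0 : ℝ) ≤ 1 / 2)).trans (le_of_eq ?_)
  rw [ENNReal.mul_rpow_of_nonneg _ _ (by norm_num), ENNReal.mul_rpow_of_nonneg _ _ (by norm_num),
    ← ENNReal.rpow_natCast, ← ENNReal.rpow_mul, ENNReal.coe_mul,
    ENNReal.coe_toNNReal dilateConst_ne_top, ENNReal.coe_rpow_of_nonneg _ (by norm_num)]
  norm_num [mul_assoc]

end

theorem proposition2 :
    ∃ β b₁ : ℝ, β < 1 / 2 ∧ 1 / 4 < b₁ ∧ b₁ < 3 / 8 ∧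
      ∀ s : ℝ, 0 ≤ s → ∃ C : ℝ≥0, ∀ (u v : SpaceTime → ℂ)
        (hu : MemLp u 2 stMeasure) (hv : MemLp v 2 stMeasure),
        normX (1 / 2) b₁ s (ofFunction hu) < ∞ →
        normX (1 / 2) b₁ s (ofFunction hv) < ∞ →
        normX (-1 / 2) b₁ s (dx (ofFunction (p := 1) (w := u * v) (hv.mul hu))) ≤
            C * (normX (1 / 2) b₁ s (ofFunction hu) * normX β 0 s (ofFunction hv) +
              normX β 0 s (ofFunction hu) * normX (1 / 2) b₁ s (ofFunction hv)) ∧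
          normZ (-1 / 2) s (dx (ofFunction (p := 1) (w := u * v) (hv.mul hu))) ≤
            C * (normX (1 / 2) b₁ s (ofFunction hu) * normX β 0 s (ofFunction hv) +
              normX β 0 s (ofFunction hu) * normX (1 / 2) b₁ s (ofFunction hv)) := by
  -- β is close enough to 1/2 for all convolution exponents built from 2β = 15/16 to stay above 1.
  -- For b₁ = 1/3 the exponent 1 − 2b₁ = 1/3 matches the cubic resonance, while 1 + 2b₁ = 5/3
  -- suffices for low-frequency inputs.
  refine ⟨15 / 32, 1 / 3, by norm_num, by norm_num, by norm_num, fun s hs => ?_⟩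
  obtain ⟨C₁, hC₁⟩ := exists_normX_dx_mul_le hs
  obtain ⟨C₂, hC₂⟩ := exists_normZ_dx_mul_le hs
  refine ⟨max C₁ C₂, fun u v hu hv h1 h2 => ?_⟩
  obtain ⟨F, hF⟩ := exists_isFourierTransform h1
  obtain ⟨K, hK⟩ := exists_isFourierTransform h2
  have hD := isFourierTransform_dx_mul hF hK (lintegral_enormFreq_sq_ne_top hs hF h1)
    (lintegral_enormFreq_sq_ne_top hs hK h2)
  have hB := rpow_half_bilinearBound_le (s := s) hF hK
  exact ⟨(hC₁ u v hu hv F K hF hK hD).trans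
      (mul_le_mul' (ENNReal.coe_le_coe.2 (le_max_left _ _)) hB),
    (hC₂ u v hu hv F K hF hK hD).trans
      (mul_le_mul' (ENNReal.coe_le_coe.2 (le_max_right _ _)) hB)⟩
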